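/- \textbf{Node Weighted Directed Steiner Tree on acyclic digraphs.} An instance consists of a finite acyclic (simple) digraph $D=(V,A)$, costs $c\in\mathbb{R}_{\ge 0}^V$, a set of terminals $T\subseteq V$ and a root $r\in V$. The task is to find a set $F\subseteq V$ of minimum cost $\sum_{v\in F}c(v)$ such that, for each terminal $t \in T$, both $r$ and $t$ lie in $F$ and there is a directed path from $r$ to $t$ in the subdigraph $(F,E(F))$ of $D$ induced by $F$, or to report that no such set exists. A \emph{tree decomposition} of a graph $G$ consists of a tree and, for each node $x$ of the tree, a bag $B_x\subseteq V(G)$, such that every vertex lies in some bag, the two ends of each edge lie in a common bag, and, whenever a vertex lies in $B_x$ and in $B_y$, it lies in the bags of all nodes on the path of the tree between $x$ and $y$. Its \emph{width} is the size of its largest bag minus one. \textbf{Theorem.} There is an algorithm that, given an instance of Node Weighted Directed Steiner Tree on an acyclic digraph $D$ with $n$ vertices, together with a tree decomposition of the underlying undirected graph of $D$ of width $w$ and with $O(n)$ nodes, solves the instance in time $O(5^{w}\cdot \max(w,1)\cdot n)$. Here the digraph is given by the list of its arcs, and the tree decomposition by the lists of the edges of its tree and of the elements of its bags. Time is the number of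 elementary operations of a random access machine with words of $O(w+\log n)$ bits (with the usual arithmetic on words), on which real numbers can be stored, copied, added, subtracted and compared at unit cost. The algorithm is one fixed program; the constants in $O(5^w\cdot\max(w,1)\cdot n)$ and in $O(w+\log n)$ depend only on the constant in the bound $O(n)$ on the number of nodes of the tree. -/

import Mathlib

open scoped NNReal

/-! ### Node-weighted directed Steiner trees -/

/-- An instance of the Node Weighted Directed Steiner Tree problem on acyclic digraphs whose
vertices are numbered `0, …, n - 1`. -/
structure SteinerInstance (n : ℕ) where
  /-- the digraph -/
  D : Digraph (Fin n)
  /-- `D` has no directed cycle (in particular no loop) -/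
  acyclic : ∀ v, ¬ Relation.TransGen D.Adj v v
  /-- the costs of the vertices -/
  c : Fin n → ℝ≥0
  /-- the terminals -/
  T : Finset (Fin n)
  /-- the root -/
  r : Fin n

namespace SteinerInstance

variable {n : ℕ} (I : SteinerInstance n)

/-- In the digraph `(F, E(F))` induced by `F` there is a directed path from `u` to `v`. -/
def ConnectedIn (F : Finset (Fin n)) (u v : Fin n) : Prop :=
  u ∈ F ∧ v ∈ F ∧ Relation.ReflTransGen (fun a b => a ∈ F ∧ b ∈ F ∧ I.D.Adj a b) u v

/-- `F` is a feasible solution: the root is connected to every terminal in `(F, E(F))`. -/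
def Feasible (F : Finset (Fin n)) : Prop := ∀ t ∈ I.T, I.ConnectedIn F I.r t

/-- The cost of a set of vertices. -/
def cost (F : Finset (Fin n)) : ℝ≥0 := ∑ v ∈ F, I.c v

/-- `F` is a feasible solution of minimum cost. -/
def Optimal (F : Finset (Fin n)) : Prop :=
  I.Feasible F ∧ ∀ F', I.Feasible F' → I.cost F ≤ I.cost F'

end SteinerInstance

/-! ### Tree decompositions -/

/-- A tree decomposition of the graph `G`, whose tree has the node set `ι`. -/
structure TreeDecomposition {V : Type*} (G : SimpleGraph V) (ι : Type*) where
  /-- the tree -/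
  tree : SimpleGraph ι
  isTree : tree.IsTree
  /-- the bags -/
  bag : ι → Finset V
  cover : ∀ v, ∃ x, v ∈ bag x
  path : ∀ (v : V) (x y : ι) (p : tree.Walk x y), p.IsPath → v ∈ bag x → v ∈ bag y →
    ∀ z ∈ p.support, v ∈ bag z
  edge : ∀ u v, G.Adj u v → ∃ x, u ∈ bag x ∧ v ∈ bag x

/-- The width: the size of the largest bag minus one. -/
def TreeDecomposition.width {V ι : Type*} [Fintype ι] {G : SimpleGraph V}
    (𝒯 : TreeDecomposition G ι) : ℕ :=
  (Finset.univ.sup fun x => (𝒯.bag x).card) - 1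

/-! ### The machine model

A random access machine with finitely many (per program) word registers, real registers, word
arrays and real arrays. A word is a natural number below `2 ^ W`; on words the machine has the
arithmetic of a word RAM. Real numbers can only be copied, added, subtracted and compared.
Every operation takes one unit of time. An operation on words whose result does not fit into
`W` bits is an error (there is then no execution). -/

namespace RAM

/-- A memory state. -/
structure Store where
  /-- the word registers -/
  word : ℕ → ℕ
  /-- the real registers -/
  real : ℕ → ℝ
  /-- the word arrays: `wmem a i` is the entry of index `i` of the array with the name `a` -/
  wmem : ℕ → ℕ → ℕ
  /-- the real arrays -/
  rmem : ℕ → ℕ → ℝ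

/-- All words of the state have at most `W` bits. -/
def Store.FitsIn (W : ℕ) (s : Store) : Prop :=
  (∀ x, s.word x < 2 ^ W) ∧ ∀ a i, s.wmem a i < 2 ^ W

/-- Expressions of type word. -/
inductive WExp where
  | const (k : ℕ)
  | reg (x : ℕ)
  | load (a : ℕ) (i : WExp)
  | add (e f : WExp)
  | sub (e f : WExp)
  | mul (e f : WExp)
  | div (e f : WExp)
  | mod (e f : WExp)

namespace WExp

/-- The value of a word expression (subtraction is truncated at `0`). -/
def eval (s : Store) : WExp → ℕ
  | const k => k
  | reg x => s.word x
  | load a i => s.wmem a (i.eval s)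
  | add e f => e.eval s + f.eval s
  | sub e f => e.eval s - f.eval s
  | mul e f => e.eval s * f.eval s
  | div e f => e.eval s / f.eval s
  | mod e f => e.eval s % f.eval s

/-- The number of operations in a word expression. -/
def time : WExp → ℕ
  | const _ => 1
  | reg _ => 1
  | load _ i => i.time + 1
  | add e f => e.time + f.time + 1
  | sub e f => e.time + f.time + 1
  | mul e f => e.time + f.time + 1
  | div e f => e.time + f.time + 1
  | mod e f => e.time + f.time + 1

/-- The evaluation of the expression causes no overflow: the value of every subexpression has at
most `W` bits. -/
def Fits (W : ℕ) (s : Store) : WExp → Prop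
  | const k => k < 2 ^ W
  | reg x => s.word x < 2 ^ W
  | load a i => i.Fits W s ∧ s.wmem a (i.eval s) < 2 ^ W
  | add e f => e.Fits W s ∧ f.Fits W s ∧ e.eval s + f.eval s < 2 ^ W
  | sub e f => e.Fits W s ∧ f.Fits W s
  | mul e f => e.Fits W s ∧ f.Fits W s ∧ e.eval s * f.eval s < 2 ^ W
  | div e f => e.Fits W s ∧ f.Fits W s
  | mod e f => e.Fits W s ∧ f.Fits W s

end WExp

/-- Expressions of type real. -/
inductive RExp where
  | zero
  | reg (x : ℕ)
  | load (a : ℕ) (i : WExp)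
  | add (e f : RExp)
  | sub (e f : RExp)

namespace RExp

/-- The value of a real expression. -/
noncomputable def eval (s : Store) : RExp → ℝ
  | zero => 0
  | reg x => s.real x
  | load a i => s.rmem a (i.eval s)
  | add e f => e.eval s + f.eval s
  | sub e f => e.eval s - f.eval s

/-- The number of operations in a real expression. -/
def time : RExp → ℕ
  | zero => 1
  | reg _ => 1
  | load _ i => i.time + 1
  | add e f => e.time + f.time + 1
  | sub e f => e.time + f.time + 1

/-- The index computations cause no overflow. -/
def Fits (W : ℕ) (s : Store) : RExp → Prop
  | zero => True
  | reg _ => True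
  | load _ i => i.Fits W s
  | add e f => e.Fits W s ∧ f.Fits W s
  | sub e f => e.Fits W s ∧ f.Fits W s

end RExp

/-- Tests. -/
inductive Test where
  | wlt (e f : WExp)
  | weq (e f : WExp)
  | rle (e f : RExp)
  | not (b : Test)
  | and (b b' : Test)

namespace Test

/-- The test succeeds. -/
def Holds (s : Store) : Test → Prop
  | wlt e f => e.eval s < f.eval s
  | weq e f => e.eval s = f.eval s
  | rle e f => e.eval s ≤ f.eval s
  | not b => ¬ b.Holds s
  | and b b' => b.Holds s ∧ b'.Holds s

/-- The number of operations in a test. -/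
def time : Test → ℕ
  | wlt e f => e.time + f.time + 1
  | weq e f => e.time + f.time + 1
  | rle e f => e.time + f.time + 1
  | not b => b.time + 1
  | and b b' => b.time + b'.time + 1

/-- The evaluation of the test causes no overflow. -/
def Fits (W : ℕ) (s : Store) : Test → Prop
  | wlt e f => e.Fits W s ∧ f.Fits W s
  | weq e f => e.Fits W s ∧ f.Fits W s
  | rle e f => e.Fits W s ∧ f.Fits W s
  | not b => b.Fits W s
  | and b b' => b.Fits W s ∧ b'.Fits W s

end Test

/-- Programs. -/
inductive Prog where
  | skip
  | setWord (x : ℕ) (e : WExp)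
  | setReal (x : ℕ) (e : RExp)
  | storeWord (a : ℕ) (i e : WExp)
  | storeReal (a : ℕ) (i : WExp) (e : RExp)
  | seq (p q : Prog)
  | ite (b : Test) (p q : Prog)
  | while (b : Test) (p : Prog)

/-- `Exec W p s k s'`: on a machine with `W`-bit words, the program `p`, started in the state `s`,
halts after `k` steps in the state `s'`, without any overflow. -/
inductive Exec (W : ℕ) : Prog → Store → ℕ → Store → Prop where
  | skip (s : Store) : Exec W .skip s 1 s
  | setWord (x : ℕ) (e : WExp) (s : Store) : e.Fits W s →
      Exec W (.setWord x e) s (e.time + 1)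
        { s with word := Function.update s.word x (e.eval s) }
  | setReal (x : ℕ) (e : RExp) (s : Store) : e.Fits W s →
      Exec W (.setReal x e) s (e.time + 1)
        { s with real := Function.update s.real x (e.eval s) }
  | storeWord (a : ℕ) (i e : WExp) (s : Store) : i.Fits W s → e.Fits W s →
      Exec W (.storeWord a i e) s (i.time + e.time + 1)
        { s with wmem := Function.update s.wmem a
                  (Function.update (s.wmem a) (i.eval s) (e.eval s)) }
  | storeReal (a : ℕ) (i : WExp) (e : RExp) (s : Store) : i.Fits W s → e.Fits W s →
      Exec W (.storeReal a i e) s (i.time + e.time + 1)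
        { s with rmem := Function.update s.rmem a
                  (Function.update (s.rmem a) (i.eval s) (e.eval s)) }
  | seq {p q : Prog} {s s' s'' : Store} {k l : ℕ} : Exec W p s k s' → Exec W q s' l s'' →
      Exec W (.seq p q) s (k + l) s''
  | iteTrue {b : Test} {p q : Prog} {s s' : Store} {k : ℕ} : b.Fits W s → b.Holds s →
      Exec W p s k s' → Exec W (.ite b p q) s (b.time + 1 + k) s'
  | iteFalse {b : Test} {p q : Prog} {s s' : Store} {k : ℕ} : b.Fits W s → ¬ b.Holds s →
      Exec W q s k s' → Exec W (.ite b p q) s (b.time + 1 + k) s'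
  | whileTrue {b : Test} {p : Prog} {s s' s'' : Store} {k l : ℕ} : b.Fits W s → b.Holds s →
      Exec W p s k s' → Exec W (.while b p) s' l s'' →
      Exec W (.while b p) s (b.time + 1 + k + l) s''
  | whileFalse {b : Test} {p : Prog} {s : Store} : b.Fits W s → ¬ b.Holds s →
      Exec W (.while b p) s (b.time + 1) s

end RAM

/-! ### Input and output conventions -/

/-- The lists by which an instance of the Steiner problem, together with a tree decomposition of
its underlying undirected graph with nodes `0, …, t - 1`, is presented to the machine. Each list
is in an arbitrary order. -/
structure SteinerInput (n t : ℕ) where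
  /-- the instance -/
  I : SteinerInstance n
  /-- the tree decomposition -/
  𝒯 : TreeDecomposition I.D.toSimpleGraphInclusive (Fin t)
  /-- the arcs of the digraph -/
  arcs : List (Fin n × Fin n)
  arcs_nodup : arcs.Nodup
  mem_arcs : ∀ u v, (u, v) ∈ arcs ↔ I.D.Adj u v
  /-- the elements of the bags -/
  bags : Fin t → List (Fin n)
  bags_nodup : ∀ x, (bags x).Nodup
  mem_bags : ∀ x v, v ∈ bags x ↔ v ∈ 𝒯.bag x
  /-- the edges of the tree, each one once and written in one of its two directions -/
  links : List (Fin t × Fin t)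
  links_nodup : (links.map fun e => s(e.1, e.2)).Nodup
  mem_links : ∀ x y, s(x, y) ∈ (links.map fun e => s(e.1, e.2)) ↔ 𝒯.tree.Adj x y

namespace SteinerInput

variable {n t : ℕ} (X : SteinerInput n t)

/-- The positions at which the bags start in the concatenation of their lists (and the total
length of this concatenation). -/
def offsets : List ℕ :=
  (List.range (t + 1)).map fun i => (((List.ofFn X.bags).take i).map List.length).sum

/-- The initial state of the machine. The word registers `0`, `1`, `2`, `3` hold the number of
vertices, the number of arcs, the root and the number of nodes of the tree. The word arrays `0`
and `1` hold the tails and the heads of the arcs, array `2` the characteristic vector of the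
terminals, array `3` the offsets of the bags, array `4` the concatenation of the bags, arrays `5`
and `6` the ends of the edges of the tree. The real array `0` holds the costs. All other memory
cells are zero. -/
noncomputable def store : RAM.Store where
  word x := [n, X.arcs.length, (X.I.r : ℕ), t].getD x 0
  real _ := 0
  wmem a i :=
    ([X.arcs.map fun e => (e.1 : ℕ),
      X.arcs.map fun e => (e.2 : ℕ),
      List.ofFn fun v => if v ∈ X.I.T then 1 else 0,
      X.offsets,
      (List.ofFn X.bags).flatten.map fun v => (v : ℕ),
      X.links.map fun e => (e.1 : ℕ),
      X.links.map fun e => (e.2 : ℕ)].getD a []).getD i 0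
  rmem a i := if a = 0 then (List.ofFn fun v => (X.I.c v : ℝ)).getD i 0 else 0

end SteinerInput

/-- The set of vertices that a final state describes: the word array `7` is its characteristic
vector. -/
def RAM.Store.outSet (n : ℕ) (s : RAM.Store) : Finset (Fin n) :=
  Finset.univ.filter fun v => s.wmem 7 v = 1

/-- The final state `s` solves the instance `I`: if there is a feasible solution, then word register
`0` holds `1` and the output set is a feasible solution of minimum cost; otherwise word register
`0` holds `0`. -/
def SteinerInstance.SolvedBy {n : ℕ} (I : SteinerInstance n) (s : RAM.Store) : Prop :=
  ((∃ F, I.Feasible F) → s.word 0 = 1 ∧ I.Optimal (s.outSet n)) ∧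
  ((¬ ∃ F, I.Feasible F) → s.word 0 = 0)

/-!
The algorithm is dynamic programming over the tree decomposition, with three states for a vertex
of a bag. On an acyclic digraph a set `F` of vertices is feasible if it is *locally feasible*: it
contains the terminals, and each of its vertices other than the root has an in-neighbour in `F`.
Indeed, going from a vertex of `F` to an in-neighbour in `F` again and again cannot go on forever,
so it ends at the root (`SteinerInput.feasible_of_locallyFeasible`).
Conversely, the vertices of a feasible solution that are reachable from the root inside of it form
a locally feasible set (`SteinerInput.exists_locallyFeasible`). So it suffices to minimise the cost
of a locally feasible set, which is a local condition.

For a set `N` of nodes of the tree that has been processed and the node `y` of `N` at its border,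
the table of `y` has an entry for each state of the bag of `y`: a vertex can be outside of the
partial solution, inside, or inside and known to be the root or to have an in-neighbour in the part
that is covered by `N`. The entry holds the minimum cost of the vertices outside of the bag. The
two properties `Net.Sound` (each entry is realised by a set) and `Net.Complete` (no entry is too
large) are preserved when a table is passed from a node to its parent (`Sound.proj`,
`IsState.proj`) and when it is combined with the table of the parent (`Sound.join`,
`IsState.join`). In a join only the side
that supplies the in-neighbour has to be chosen; in the code of a join the digits `2` and `3` of a
vertex stand for the two choices, so there are `4 ^ (w + 1)` combinations for a bag, and
`O((w + 2) ^ 2)` steps suffice for each. As `4 ^ (w + 1) * (w + 2) ^ 2` is `O(5 ^ w)`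
(`four_pow_mul_sq_le`), the time for a single combination does not matter.

The nodes are eliminated one by one, always a leaf of what remains of the tree. The order is found
by a queue of leaves (`TreePeel.Peeled`), where the only remaining neighbour of a leaf is known from
the sum of the numbers of its remaining neighbours, so that no adjacency lists are necessary. The
last node gets a virtual parent with an empty bag, whose table finally has one entry of interest.
Entries hold the addresses of the two entries from which they arose, and the set of an optimal entry
is recovered by marking, downwards from its address, the entries on which it depends.

The program is verified with a Hoare logic with time bounds (`RAM.Runs`): the loop-free parts are
evaluated (`RAM.Runs.of_run`), there is an invariant rule for counting loops (`RAM.Runs.forLoop`),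
and what a program leaves unchanged is read off from its text (`RAM.Exec.frame`). As memory is zero at
the start, two-dimensional arrays can be used without being initialised.
-/

/-! ### Verifying programs of the random access machine -/

namespace RAM

instance : Add WExp := ⟨WExp.add⟩
instance : Sub WExp := ⟨WExp.sub⟩
instance : Mul WExp := ⟨WExp.mul⟩
instance : Div WExp := ⟨WExp.div⟩
instance : Mod WExp := ⟨WExp.mod⟩
instance (k : ℕ) : OfNat WExp k := ⟨WExp.const k⟩
instance : Add RExp := ⟨RExp.add⟩

/-- Sequential composition of programs. -/
infixr:60 " ;; " => Prog.seq

namespace Store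

/-- The state in which the word register `x` has been set to `v`. -/
def setW (s : Store) (x v : ℕ) : Store := { s with word := Function.update s.word x v }

/-- The state in which the real register `x` has been set to `v`. -/
def setR (s : Store) (x : ℕ) (v : ℝ) : Store := { s with real := Function.update s.real x v }

/-- The state in which the entry `i` of the word array `a` has been set to `v`. -/
def putW (s : Store) (a i v : ℕ) : Store :=
  { s with wmem := Function.update s.wmem a (Function.update (s.wmem a) i v) }

/-- The state in which the entry `i` of the real array `a` has been set to `v`. -/
def putR (s : Store) (a i : ℕ) (v : ℝ) : Store :=
  { s with rmem := Function.update s.rmem a (Function.update (s.rmem a) i v) }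

variable (s : Store)

@[simp] theorem setW_word (x v y : ℕ) : (s.setW x v).word y = if y = x then v else s.word y :=
  Function.update_apply ..
@[simp] theorem setW_real (x v : ℕ) : (s.setW x v).real = s.real := rfl
@[simp] theorem setW_wmem (x v : ℕ) : (s.setW x v).wmem = s.wmem := rfl
@[simp] theorem setW_rmem (x v : ℕ) : (s.setW x v).rmem = s.rmem := rfl
@[simp] theorem setR_word (x : ℕ) (v : ℝ) : (s.setR x v).word = s.word := rfl
@[simp] theorem setR_real (x : ℕ) (v : ℝ) (y : ℕ) :
    (s.setR x v).real y = if y = x then v else s.real y := Function.update_apply ..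
@[simp] theorem setR_wmem (x : ℕ) (v : ℝ) : (s.setR x v).wmem = s.wmem := rfl
@[simp] theorem setR_rmem (x : ℕ) (v : ℝ) : (s.setR x v).rmem = s.rmem := rfl
@[simp] theorem putW_word (a i v : ℕ) : (s.putW a i v).word = s.word := rfl
@[simp] theorem putW_real (a i v : ℕ) : (s.putW a i v).real = s.real := rfl
@[simp] theorem putW_wmem (a i v b : ℕ) : (s.putW a i v).wmem b =
    if b = a then Function.update (s.wmem a) i v else s.wmem b := Function.update_apply ..
@[simp] theorem putW_rmem (a i v : ℕ) : (s.putW a i v).rmem = s.rmem := rfl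
@[simp] theorem putR_word (a i : ℕ) (v : ℝ) : (s.putR a i v).word = s.word := rfl
@[simp] theorem putR_real (a i : ℕ) (v : ℝ) : (s.putR a i v).real = s.real := rfl
@[simp] theorem putR_wmem (a i : ℕ) (v : ℝ) : (s.putR a i v).wmem = s.wmem := rfl
@[simp] theorem putR_rmem (a i : ℕ) (v : ℝ) (b : ℕ) : (s.putR a i v).rmem b =
    if b = a then Function.update (s.rmem a) i v else s.rmem b := Function.update_apply ..

end Store

/-! Overflow conditions, for states all of whose words fit. -/

/-- In a state all of whose words fit, only constants, sums and products can overflow. -/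
def WExp.Safe (W : ℕ) (s : Store) : WExp → Prop
  | const k => k < 2 ^ W
  | reg _ => True
  | load _ i => i.Safe W s
  | add e f => e.Safe W s ∧ f.Safe W s ∧ e.eval s + f.eval s < 2 ^ W
  | sub e f => e.Safe W s ∧ f.Safe W s
  | mul e f => e.Safe W s ∧ f.Safe W s ∧ e.eval s * f.eval s < 2 ^ W
  | div e f => e.Safe W s ∧ f.Safe W s
  | mod e f => e.Safe W s ∧ f.Safe W s

/-- The index computations of a real expression do not overflow. -/
def RExp.Safe (W : ℕ) (s : Store) : RExp → Prop
  | zero => True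
  | reg _ => True
  | load _ i => i.Safe W s
  | add e f => e.Safe W s ∧ f.Safe W s
  | sub e f => e.Safe W s ∧ f.Safe W s

/-- A test does not overflow. -/
def Test.Safe (W : ℕ) (s : Store) : Test → Prop
  | wlt e f => e.Safe W s ∧ f.Safe W s
  | weq e f => e.Safe W s ∧ f.Safe W s
  | rle e f => e.Safe W s ∧ f.Safe W s
  | not b => b.Safe W s
  | and b b' => b.Safe W s ∧ b'.Safe W s

section eval
variable (s : Store) (W : ℕ)

@[simp] theorem WExp.eval_zero : WExp.eval s 0 = 0 := rfl
@[simp] theorem WExp.eval_one : WExp.eval s 1 = 1 := rfl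
@[simp] theorem WExp.eval_two : WExp.eval s 2 = 2 := rfl
@[simp] theorem WExp.eval_three : WExp.eval s 3 = 3 := rfl
@[simp] theorem WExp.eval_four : WExp.eval s 4 = 4 := rfl
@[simp] theorem WExp.eval_reg (x : ℕ) : WExp.eval s (.reg x) = s.word x := rfl
@[simp] theorem WExp.eval_load (a : ℕ) (i : WExp) :
    WExp.eval s (.load a i) = s.wmem a (i.eval s) := rfl
@[simp] theorem WExp.eval_add (e f : WExp) : (e + f).eval s = e.eval s + f.eval s := rfl
@[simp] theorem WExp.eval_sub (e f : WExp) : (e - f).eval s = e.eval s - f.eval s := rfl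
@[simp] theorem WExp.eval_mul (e f : WExp) : (e * f).eval s = e.eval s * f.eval s := rfl
@[simp] theorem WExp.eval_div (e f : WExp) : (e / f).eval s = e.eval s / f.eval s := rfl
@[simp] theorem WExp.eval_mod (e f : WExp) : (e % f).eval s = e.eval s % f.eval s := rfl

@[simp] theorem WExp.safe_zero : WExp.Safe W s 0 ↔ 0 < 2 ^ W := Iff.rfl
@[simp] theorem WExp.safe_one : WExp.Safe W s 1 ↔ 1 < 2 ^ W := Iff.rfl
@[simp] theorem WExp.safe_two : WExp.Safe W s 2 ↔ 2 < 2 ^ W := Iff.rfl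
@[simp] theorem WExp.safe_three : WExp.Safe W s 3 ↔ 3 < 2 ^ W := Iff.rfl
@[simp] theorem WExp.safe_four : WExp.Safe W s 4 ↔ 4 < 2 ^ W := Iff.rfl
@[simp] theorem WExp.safe_reg (x : ℕ) : WExp.Safe W s (.reg x) := trivial
@[simp] theorem WExp.safe_load (a : ℕ) (i : WExp) :
    WExp.Safe W s (.load a i) ↔ i.Safe W s := Iff.rfl
@[simp] theorem WExp.safe_add (e f : WExp) :
    (e + f).Safe W s ↔ e.Safe W s ∧ f.Safe W s ∧ e.eval s + f.eval s < 2 ^ W := Iff.rfl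
@[simp] theorem WExp.safe_sub (e f : WExp) :
    (e - f).Safe W s ↔ e.Safe W s ∧ f.Safe W s := Iff.rfl
@[simp] theorem WExp.safe_mul (e f : WExp) :
    (e * f).Safe W s ↔ e.Safe W s ∧ f.Safe W s ∧ e.eval s * f.eval s < 2 ^ W := Iff.rfl
@[simp] theorem WExp.safe_div (e f : WExp) :
    (e / f).Safe W s ↔ e.Safe W s ∧ f.Safe W s := Iff.rfl
@[simp] theorem WExp.safe_mod (e f : WExp) :
    (e % f).Safe W s ↔ e.Safe W s ∧ f.Safe W s := Iff.rfl

@[simp] theorem RExp.eval_reg (x : ℕ) : RExp.eval s (.reg x) = s.real x := rfl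
@[simp] theorem RExp.eval_load (a : ℕ) (i : WExp) :
    RExp.eval s (.load a i) = s.rmem a (i.eval s) := rfl
@[simp] theorem RExp.eval_add (e f : RExp) : (e + f).eval s = e.eval s + f.eval s := rfl
@[simp] theorem RExp.safe_reg (x : ℕ) : RExp.Safe W s (.reg x) := trivial
@[simp] theorem RExp.safe_load (a : ℕ) (i : WExp) :
    RExp.Safe W s (.load a i) ↔ i.Safe W s := Iff.rfl
@[simp] theorem RExp.safe_add (e f : RExp) :
    (e + f).Safe W s ↔ e.Safe W s ∧ f.Safe W s := Iff.rfl

@[simp] theorem Test.holds_wlt (e f : WExp) :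
    Test.Holds s (.wlt e f) ↔ e.eval s < f.eval s := Iff.rfl
@[simp] theorem Test.holds_weq (e f : WExp) :
    Test.Holds s (.weq e f) ↔ e.eval s = f.eval s := Iff.rfl
@[simp] theorem Test.holds_rle (e f : RExp) :
    Test.Holds s (.rle e f) ↔ e.eval s ≤ f.eval s := Iff.rfl
@[simp] theorem Test.holds_not (b : Test) : Test.Holds s (.not b) ↔ ¬ b.Holds s := Iff.rfl
@[simp] theorem Test.holds_and (b b' : Test) :
    Test.Holds s (.and b b') ↔ b.Holds s ∧ b'.Holds s := Iff.rfl
@[simp] theorem Test.safe_wlt (e f : WExp) :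
    Test.Safe W s (.wlt e f) ↔ e.Safe W s ∧ f.Safe W s := Iff.rfl
@[simp] theorem Test.safe_weq (e f : WExp) :
    Test.Safe W s (.weq e f) ↔ e.Safe W s ∧ f.Safe W s := Iff.rfl
@[simp] theorem Test.safe_rle (e f : RExp) :
    Test.Safe W s (.rle e f) ↔ e.Safe W s ∧ f.Safe W s := Iff.rfl
@[simp] theorem Test.safe_not (b : Test) : Test.Safe W s (.not b) ↔ b.Safe W s := Iff.rfl
@[simp] theorem Test.safe_and (b b' : Test) :
    Test.Safe W s (.and b b') ↔ b.Safe W s ∧ b'.Safe W s := Iff.rfl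

end eval

variable {W : ℕ} {s s' : Store}

theorem WExp.Safe.fits_and_lt (hs : s.FitsIn W) :
    ∀ {e : WExp}, e.Safe W s → e.Fits W s ∧ e.eval s < 2 ^ W
  | .const _, h => ⟨h, h⟩
  | .reg x, _ => ⟨hs.1 x, hs.1 x⟩
  | .load _ i, h => ⟨⟨(fits_and_lt (e := i) hs h).1, hs.2 _ _⟩, hs.2 _ _⟩
  | .add _ _, h => ⟨⟨(fits_and_lt hs h.1).1, (fits_and_lt hs h.2.1).1, h.2.2⟩, h.2.2⟩
  | .sub _ _, h => ⟨⟨(fits_and_lt hs h.1).1, (fits_and_lt hs h.2).1⟩,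
      (Nat.sub_le _ _).trans_lt (fits_and_lt hs h.1).2⟩
  | .mul _ _, h => ⟨⟨(fits_and_lt hs h.1).1, (fits_and_lt hs h.2.1).1, h.2.2⟩, h.2.2⟩
  | .div _ _, h => ⟨⟨(fits_and_lt hs h.1).1, (fits_and_lt hs h.2).1⟩,
      (Nat.div_le_self _ _).trans_lt (fits_and_lt hs h.1).2⟩
  | .mod _ _, h => ⟨⟨(fits_and_lt hs h.1).1, (fits_and_lt hs h.2).1⟩,
      (Nat.mod_le _ _).trans_lt (fits_and_lt hs h.1).2⟩

theorem WExp.Fits.eval_lt : ∀ {e : WExp}, e.Fits W s → e.eval s < 2 ^ W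
  | .const _, h => h
  | .reg _, h => h
  | .load _ _, h => h.2
  | .add _ _, h => h.2.2
  | .sub _ _, h => (Nat.sub_le _ _).trans_lt h.1.eval_lt
  | .mul _ _, h => h.2.2
  | .div _ _, h => (Nat.div_le_self _ _).trans_lt h.1.eval_lt
  | .mod _ _, h => (Nat.mod_le _ _).trans_lt h.1.eval_lt

theorem RExp.Safe.fits (hs : s.FitsIn W) : ∀ {e : RExp}, e.Safe W s → e.Fits W s
  | .zero, _ => trivial
  | .reg _, _ => trivial
  | .load _ _, h => (WExp.Safe.fits_and_lt hs h).1
  | .add _ _, h => ⟨fits hs h.1, fits hs h.2⟩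
  | .sub _ _, h => ⟨fits hs h.1, fits hs h.2⟩

theorem Test.Safe.fits (hs : s.FitsIn W) : ∀ {b : Test}, b.Safe W s → b.Fits W s
  | .wlt _ _, h => ⟨(h.1.fits_and_lt hs).1, (h.2.fits_and_lt hs).1⟩
  | .weq _ _, h => ⟨(h.1.fits_and_lt hs).1, (h.2.fits_and_lt hs).1⟩
  | .rle _ _, h => ⟨h.1.fits hs, h.2.fits hs⟩
  | .not b, h => fits (b := b) hs h
  | .and _ _, h => ⟨fits hs h.1, fits hs h.2⟩

theorem Store.FitsIn.setW (hs : s.FitsIn W) {x v : ℕ} (hv : v < 2 ^ W) :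
    (s.setW x v).FitsIn W := by
  refine ⟨fun y => ?_, hs.2⟩
  rw [Store.setW_word]; split_ifs
  · exact hv
  · exact hs.1 y

theorem Store.FitsIn.putW (hs : s.FitsIn W) {a i v : ℕ} (hv : v < 2 ^ W) :
    (s.putW a i v).FitsIn W := by
  refine ⟨hs.1, fun b j => ?_⟩
  rw [Store.putW_wmem]; split_ifs
  · rw [Function.update_apply]; split_ifs
    · exact hv
    · exact hs.2 a j
  · exact hs.2 b j

/-- Executions cannot create words that do not fit. -/
theorem Exec.fitsIn {p : Prog} {k : ℕ} (h : Exec W p s k s') : s.FitsIn W → s'.FitsIn W := by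
  induction h with
  | skip s => exact id
  | setWord x e s he => exact fun hs => hs.setW he.eval_lt
  | setReal x e s he => exact id
  | storeWord a i e s hi he => exact fun hs => hs.putW he.eval_lt
  | storeReal a i e s hi he => exact id
  | seq _ _ h1 h2 => exact fun hs => h2 (h1 hs)
  | iteTrue _ _ _ h => exact h
  | iteFalse _ _ _ h => exact h
  | whileTrue _ _ _ _ h1 h2 => exact fun hs => h2 (h1 hs)
  | whileFalse _ _ => exact id

/-! Which registers and arrays a program can change is read off from its text. -/

namespace Prog

/-- The program has an assignment to the word register `y`. -/
def setsWord (y : ℕ) : Prog → Bool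
  | setWord x _ => Nat.beq x y
  | seq p q => p.setsWord y || q.setsWord y
  | ite _ p q => p.setsWord y || q.setsWord y
  | .while _ p => p.setsWord y
  | _ => false

/-- The program has an assignment to the real register `y`. -/
def setsReal (y : ℕ) : Prog → Bool
  | setReal x _ => Nat.beq x y
  | seq p q => p.setsReal y || q.setsReal y
  | ite _ p q => p.setsReal y || q.setsReal y
  | .while _ p => p.setsReal y
  | _ => false

/-- The program has an assignment to an entry of the word array `b`. -/
def putsWord (b : ℕ) : Prog → Bool
  | storeWord a _ _ => Nat.beq a b
  | seq p q => p.putsWord b || q.putsWord b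
  | ite _ p q => p.putsWord b || q.putsWord b
  | .while _ p => p.putsWord b
  | _ => false

/-- The program has an assignment to an entry of the real array `b`. -/
def putsReal (b : ℕ) : Prog → Bool
  | storeReal a _ _ => Nat.beq a b
  | seq p q => p.putsReal b || q.putsReal b
  | ite _ p q => p.putsReal b || q.putsReal b
  | .while _ p => p.putsReal b
  | _ => false

end Prog

/-- The states `s` and `s'` agree on everything to which `p` has no assignment. -/
structure Frame (p : Prog) (s s' : Store) : Prop where
  word : ∀ x, p.setsWord x = false → s'.word x = s.word x
  real : ∀ x, p.setsReal x = false → s'.real x = s.real x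
  wmem : ∀ a, p.putsWord a = false → s'.wmem a = s.wmem a
  rmem : ∀ a, p.putsReal a = false → s'.rmem a = s.rmem a

theorem Frame.refl (p : Prog) (s : Store) : Frame p s s :=
  ⟨fun _ _ => rfl, fun _ _ => rfl, fun _ _ => rfl, fun _ _ => rfl⟩

theorem Frame.trans {p : Prog} {s₁ s₂ s₃ : Store} (h : Frame p s₁ s₂) (h' : Frame p s₂ s₃) :
    Frame p s₁ s₃ :=
  ⟨fun x hx => (h'.word x hx).trans (h.word x hx), fun x hx => (h'.real x hx).trans (h.real x hx),
    fun x hx => (h'.wmem x hx).trans (h.wmem x hx), fun x hx => (h'.rmem x hx).trans (h.rmem x hx)⟩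

/-- A frame for a program is a frame for each program with more assignments. -/
theorem Frame.mono {p q : Prog} (h : Frame p s s')
    (h1 : ∀ x, q.setsWord x = false → p.setsWord x = false)
    (h2 : ∀ x, q.setsReal x = false → p.setsReal x = false)
    (h3 : ∀ x, q.putsWord x = false → p.putsWord x = false)
    (h4 : ∀ x, q.putsReal x = false → p.putsReal x = false) : Frame q s s' :=
  ⟨fun x hx => h.word x (h1 x hx), fun x hx => h.real x (h2 x hx),
    fun x hx => h.wmem x (h3 x hx), fun x hx => h.rmem x (h4 x hx)⟩

theorem Exec.frame {p : Prog} {k : ℕ} (h : Exec W p s k s') : Frame p s s' := by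
  have ne_of_beq {x y : ℕ} (h : Nat.beq x y = false) : y ≠ x :=
    fun e => by subst e; simp at h
  induction h with
  | skip s => exact .refl _ _
  | setWord x e s he =>
    exact ⟨fun y hy => Function.update_of_ne (ne_of_beq hy) _ _, fun _ _ => rfl, fun _ _ => rfl,
      fun _ _ => rfl⟩
  | setReal x e s he =>
    exact ⟨fun _ _ => rfl, fun y hy => Function.update_of_ne (ne_of_beq hy) _ _, fun _ _ => rfl,
      fun _ _ => rfl⟩
  | storeWord a i e s hi he =>
    exact ⟨fun _ _ => rfl, fun _ _ => rfl, fun y hy => Function.update_of_ne (ne_of_beq hy) _ _,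
      fun _ _ => rfl⟩
  | storeReal a i e s hi he =>
    exact ⟨fun _ _ => rfl, fun _ _ => rfl, fun _ _ => rfl,
      fun y hy => Function.update_of_ne (ne_of_beq hy) _ _⟩
  | seq _ _ h1 h2 =>
    refine Frame.trans (h1.mono ?_ ?_ ?_ ?_) (h2.mono ?_ ?_ ?_ ?_) <;> intro x hx <;>
      simp only [Prog.setsWord, Prog.setsReal, Prog.putsWord, Prog.putsReal,
        Bool.or_eq_false_iff] at hx <;> first | exact hx.1 | exact hx.2
  | iteTrue _ _ _ h1 =>
    refine h1.mono ?_ ?_ ?_ ?_ <;> intro x hx <;>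
      simp only [Prog.setsWord, Prog.setsReal, Prog.putsWord, Prog.putsReal,
        Bool.or_eq_false_iff] at hx <;> exact hx.1
  | iteFalse _ _ _ h1 =>
    refine h1.mono ?_ ?_ ?_ ?_ <;> intro x hx <;>
      simp only [Prog.setsWord, Prog.setsReal, Prog.putsWord, Prog.putsReal,
        Bool.or_eq_false_iff] at hx <;> exact hx.2
  | whileTrue _ _ _ _ h1 h2 =>
    exact Frame.trans (h1.mono (fun _ h => h) (fun _ h => h) (fun _ h => h) (fun _ h => h)) h2
  | whileFalse _ _ => exact .refl _ _

/-- Started in `s`, the program `p` halts within `B` steps in a state with the property `Q`. -/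
def Runs (W : ℕ) (p : Prog) (s : Store) (B : ℕ) (Q : Store → Prop) : Prop :=
  ∃ k s', Exec W p s k s' ∧ k ≤ B ∧ Q s'

theorem Runs.mono {p : Prog} {B B' : ℕ} {Q Q' : Store → Prop} (h : Runs W p s B Q)
    (hB : B ≤ B') (hQ : ∀ s', Q s' → Q' s') : Runs W p s B' Q' := by
  obtain ⟨k, s', h1, h2, h3⟩ := h
  exact ⟨k, s', h1, h2.trans hB, hQ _ h3⟩

theorem Runs.mono_frame {p : Prog} {B B' : ℕ} {Q Q' : Store → Prop} (hs : s.FitsIn W)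
    (h : Runs W p s B Q) (hB : B ≤ B')
    (hQ : ∀ s', Frame p s s' → s'.FitsIn W → Q s' → Q' s') : Runs W p s B' Q' := by
  obtain ⟨k, s', h1, h2, h3⟩ := h
  exact ⟨k, s', h1, h2.trans hB, hQ _ h1.frame (h1.fitsIn hs) h3⟩

theorem Runs.seq {p q : Prog} {B B' : ℕ} {R Q : Store → Prop} (hs : s.FitsIn W)
    (h : Runs W p s B R)
    (h' : ∀ s', Frame p s s' → s'.FitsIn W → R s' → Runs W q s' B' Q) :
    Runs W (p ;; q) s (B + B') Q := by
  obtain ⟨k, s', h1, h2, h3⟩ := h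
  obtain ⟨l, s'', h4, h5, h6⟩ := h' s' h1.frame (h1.fitsIn hs) h3
  exact ⟨k + l, s'', .seq h1 h4, Nat.add_le_add h2 h5, h6⟩

theorem Runs.ite {b : Test} {p q : Prog} {B : ℕ} {Q : Store → Prop} (hs : s.FitsIn W)
    (hb : b.Safe W s) (hp : b.Holds s → Runs W p s B Q) (hq : ¬ b.Holds s → Runs W q s B Q) :
    Runs W (.ite b p q) s (b.time + 1 + B) Q := by
  by_cases h : b.Holds s
  · obtain ⟨k, s', h1, h2, h3⟩ := hp h
    exact ⟨_, s', .iteTrue (hb.fits hs) h h1, by lia, h3⟩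
  · obtain ⟨k, s', h1, h2, h3⟩ := hq h
    exact ⟨_, s', .iteFalse (hb.fits hs) h h1, by lia, h3⟩

/-! Programs without loops are evaluated. -/

namespace Prog

/-- The program has no loop. -/
def loopFree : Prog → Bool
  | seq p q => p.loopFree && q.loopFree
  | ite _ p q => p.loopFree && q.loopFree
  | .while _ _ => false
  | _ => true

open Classical in
/-- The final state of a program without loops. -/
noncomputable def run : Prog → Store → Store
  | skip, s => s
  | setWord x e, s => s.setW x (e.eval s)
  | setReal x e, s => s.setR x (e.eval s)
  | storeWord a i e, s => s.putW a (i.eval s) (e.eval s)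
  | storeReal a i e, s => s.putR a (i.eval s) (e.eval s)
  | seq p q, s => q.run (p.run s)
  | ite b p q, s => if b.Holds s then p.run s else q.run s
  | .while _ _, s => s

/-- The maximal number of steps of a program without loops. -/
def steps : Prog → ℕ
  | skip => 1
  | setWord _ e => e.time + 1
  | setReal _ e => e.time + 1
  | storeWord _ i e => i.time + e.time + 1
  | storeReal _ i e => i.time + e.time + 1
  | seq p q => p.steps + q.steps
  | ite b p q => b.time + 1 + (p.steps + q.steps)
  | .while _ _ => 0

/-- A program without loops does not overflow. -/
def Safe (W : ℕ) : Prog → Store → Prop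
  | skip, _ => True
  | setWord _ e, s => e.Safe W s
  | setReal _ e, s => e.Safe W s
  | storeWord _ i e, s => i.Safe W s ∧ e.Safe W s
  | storeReal _ i e, s => i.Safe W s ∧ e.Safe W s
  | seq p q, s => p.Safe W s ∧ q.Safe W (p.run s)
  | ite b p q, s => b.Safe W s ∧ (b.Holds s → p.Safe W s) ∧ (¬ b.Holds s → q.Safe W s)
  | .while _ _, _ => True

end Prog

theorem Runs.run {p : Prog} : p.loopFree = true → s.FitsIn W → p.Safe W s →
    Runs W p s p.steps (fun s' => s' = p.run s) := by
  induction p generalizing s with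
  | skip => exact fun _ _ _ => ⟨_, _, .skip s, le_rfl, rfl⟩
  | setWord x e => exact fun _ hs h => ⟨_, _, .setWord x e s (h.fits_and_lt hs).1, le_rfl, rfl⟩
  | setReal x e => exact fun _ hs h => ⟨_, _, .setReal x e s (h.fits hs), le_rfl, rfl⟩
  | storeWord a i e =>
    exact fun _ hs h => ⟨_, _, .storeWord a i e s (h.1.fits_and_lt hs).1 (h.2.fits_and_lt hs).1,
      le_rfl, rfl⟩
  | storeReal a i e =>
    exact fun _ hs h => ⟨_, _, .storeReal a i e s (h.1.fits_and_lt hs).1 (h.2.fits hs),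
      le_rfl, rfl⟩
  | seq p q hp hq =>
    intro hl hs h
    simp only [Prog.loopFree, Bool.and_eq_true] at hl
    refine Runs.seq hs (hp hl.1 hs h.1) fun s' _ hs' e => ?_
    subst e
    exact hq hl.2 hs' h.2
  | ite b p q hp hq =>
    intro hl hs h
    simp only [Prog.loopFree, Bool.and_eq_true] at hl
    refine Runs.ite hs h.1 (fun hb => (hp hl.1 hs (h.2.1 hb)).mono (Nat.le_add_right _ _) ?_)
      (fun hb => (hq hl.2 hs (h.2.2 hb)).mono (Nat.le_add_left _ _) ?_)
    · rintro _ rfl; exact (if_pos hb).symm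
    · rintro _ rfl; exact (if_neg hb).symm
  | _ => intro hl; simp [Prog.loopFree] at hl

/-- A program without loops, with its postcondition. -/
theorem Runs.of_run {p : Prog} {B : ℕ} {Q : Store → Prop} (hl : p.loopFree = true)
    (hs : s.FitsIn W) (h : p.Safe W s) (hB : p.steps ≤ B) (hQ : Q (p.run s)) :
    Runs W p s B Q :=
  (Runs.run hl hs h).mono hB fun _ e => e ▸ hQ

/-- A program that starts with a loop-free part. -/
theorem Runs.run_seq {p q : Prog} {B : ℕ} {Q : Store → Prop} (hl : p.loopFree = true)
    (hs : s.FitsIn W) (h : p.Safe W s)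
    (hq : (p.run s).FitsIn W → Frame p s (p.run s) → Runs W q (p.run s) B Q) :
    Runs W (p ;; q) s (p.steps + B) Q :=
  Runs.seq hs (Runs.run hl hs h) fun s' hf hs' e => by subst e; exact hq hs' hf

/-- `for i := 0 to L - 1 do p`, where `i` and `L` are registers to which `p` does not assign. -/
def Prog.forLoop (i L : ℕ) (p : Prog) : Prog :=
  .setWord i 0 ;; .while (.wlt (.reg i) (.reg L)) (p ;; .setWord i (.reg i + 1))

/-- The invariant rule for counting loops. -/
theorem Runs.forLoop {i L : ℕ} {p : Prog} {N B : ℕ} (Inv : ℕ → Store → Prop)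
    {Q : Store → Prop} (hs : s.FitsIn W) (hW : 1 < 2 ^ W) (hN : s.word L = N)
    (hiL : Nat.beq i L = false) (hpi : p.setsWord i = false) (hpL : p.setsWord L = false)
    (h0 : Inv 0 (s.setW i 0))
    (hstep : ∀ j s', j < N → Frame (.forLoop i L p) s s' → s'.FitsIn W → s'.word i = j →
      Inv j s' → Runs W p s' B (fun s'' => Inv (j + 1) (s''.setW i (j + 1))))
    (hQ : ∀ s', s'.FitsIn W → Frame (.forLoop i L p) s s' → Inv N s' → Q s') :
    Runs W (.forLoop i L p) s (N * (B + 8) + 6) Q := by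
  have hiL' : L ≠ i := fun e => by subst e; simp at hiL
  have fr {s₁ s₂ : Store} (h : Frame p s₁ s₂) : Frame (.forLoop i L p) s₁ s₂ := by
    refine h.mono ?_ ?_ ?_ ?_ <;> intro x hx <;>
      simp_all [Prog.forLoop, Prog.setsWord, Prog.setsReal, Prog.putsWord, Prog.putsReal]
  have fr' (s₁ : Store) (v : ℕ) : Frame (.forLoop i L p) s₁ (s₁.setW i v) := by
    refine ⟨fun x hx => ?_, fun _ _ => rfl, fun _ _ => rfl, fun _ _ => rfl⟩
    rw [Store.setW_word, if_neg]
    rintro rfl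
    simp [Prog.forLoop, Prog.setsWord] at hx
  have key : ∀ d j s₁, j + d = N → Frame (.forLoop i L p) s s₁ → s₁.FitsIn W → s₁.word i = j →
      s₁.word L = N → Inv j s₁ →
      Runs W (.while (.wlt (.reg i) (.reg L)) (p ;; .setWord i (.reg i + 1))) s₁
        (d * (B + 8) + 4) Q := by
    intro d
    induction d with
    | zero =>
      intro j s₁ hj hf hs₁ hi hL hI
      refine ⟨_, s₁, .whileFalse ⟨hs₁.1 _, hs₁.1 _⟩ ?_, ?_, hQ _ hs₁ hf ?_⟩
      · simp only [Test.holds_wlt, WExp.eval_reg]; lia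
      · simp [Test.time, WExp.time]
      · obtain rfl : j = N := by lia
        exact hI
    | succ d ih =>
      intro j s₁ hj hf hs₁ hi hL hI
      obtain ⟨k, s₂, h1, h2, h3⟩ := hstep j s₁ (by lia) hf hs₁ hi hI
      have hs₂ := h1.fitsIn hs₁
      have hi₂ : s₂.word i = j := by rw [h1.frame.word i hpi, hi]
      have hL₂ : s₂.word L = N := by rw [h1.frame.word L hpL, hL]
      have hlt : j + 1 < 2 ^ W := by have := hs₂.1 L; lia
      have hset : Exec W (.setWord i (.reg i + 1)) s₂ 4 (s₂.setW i (j + 1)) := by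
        have hfit : WExp.Fits W s₂ (.reg i + 1) :=
          ⟨hs₂.1 i, hW, by change s₂.word i + 1 < _; rw [hi₂]; exact hlt⟩
        have := Exec.setWord (W := W) i (.reg i + 1) s₂ hfit
        have e : WExp.eval s₂ (.reg i + 1) = j + 1 := by
          change s₂.word i + 1 = _; rw [hi₂]
        rw [e] at this
        exact this
      obtain ⟨l, s₃, h4, h5, h6⟩ := ih (j + 1) (s₂.setW i (j + 1)) (by lia)
        ((hf.trans (fr h1.frame)).trans (fr' _ _)) (hs₂.setW hlt) (by simp)
        (by rw [Store.setW_word, if_neg hiL', hL₂]) h3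
      refine ⟨_, s₃, .whileTrue ⟨hs₁.1 _, hs₁.1 _⟩ ?_ (.seq h1 hset) h4, ?_, h6⟩
      · simp only [Test.holds_wlt, WExp.eval_reg]; lia
      · simp only [Test.time, WExp.time]
        have : (d + 1) * (B + 8) = d * (B + 8) + (B + 8) := by ring
        lia
  obtain ⟨k, s₁, h1, h2, h3⟩ := key N 0 (s.setW i 0) (by lia) (fr' _ _) (hs.setW (by lia))
    (by simp) (by rw [Store.setW_word, if_neg hiL', hN]) h0
  exact ⟨2 + k, s₁, .seq (.setWord i 0 s (show 0 < 2 ^ W by lia)) h1, by lia, h3⟩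

end RAM

/-! ### States of a bag as numbers in base four -/

namespace SteinerDP

/-- The number whose digits in base `4`, the least significant one first, are the values of `σ` at
the elements of `l`. -/
def enc (l : List ℕ) (σ : ℕ → ℕ) : ℕ :=
  match l with
  | [] => 0
  | v :: l => σ v + 4 * enc l σ

/-- The digit of `c` that belongs to the element `v` of `l`. -/
def dec (l : List ℕ) (c v : ℕ) : ℕ := c / 4 ^ l.idxOf v % 4

theorem dec_lt (l : List ℕ) (c v : ℕ) : dec l c v < 4 := Nat.mod_lt _ (by norm_num)

theorem enc_lt {l : List ℕ} {σ : ℕ → ℕ} (h : ∀ v ∈ l, σ v < 4) : enc l σ < 4 ^ l.length := by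
  induction l with
  | nil => simp [enc]
  | cons a l ih =>
    have h1 := ih fun v hv => h v (List.mem_cons_of_mem _ hv)
    have h2 := h a List.mem_cons_self
    simp only [enc, List.length_cons, pow_succ]
    lia

theorem enc_congr {l : List ℕ} {σ τ : ℕ → ℕ} (h : ∀ v ∈ l, σ v = τ v) : enc l σ = enc l τ := by
  induction l with
  | nil => rfl
  | cons a l ih =>
    simp only [enc]
    rw [h a List.mem_cons_self, ih fun v hv => h v (List.mem_cons_of_mem _ hv)]

theorem enc_zero (l : List ℕ) : enc l (fun _ => 0) = 0 := by
  induction l with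
  | nil => rfl
  | cons a l ih => simp [enc, ih]

theorem dec_enc {l : List ℕ} {σ : ℕ → ℕ} (h : ∀ v ∈ l, σ v < 4) {v : ℕ} (hv : v ∈ l) :
    dec l (enc l σ) v = σ v := by
  induction l with
  | nil => simp at hv
  | cons a l ih =>
    have h2 := h a List.mem_cons_self
    by_cases e : a = v
    · subst e
      simp only [dec, enc, List.idxOf_cons_self, pow_zero, Nat.div_one]
      lia
    · have hv' : v ∈ l := by simpa [Ne.symm e] using hv
      rw [← ih (fun v hv => h v (List.mem_cons_of_mem _ hv)) hv']
      simp only [dec, enc, List.idxOf_cons_ne _ e, Nat.succ_eq_add_one, pow_succ']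
      rw [← Nat.div_div_eq_div_mul]
      congr 2
      lia

theorem enc_update {l : List ℕ} (hl : l.Nodup) {σ : ℕ → ℕ} {v : ℕ} (hv : v ∈ l) (h0 : σ v = 0)
    (d : ℕ) : enc l (Function.update σ v d) = enc l σ + d * 4 ^ l.idxOf v := by
  induction l with
  | nil => simp at hv
  | cons a l ih =>
    rw [List.nodup_cons] at hl
    by_cases e : a = v
    · subst e
      have : enc l (Function.update σ a d) = enc l σ := enc_congr fun u hu =>
        Function.update_of_ne (fun e : u = a => hl.1 (e ▸ hu)) _ _
      simp [enc, this, h0, add_comm]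
    · have hv' : v ∈ l := by simpa [Ne.symm e] using hv
      simp only [enc, List.idxOf_cons_ne _ e, Nat.succ_eq_add_one, pow_succ', ih hl.2 hv',
        Function.update_of_ne e]
      ring

/-- The digits of the elements of `l'` are entered into the code of a state of `l` one by one. -/
theorem enc_take_succ {l l' : List ℕ} (hl : l.Nodup) (hl' : l'.Nodup) {j : ℕ}
    (hj : j < l'.length) (f : ℕ → ℕ) :
    enc l (fun u => if u ∈ l'.take (j + 1) then f u else 0) =
      enc l (fun u => if u ∈ l'.take j then f u else 0) +
        if l'[j] ∈ l then f l'[j] * 4 ^ l.idxOf l'[j] else 0 := by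
  have hnot : l'[j] ∉ l'.take j := by
    intro h
    obtain ⟨i, hi, e⟩ := List.mem_take_iff_getElem.1 h
    have := (List.Nodup.getElem_inj_iff hl').1 e
    lia
  have hmem (u : ℕ) : u ∈ l'.take (j + 1) ↔ u ∈ l'.take j ∨ u = l'[j] := by
    rw [List.take_succ_eq_append_getElem hj, List.mem_append, List.mem_singleton]
  split_ifs with h
  · rw [← enc_update hl h (by simp [hnot])]
    refine enc_congr fun u _ => ?_
    rw [Function.update_apply]
    by_cases e : u = l'[j]
    · simp [hmem, e]
    · simp [hmem, e]
  · refine enc_congr fun u hu => ?_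
    have e : u ≠ l'[j] := fun e => h (e ▸ hu)
    simp [hmem, e]

theorem enc_take_zero (l l' : List ℕ) (f : ℕ → ℕ) :
    enc l (fun u => if u ∈ l'.take 0 then f u else 0) = 0 := by
  simpa using enc_zero l

end SteinerDP

/-! ### Dynamic programming over a tree decomposition -/

namespace SteinerDP

/-- A digraph on `0, …, n - 1` with a root, terminals, costs and a covering family of bags. The
nodes `y ≥ t` are virtual and have empty bags; the node `t` is the parent of the root of
the tree. -/
structure Net where
  n : ℕ
  t : ℕ
  r : ℕ
  bag : ℕ → List ℕ
  adj : ℕ → ℕ → Prop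
  term : ℕ → Prop
  cost : ℕ → ℝ
  nodup : ∀ y, (bag y).Nodup
  lt : ∀ y, ∀ v ∈ bag y, v < n
  virt : ∀ y, t ≤ y → bag y = []
  cover : ∀ v < n, ∃ y < t, v ∈ bag y
  edge : ∀ u v, adj u v → ∃ y < t, u ∈ bag y ∧ v ∈ bag y
  term_lt : ∀ v, term v → v < n
  cost_nonneg : ∀ v, 0 ≤ cost v

namespace Net

variable (D : Net)

/-- The vertex `v` is the root or has an in-neighbour in `F`. -/
def Sat (F : Finset ℕ) (v : ℕ) : Prop := v = D.r ∨ ∃ u ∈ F, D.adj u v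

/-- `F` contains the terminals, and each of its vertices other than the root has an in-neighbour
in `F`. -/
def LocallyFeasible (F : Finset ℕ) : Prop :=
  (∀ v ∈ F, v < D.n) ∧ (∀ v, D.term v → v ∈ F) ∧ ∀ v ∈ F, D.Sat F v

/-- The vertex `v` lies in the bag of a node of `N`. -/
def Covered (N : Set ℕ) (v : ℕ) : Prop := ∃ z ∈ N, v ∈ D.bag z

/-- The vertex `v` is the root or has an in-neighbour in `F` by an arc inside the bag of a node
of `N`. -/
def SatIn (N : Set ℕ) (F : Finset ℕ) (v : ℕ) : Prop :=
  v = D.r ∨ ∃ u ∈ F, D.adj u v ∧ ∃ z ∈ N, u ∈ D.bag z ∧ v ∈ D.bag z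

/-- The set `F` is a partial solution on the bags of the nodes of `N`, of cost `x` outside the bag
of `y`, whose state on the bag of `y` is encoded by `c`: the digit `0` stands for a vertex outside
`F`, the digit `1` for a vertex of `F`, and greater digits for vertices of `F` that are known to be
the root or to have an in-neighbour in `F`. -/
structure Sound (y : ℕ) (N : Set ℕ) (c : ℕ) (x : ℝ) (F : Finset ℕ) : Prop where
  mem : ∀ v ∈ D.bag y, v ∈ F ↔ dec (D.bag y) c v ≠ 0
  covered : ∀ v ∈ F, D.Covered N v
  sat : ∀ v ∈ D.bag y, 2 ≤ dec (D.bag y) c v → D.Sat F v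
  forgotten : ∀ v ∈ F, v ∉ D.bag y → D.Sat F v
  term : ∀ v, D.Covered N v → D.term v → v ∈ F
  cost : x = ∑ v ∈ F with v ∉ D.bag y, D.cost v

/-- The function `σ` describes the restriction to the bag of `y` of the part of `F` covered by the
nodes in `N`; its value is `2` only at vertices that are satisfied there. -/
def IsState (y : ℕ) (N : Set ℕ) (F : Finset ℕ) (σ : ℕ → ℕ) : Prop :=
  ∀ v ∈ D.bag y, (σ v ≠ 0 ↔ v ∈ F ∧ D.Covered N v) ∧ σ v ≤ 2 ∧ (σ v = 2 → D.SatIn N F v)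

open Classical in
/-- The cost of the vertices of `F` that are covered by `N` and do not lie in the bag of `y`. -/
noncomputable def partCost (y : ℕ) (N : Set ℕ) (F : Finset ℕ) : ℝ :=
  ∑ v ∈ F with D.Covered N v ∧ v ∉ D.bag y, D.cost v

/-- The table with flags `fl` and values `vl` has, for every state of the restriction of a locally
feasible set, an entry that is at most the cost of this restriction. -/
def Complete (y : ℕ) (N : Set ℕ) (fl : ℕ → ℕ) (vl : ℕ → ℝ) : Prop :=
  ∀ F, D.LocallyFeasible F → ∀ σ, D.IsState y N F σ →
    fl (enc (D.bag y) σ) = 1 ∧ vl (enc (D.bag y) σ) ≤ D.partCost y N F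

variable {D}

theorem Sat.mono {F F' : Finset ℕ} (h : F ⊆ F') {v : ℕ} (hv : D.Sat F v) : D.Sat F' v :=
  hv.imp id fun ⟨u, hu, hu'⟩ => ⟨u, h hu, hu'⟩

theorem Covered.mono {N N' : Set ℕ} (h : N ⊆ N') {v : ℕ} (hv : D.Covered N v) :
    D.Covered N' v := by
  obtain ⟨z, hz, hz'⟩ := hv
  exact ⟨z, h hz, hz'⟩

theorem covered_union {N N' : Set ℕ} {v : ℕ} :
    D.Covered (N ∪ N') v ↔ D.Covered N v ∨ D.Covered N' v := by
  constructor
  · rintro ⟨z, hz | hz, h⟩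
    · exact .inl ⟨z, hz, h⟩
    · exact .inr ⟨z, hz, h⟩
  · rintro (h | h)
    · exact h.mono Set.subset_union_left
    · exact h.mono Set.subset_union_right

theorem covered_singleton {x v : ℕ} : D.Covered {x} v ↔ v ∈ D.bag x := by
  simp [Covered]

theorem IsState.lt_four {y : ℕ} {N : Set ℕ} {F : Finset ℕ} {σ : ℕ → ℕ} (h : D.IsState y N F σ) :
    ∀ v ∈ D.bag y, σ v < 4 := fun v hv => by have := (h v hv).2.1; lia

theorem partCost_nonneg (y : ℕ) (N : Set ℕ) (F : Finset ℕ) : 0 ≤ D.partCost y N F :=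
  Finset.sum_nonneg fun v _ => D.cost_nonneg v

/-! #### A single bag -/

variable (D) in
/-- The state of the bag of `x` with the code `c` contains the terminals of the bag, and the
vertices that claim to be satisfied are the root or have an in-neighbour in the bag. -/
def BaseOK (x c : ℕ) : Prop :=
  ∀ v ∈ D.bag x, (dec (D.bag x) c v = 0 → ¬ D.term v) ∧
    (2 ≤ dec (D.bag x) c v → v = D.r ∨ ∃ u ∈ D.bag x, D.adj u v ∧ dec (D.bag x) c u ≠ 0)

variable (D) in
/-- The vertices of the bag of `x` that are selected by the code `c`. -/
def baseSet (x c : ℕ) : Finset ℕ := (D.bag x).toFinset.filter fun v => dec (D.bag x) c v ≠ 0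

theorem mem_baseSet {x c v : ℕ} :
    v ∈ D.baseSet x c ↔ v ∈ D.bag x ∧ dec (D.bag x) c v ≠ 0 := by
  simp [baseSet]

theorem BaseOK.sound {x c : ℕ} (h : D.BaseOK x c) : D.Sound x {x} c 0 (D.baseSet x c) where
  mem v hv := by simp [mem_baseSet, hv]
  covered v hv := covered_singleton.2 (mem_baseSet.1 hv).1
  sat v hv h2 := ((h v hv).2 h2).imp id fun ⟨u, hu, ha, hd⟩ => ⟨u, mem_baseSet.2 ⟨hu, hd⟩, ha⟩
  forgotten v hv h' := absurd (mem_baseSet.1 hv).1 h'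
  term v hv ht := by
    rw [covered_singleton] at hv
    exact mem_baseSet.2 ⟨hv, fun h0 => (h v hv).1 h0 ht⟩
  cost := by
    rw [Finset.filter_false_of_mem, Finset.sum_empty]
    exact fun v hv => not_not.2 (mem_baseSet.1 hv).1

theorem IsState.baseOK {x : ℕ} {F : Finset ℕ} (hF : D.LocallyFeasible F) {σ : ℕ → ℕ}
    (h : D.IsState x {x} F σ) : D.BaseOK x (enc (D.bag x) σ) := by
  intro v hv
  have h4 := h.lt_four
  rw [dec_enc h4 hv]
  refine ⟨fun h0 ht => ?_, fun h2 => ?_⟩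
  · exact ((h v hv).1.2 ⟨hF.2.1 v ht, covered_singleton.2 hv⟩) h0
  · refine ((h v hv).2.2 (le_antisymm (h v hv).2.1 h2)).imp id ?_
    rintro ⟨u, hu, ha, z, rfl, hz, -⟩
    refine ⟨u, hz, ha, ?_⟩
    rw [dec_enc h4 hz]
    exact (h u hz).1.2 ⟨hu, covered_singleton.2 hz⟩

/-! #### Passing from a node to its parent -/

variable (D) in
/-- The code for the bag of `p` of the state `c` of the bag of `x`, restricted to the common
vertices. -/
def projCode (x p c : ℕ) : ℕ :=
  enc (D.bag p) fun v => if v ∈ D.bag x then dec (D.bag x) c v else 0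

variable (D) in
/-- All the vertices selected by `c` that are forgotten on the way from `x` to `p` are satisfied. -/
def ProjOK (x p c : ℕ) : Prop := ∀ v ∈ D.bag x, v ∉ D.bag p → dec (D.bag x) c v ≠ 1

variable (D) in
/-- The cost of the vertices selected by `c` that are forgotten on the way from `x` to `p`. -/
noncomputable def forgetCost (x p c : ℕ) : ℝ :=
  ∑ v ∈ D.baseSet x c with v ∉ D.bag p, D.cost v

theorem dec_projCode {x p c v : ℕ} (hv : v ∈ D.bag p) :
    dec (D.bag p) (D.projCode x p c) v = if v ∈ D.bag x then dec (D.bag x) c v else 0 := by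
  refine dec_enc (fun u _ => ?_) hv
  split_ifs
  · exact dec_lt ..
  · norm_num

theorem Sound.proj {x p c : ℕ} {N : Set ℕ} {a : ℝ} {F : Finset ℕ} (h : D.Sound x N c a F)
    (hok : D.ProjOK x p c) (hsep : ∀ v ∈ D.bag p, D.Covered N v → v ∈ D.bag x) :
    D.Sound p N (D.projCode x p c) (a + D.forgetCost x p c) F where
  mem v hv := by
    rw [dec_projCode hv]
    split_ifs with hx
    · exact h.mem v hx
    · simpa using fun hF => hx (hsep v hv (h.covered v hF))
  covered := h.covered
  sat v hv h2 := by
    rw [dec_projCode hv] at h2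
    split_ifs at h2 with hx
    · exact h.sat v hx h2
    · simp at h2
  forgotten v hv hp := by
    by_cases hx : v ∈ D.bag x
    · refine h.sat v hx ?_
      have := hok v hx hp
      have := (h.mem v hx).1 hv
      lia
    · exact h.forgotten v hv hx
  term := h.term
  cost := by
    rw [h.cost, forgetCost, ← Finset.sum_union]
    · congr 1
      ext v
      simp only [Finset.mem_union, Finset.mem_filter, mem_baseSet]
      constructor
      · rintro (⟨h1, h2⟩ | ⟨⟨h1, h2⟩, h3⟩)
        · exact ⟨h1, fun h3 => h2 (hsep v h3 (h.covered v h1))⟩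
        · exact ⟨(h.mem v h1).2 h2, h3⟩
      · rintro ⟨h1, h2⟩
        by_cases hx : v ∈ D.bag x
        · exact .inr ⟨⟨hx, (h.mem v hx).1 h1⟩, h2⟩
        · exact .inl ⟨h1, hx⟩
    · rw [Finset.disjoint_left]
      simp only [Finset.mem_filter, mem_baseSet]
      tauto

/-- A state of the bag of `p` that describes a locally feasible set comes from a state of the bag
of `x`. -/
theorem IsState.proj {x p : ℕ} {N : Set ℕ} {F : Finset ℕ} (hF : D.LocallyFeasible F) {σ : ℕ → ℕ}
    (h : D.IsState p N F σ) (hxN : x ∈ N) (hsep : ∀ v ∈ D.bag p, D.Covered N v → v ∈ D.bag x)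
    (hforget : ∀ v ∈ D.bag x, v ∉ D.bag p → ∀ z ≤ D.t, v ∈ D.bag z → z ∈ N) :
    ∃ τ, D.IsState x N F τ ∧ D.ProjOK x p (enc (D.bag x) τ) ∧
      D.projCode x p (enc (D.bag x) τ) = enc (D.bag p) σ ∧
      D.partCost x N F + D.forgetCost x p (enc (D.bag x) τ) = D.partCost p N F := by
  have hcov {v : ℕ} (hv : v ∈ D.bag x) : D.Covered N v := ⟨x, hxN, hv⟩
  let τ : ℕ → ℕ := fun v => if v ∈ D.bag p then σ v else if v ∈ F then 2 else 0
  have hτ : D.IsState x N F τ := by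
    intro v hv
    by_cases hp : v ∈ D.bag p
    · simpa [τ, hp] using h v hp
    · by_cases hvF : v ∈ F
      · simp only [τ, hp, hvF, if_true, if_false]
        refine ⟨by simp [hcov hv], le_rfl, fun _ => (hF.2.2 v hvF).imp id ?_⟩
        rintro ⟨u, hu, ha⟩
        obtain ⟨z, hz, huz, hvz⟩ := D.edge u v ha
        exact ⟨u, hu, ha, z, hforget v hv hp z hz.le hvz, huz, hvz⟩
      · simp [τ, hp, hvF]
  have h4 := hτ.lt_four
  refine ⟨τ, hτ, fun v hv hp => ?_, enc_congr fun v hv => ?_, ?_⟩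
  · rw [dec_enc h4 hv]
    simp only [τ, hp, if_false]
    split_ifs <;> norm_num
  · split_ifs with hx
    · rw [dec_enc h4 hx]; simp [τ, hv]
    · by_contra hne
      exact hx (hsep v hv ((h v hv).1.1 (Ne.symm hne)).2)
  · rw [partCost, forgetCost, partCost, ← Finset.sum_union]
    · congr 1
      ext v
      simp only [Finset.mem_union, Finset.mem_filter, mem_baseSet]
      constructor
      · rintro (⟨h1, h2, h3⟩ | ⟨⟨h1, h2⟩, h3⟩)
        · exact ⟨h1, h2, fun h4 => h3 (hsep v h4 h2)⟩
        · rw [dec_enc h4 h1] at h2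
          exact ⟨((hτ v h1).1.1 h2).1, hcov h1, h3⟩
      · rintro ⟨h1, h2, h3⟩
        by_cases hx : v ∈ D.bag x
        · refine .inr ⟨⟨hx, ?_⟩, h3⟩
          rw [dec_enc h4 hx]
          exact (hτ v hx).1.2 ⟨h1, h2⟩
        · exact .inl ⟨h1, h2, hx⟩
    · rw [Finset.disjoint_left]
      simp only [Finset.mem_filter, mem_baseSet]
      tauto

/-! #### Joining the tables of a node and of one of its children -/

/-- The digit of the first one of the two states that are combined by the digit `d`: a vertex that
is satisfied in the combination is satisfied in the first part (`d = 2`) or in the second one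
(`d = 3`). -/
def digitL (d : ℕ) : ℕ := if d = 3 then 1 else d

/-- The digit of the second one of the two states that are combined by the digit `d`. -/
def digitR (d : ℕ) : ℕ := if d = 3 then 2 else if d = 2 then 1 else d

variable (D) in
/-- The code of the first state that is combined by `c`. -/
def joinL (p c : ℕ) : ℕ := enc (D.bag p) fun v => digitL (dec (D.bag p) c v)

variable (D) in
/-- The code of the second state that is combined by `c`; this state is supported on the bag of the
child `x`. -/
def joinR (x p c : ℕ) : ℕ :=
  enc (D.bag p) fun v => if v ∈ D.bag x then digitR (dec (D.bag p) c v) else 0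

variable (D) in
/-- The code of the combination. -/
def joinZ (x p c : ℕ) : ℕ :=
  enc (D.bag p) fun v => if v ∈ D.bag x then min (dec (D.bag p) c v) 2
    else digitL (dec (D.bag p) c v)

theorem digitL_le {d : ℕ} (h : d < 4) : digitL d ≤ 2 := by unfold digitL; split_ifs <;> lia

theorem digitR_le {d : ℕ} (h : d < 4) : digitR d ≤ 2 := by unfold digitR; split_ifs <;> lia

theorem dec_joinL {p c v : ℕ} (hv : v ∈ D.bag p) :
    dec (D.bag p) (D.joinL p c) v = digitL (dec (D.bag p) c v) :=
  dec_enc (fun u _ => by have := digitL_le (dec_lt (D.bag p) c u); lia) hv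

theorem dec_joinR {x p c v : ℕ} (hv : v ∈ D.bag p) : dec (D.bag p) (D.joinR x p c) v =
    if v ∈ D.bag x then digitR (dec (D.bag p) c v) else 0 :=
  dec_enc (fun u _ => by
    have := digitR_le (dec_lt (D.bag p) c u)
    split_ifs <;> lia) hv

theorem dec_joinZ {x p c v : ℕ} (hv : v ∈ D.bag p) : dec (D.bag p) (D.joinZ x p c) v =
    if v ∈ D.bag x then min (dec (D.bag p) c v) 2 else digitL (dec (D.bag p) c v) :=
  dec_enc (fun u _ => by
    have := digitL_le (dec_lt (D.bag p) c u)
    split_ifs <;> lia) hv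

theorem Sound.join {x p c : ℕ} {N N' : Set ℕ} {a a' : ℝ} {F F' : Finset ℕ}
    (h : D.Sound p N (D.joinL p c) a F) (h' : D.Sound p N' (D.joinR x p c) a' F')
    (hsep : ∀ v, D.Covered N v → D.Covered N' v → v ∈ D.bag p) :
    D.Sound p (N ∪ N') (D.joinZ x p c) (a + a') (F ∪ F') where
  mem v hv := by
    rw [Finset.mem_union, h.mem v hv, h'.mem v hv, dec_joinL hv, dec_joinR hv, dec_joinZ hv,
      digitL, digitR]
    split_ifs <;> lia
  covered v hv := by
    rw [covered_union]
    exact (Finset.mem_union.1 hv).imp (h.covered v) (h'.covered v)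
  sat v hv h2 := by
    rw [dec_joinZ hv] at h2
    by_cases h3 : dec (D.bag p) c v = 3
    · by_cases hx : v ∈ D.bag x
      · refine (h'.sat v hv ?_).mono Finset.subset_union_right
        simp [dec_joinR hv, h3, hx, digitR]
      · simp [hx, h3, digitL] at h2
    · refine (h.sat v hv ?_).mono Finset.subset_union_left
      rw [dec_joinL hv]
      simp only [digitL, h3, if_false] at h2 ⊢
      split_ifs at h2 <;> lia
  forgotten v hv hp := by
    rcases Finset.mem_union.1 hv with h1 | h1
    · exact (h.forgotten v h1 hp).mono Finset.subset_union_left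
    · exact (h'.forgotten v h1 hp).mono Finset.subset_union_right
  term v hv ht := by
    rw [covered_union] at hv
    exact Finset.mem_union.2 (hv.imp (fun hv => h.term v hv ht) (fun hv => h'.term v hv ht))
  cost := by
    rw [h.cost, h'.cost, Finset.filter_union, Finset.sum_union]
    rw [Finset.disjoint_left]
    simp only [Finset.mem_filter]
    exact fun v h1 h2 => h1.2 (hsep v (h.covered v h1.1) (h'.covered v h2.1))

/-- A state that describes the restriction of a locally feasible set to two parts is a combination
of states that describe the restrictions to these parts. -/
theorem IsState.join {x p : ℕ} {N N' : Set ℕ} {F : Finset ℕ} {σ : ℕ → ℕ}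
    (h : D.IsState p (N ∪ N') F σ) (hpN : p ∈ N) (hxN : x ∈ N')
    (hx : ∀ v ∈ D.bag p, D.Covered N' v → v ∈ D.bag x)
    (hsep : ∀ v, D.Covered N v → D.Covered N' v → v ∈ D.bag p) :
    ∃ c < 4 ^ (D.bag p).length, (∃ τ, D.IsState p N F τ ∧ D.joinL p c = enc (D.bag p) τ) ∧
      (∃ τ, D.IsState p N' F τ ∧ D.joinR x p c = enc (D.bag p) τ) ∧
      D.joinZ x p c = enc (D.bag p) σ ∧
      D.partCost p N F + D.partCost p N' F = D.partCost p (N ∪ N') F := by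
  classical
  have hcov {v : ℕ} (hv : v ∈ D.bag p) : D.Covered N v := ⟨p, hpN, hv⟩
  have hcov' {v : ℕ} (hv : v ∈ D.bag x) : D.Covered N' v := ⟨x, hxN, hv⟩
  have hσ {v : ℕ} (hv : v ∈ D.bag p) : σ v ≠ 0 ↔ v ∈ F := by
    rw [(h v hv).1, covered_union]; simp [hcov hv]
  have hsat {v : ℕ} (h2 : D.SatIn (N ∪ N') F v) (h1 : ¬ D.SatIn N F v) :
      D.SatIn N' F v ∧ D.Covered N' v := by
    rcases h2 with rfl | ⟨u, hu, ha, z, hz | hz, huz, hvz⟩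
    · exact absurd (.inl rfl) h1
    · exact absurd (.inr ⟨u, hu, ha, z, hz, huz, hvz⟩) h1
    · exact ⟨.inr ⟨u, hu, ha, z, hz, huz, hvz⟩, z, hz, hvz⟩
  let d : ℕ → ℕ := fun v => if σ v = 2 ∧ ¬ D.SatIn N F v then 3 else σ v
  have h4 : ∀ v ∈ D.bag p, d v < 4 := fun v hv => by
    have := (h v hv).2.1
    simp only [d]; split_ifs <;> lia
  have hd {v : ℕ} (hv : v ∈ D.bag p) : dec (D.bag p) (enc (D.bag p) d) v = d v := dec_enc h4 hv
  refine ⟨enc (D.bag p) d, enc_lt h4, ⟨fun v => digitL (d v), ?_, ?_⟩,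
    ⟨fun v => if v ∈ D.bag x then digitR (d v) else 0, ?_, ?_⟩, ?_, ?_⟩
  · intro v hv
    have h1 := hσ hv
    have h2 := (h v hv).2.1
    simp only [hcov hv, and_true, ← h1, digitL, d]
    by_cases hc : σ v = 2 ∧ ¬ D.SatIn N F v
    · simp [hc]
    · rw [if_neg hc]
      rw [if_neg (by lia)]
      refine ⟨Iff.rfl, h2, fun h3 => ?_⟩
      by_contra hcon
      exact hc ⟨h3, hcon⟩
  · exact enc_congr fun v hv => by rw [hd hv]
  · intro v hv
    have h1 := hσ hv
    have h2 := (h v hv).2.1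
    by_cases hvx : v ∈ D.bag x
    · simp only [hvx, if_true, hcov' hvx, and_true, ← h1, digitR, d]
      by_cases hc : σ v = 2 ∧ ¬ D.SatIn N F v
      · simpa [hc] using (hsat ((h v hv).2.2 hc.1) hc.2).1
      · rw [if_neg hc]
        split_ifs <;> lia
    · have : ¬ D.Covered N' v := fun hc => hvx (hx v hv hc)
      simp [hvx, this]
  · exact enc_congr fun v hv => by rw [hd hv]
  · refine enc_congr fun v hv => ?_
    have h2 := (h v hv).2.1
    rw [hd hv]
    simp only [d, digitL]
    by_cases hc : σ v = 2 ∧ ¬ D.SatIn N F v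
    · have := hx v hv (hsat ((h v hv).2.2 hc.1) hc.2).2
      rw [if_pos hc, if_pos this, hc.1]
      rfl
    · rw [if_neg hc]
      split_ifs <;> lia
  · rw [partCost, partCost, partCost, ← Finset.sum_union]
    · congr 1
      ext v
      simp only [Finset.mem_union, Finset.mem_filter, covered_union]
      tauto
    · rw [Finset.disjoint_left]
      simp only [Finset.mem_filter]
      exact fun v h1 h2 => h1.2.2 (hsep v h1.2.1 h2.2.1)

/-! #### The parts of the tree that have been merged -/

variable (D) in
/-- The nodes `0, …, t` are divided into parts `N y`, one for each node `y` with the property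
`alive`; the bag of `y` separates the part `N y` from the other parts. -/
structure Parts (alive : ℕ → Prop) (N : ℕ → Set ℕ) : Prop where
  self : ∀ y, alive y → y ∈ N y
  le : ∀ y, alive y → ∀ z ∈ N y, z ≤ D.t
  cover : ∀ z ≤ D.t, ∃ y, alive y ∧ z ∈ N y
  disj : ∀ y y' z, alive y → alive y' → z ∈ N y → z ∈ N y' → y = y'
  sep : ∀ y z z' v, alive y → z ∈ N y → z' ≤ D.t → z' ∉ N y → v ∈ D.bag z → v ∈ D.bag z' →
    v ∈ D.bag y

variable (D) in
theorem Parts.singletons : D.Parts (fun y => y ≤ D.t) (fun y => {y}) where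
  self _ _ := rfl
  le y hy z hz := by obtain rfl : z = y := hz; exact hy
  cover z hz := ⟨z, hz, rfl⟩
  disj y y' z _ _ h h' := by obtain rfl : z = y := h; exact h'
  sep y z z' v _ h _ _ hv _ := by obtain rfl : z = y := h; exact hv

section merge

variable {alive : ℕ → Prop} {N : ℕ → Set ℕ} (h : D.Parts alive N) {x p : ℕ} (hx : alive x)
  (hp : alive p) (hne : x ≠ p)
  (hP : ∀ v ∈ D.bag x, ∀ y, alive y → y ≠ x → v ∈ D.bag y → v ∈ D.bag p)

include h hx hp hne

theorem Parts.mem_child {v : ℕ} (hv : v ∈ D.bag p) (hc : D.Covered (N x) v) : v ∈ D.bag x := by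
  obtain ⟨z, hz, hvz⟩ := hc
  exact h.sep x z p v hx hz (h.le p hp p (h.self p hp))
    (fun hpx => hne (h.disj x p p hx hp hpx (h.self p hp))) hvz hv

theorem Parts.mem_parent {v : ℕ} (hc : D.Covered (N p) v) (hc' : D.Covered (N x) v) :
    v ∈ D.bag p := by
  obtain ⟨z, hz, hvz⟩ := hc
  obtain ⟨z', hz', hvz'⟩ := hc'
  exact h.sep p z z' v hp hz (h.le x hx z' hz')
    (fun hpx => hne (h.disj x p z' hx hp hz' hpx)) hvz hvz'

include hP

omit hp hne in
theorem Parts.mem_of_forgotten {v : ℕ} (hv : v ∈ D.bag x) (hv' : v ∉ D.bag p) {z : ℕ}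
    (hz : z ≤ D.t) (hvz : v ∈ D.bag z) : z ∈ N x := by
  by_contra hzx
  obtain ⟨y, hy, hzy⟩ := h.cover z hz
  have hyx : y ≠ x := fun e => hzx (e ▸ hzy)
  have : v ∈ D.bag y := h.sep y z x v hy hzy (h.le x hx x (h.self x hx))
    (fun hxy => hyx (h.disj y x x hy hx hxy (h.self x hx))) hvz hv
  exact hv' (hP v hv y hy hyx this)

theorem Parts.merge : D.Parts (fun y => alive y ∧ y ≠ x)
    (Function.update N p (N p ∪ N x)) where
  self y hy := by
    rw [Function.update_apply]; split_ifs with e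
    · rw [e]; exact .inl (h.self p hp)
    · exact h.self y hy.1
  le y hy z hz := by
    rw [Function.update_apply] at hz; split_ifs at hz with e
    · exact hz.elim (h.le p hp z) (h.le x hx z)
    · exact h.le y hy.1 z hz
  cover z hz := by
    obtain ⟨y, hy, hzy⟩ := h.cover z hz
    by_cases e : y = x
    · exact ⟨p, ⟨hp, hne.symm⟩, by rw [Function.update_self]; exact .inr (e ▸ hzy)⟩
    · refine ⟨y, ⟨hy, e⟩, ?_⟩
      rw [Function.update_apply]; split_ifs with e'
      · exact .inl (e' ▸ hzy)
      · exact hzy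
  disj y y' z hy hy' hz hz' := by
    rw [Function.update_apply] at hz hz'
    split_ifs at hz hz' with e e' e'
    · rw [e, e']
    · rcases hz with hz | hz
      · exact e.trans (h.disj p y' z hp hy'.1 hz hz')
      · exact absurd (h.disj x y' z hx hy'.1 hz hz').symm hy'.2
    · rcases hz' with hz' | hz'
      · exact (h.disj y p z hy.1 hp hz hz').trans e'.symm
      · exact absurd (h.disj y x z hy.1 hx hz hz') hy.2
    · exact h.disj y y' z hy.1 hy'.1 hz hz'
  sep y z z' v hy hz hz't hz' hv hv' := by
    rw [Function.update_apply] at hz hz'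
    split_ifs at hz hz' with e
    · subst e
      rw [Set.mem_union, not_or] at hz'
      rcases hz with hz | hz
      · exact h.sep y z z' v hp hz hz't hz'.1 hv hv'
      · have hvx := h.sep x z z' v hx hz hz't hz'.2 hv hv'
        by_contra hvp
        exact hz'.2 (h.mem_of_forgotten hx hP hvx hvp hz't hv')
    · exact h.sep y z z' v hy.1 hz hz't hz' hv hv'

end merge

end Net

end SteinerDP

/-! ### Local feasibility on acyclic digraphs -/

namespace SteinerInput

open SteinerDP

variable {n t : ℕ} (X : SteinerInput n t)

/-- The bag of the node `y` as a list of numbers; it is empty for `y ≥ t`. -/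
def bagList (y : ℕ) : List ℕ := if h : y < t then (X.bags ⟨y, h⟩).map Fin.val else []

theorem mem_bagList {y v : ℕ} :
    v ∈ X.bagList y ↔ ∃ (hy : y < t) (hv : v < n), (⟨v, hv⟩ : Fin n) ∈ X.𝒯.bag ⟨y, hy⟩ := by
  unfold bagList
  split_ifs with h
  · simp only [List.mem_map, X.mem_bags]
    constructor
    · rintro ⟨a, ha, rfl⟩; exact ⟨h, a.2, ha⟩
    · rintro ⟨_, hv, ha⟩; exact ⟨_, ha, rfl⟩
  · simp [h]

/-- The instance with its bags, on natural numbers. -/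
noncomputable def net : Net where
  n := n
  t := t
  r := X.I.r
  bag := X.bagList
  adj u v := ∃ (hu : u < n) (hv : v < n), X.I.D.Adj ⟨u, hu⟩ ⟨v, hv⟩
  term v := ∃ hv : v < n, (⟨v, hv⟩ : Fin n) ∈ X.I.T
  cost v := if hv : v < n then X.I.c ⟨v, hv⟩ else 0
  nodup y := by
    unfold bagList
    split_ifs with h
    · exact (X.bags_nodup _).map Fin.val_injective
    · exact List.nodup_nil
  lt y v hv := by obtain ⟨_, h, _⟩ := X.mem_bagList.1 hv; exact h
  virt y hy := by simp [bagList, hy]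
  cover v hv := by
    obtain ⟨y, hy⟩ := X.𝒯.cover ⟨v, hv⟩
    exact ⟨y, y.2, X.mem_bagList.2 ⟨y.2, hv, hy⟩⟩
  edge := by
    rintro u v ⟨hu, hv, h⟩
    obtain ⟨y, h1, h2⟩ := X.𝒯.edge ⟨u, hu⟩ ⟨v, hv⟩ (by
      rw [Digraph.toSimpleGraphInclusive, SimpleGraph.fromRel_adj]
      refine ⟨fun e => ?_, .inl h⟩
      rw [e] at h
      exact X.I.acyclic _ (.single h))
    exact ⟨y, y.2, X.mem_bagList.2 ⟨y.2, hu, h1⟩, X.mem_bagList.2 ⟨y.2, hv, h2⟩⟩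
  term_lt v hv := hv.1
  cost_nonneg v := by split_ifs <;> simp

/-- The vertices in a set of numbers. -/
def toVerts (n : ℕ) (F : Finset ℕ) : Finset (Fin n) := Finset.univ.filter fun v => (v : ℕ) ∈ F

theorem cost_toVerts {F : Finset ℕ} (hF : ∀ v ∈ F, v < n) :
    (X.I.cost (toVerts n F) : ℝ) = ∑ v ∈ F, X.net.cost v := by
  rw [SteinerInstance.cost, NNReal.coe_sum]
  refine Finset.sum_bij (fun v _ => (v : ℕ)) ?_ ?_ ?_ ?_
  · intro v hv; simpa [toVerts] using hv
  · intro v _ u _ h; exact Fin.ext h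
  · intro v hv; exact ⟨⟨v, hF v hv⟩, by simpa [toVerts] using hv, rfl⟩
  · intro v _; simp [net]

/-- As the digraph is acyclic, going backwards from a vertex of a locally feasible set, from
in-neighbour to in-neighbour, ends at the root. -/
theorem feasible_of_locallyFeasible {F : Finset ℕ} (hF : X.net.LocallyFeasible F) :
    X.I.Feasible (toVerts n F) := by
  have key : ∀ v : Fin n, (v : ℕ) ∈ F → X.I.ConnectedIn (toVerts n F) X.I.r v := by
    have : IsTrans (Fin n) (Relation.TransGen X.I.D.Adj) := ⟨fun _ _ _ => .trans⟩
    have : Std.Irrefl (Relation.TransGen X.I.D.Adj) := ⟨X.I.acyclic⟩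
    have wf := Finite.wellFounded_of_trans_of_irrefl (Relation.TransGen X.I.D.Adj)
    intro v
    induction v using wf.induction with
    | _ v ih =>
    intro hv
    have hv' : v ∈ toVerts n F := by simpa [toVerts] using hv
    rcases hF.2.2 v hv with h | ⟨u, hu, hun, _, h⟩
    · obtain rfl : v = X.I.r := Fin.ext h
      exact ⟨hv', hv', .refl⟩
    · obtain ⟨h1, h2, h3⟩ := ih ⟨u, hun⟩ (.single h) hu
      exact ⟨h1, hv', h3.tail ⟨h2, hv', h⟩⟩
  rintro v hv
  exact key v (hF.2.1 v ⟨v.2, hv⟩)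

/-- The vertices that are reachable from the root in a feasible set form a locally feasible set. -/
theorem exists_locallyFeasible {F : Finset (Fin n)} (hF : X.I.Feasible F) :
    ∃ G, X.net.LocallyFeasible G ∧ toVerts n G ⊆ F := by
  classical
  refine ⟨(F.filter fun v => X.I.ConnectedIn F X.I.r v).image Fin.val, ⟨?_, ?_, ?_⟩, ?_⟩
  · simp only [Finset.mem_image]
    rintro _ ⟨v, _, rfl⟩; exact v.2
  · rintro v ⟨hv, hvT⟩
    have h := hF _ hvT
    exact Finset.mem_image.2 ⟨_, Finset.mem_filter.2 ⟨h.2.1, h⟩, rfl⟩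
  · simp only [Finset.mem_image]
    rintro _ ⟨v, hv, rfl⟩
    obtain ⟨hv, h1, h2, h3⟩ := Finset.mem_filter.1 hv
    rcases h3.cases_tail with e | ⟨u, hu, huF, _, ha⟩
    · left; rw [e]; rfl
    · right
      exact ⟨u, Finset.mem_image.2 ⟨u, Finset.mem_filter.2 ⟨huF, h1, huF, hu⟩, rfl⟩, u.2, v.2, ha⟩
  · intro v hv
    simp only [toVerts, Finset.mem_filter, Finset.mem_image] at hv
    obtain ⟨_, u, hu, e⟩ := hv
    exact Fin.ext e ▸ hu.1

theorem optimal_toVerts {G : Finset ℕ} (hG : X.net.LocallyFeasible G)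
    (hmin : ∀ F, X.net.LocallyFeasible F →
      ∑ v ∈ G, X.net.cost v ≤ ∑ v ∈ F, X.net.cost v) :
    X.I.Optimal (toVerts n G) := by
  refine ⟨X.feasible_of_locallyFeasible hG, fun F' hF' => ?_⟩
  obtain ⟨F, hF, hsub⟩ := X.exists_locallyFeasible hF'
  have h1 := hmin F hF
  rw [← X.cost_toVerts hG.1, ← X.cost_toVerts hF.1, NNReal.coe_le_coe] at h1
  exact h1.trans (Finset.sum_le_sum_of_subset hsub)

end SteinerInput

/-! ### Peeling off the leaves of a tree -/

namespace TreePeel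

variable {A : ℕ → ℕ → Prop}

/-- The graph `A` is connected on `R`. -/
def ConnOn (A : ℕ → ℕ → Prop) (R : Finset ℕ) : Prop :=
  ∀ a ∈ R, ∀ b ∈ R, Relation.ReflTransGen (fun a b => b ∈ R ∧ A a b) a b

/-- Deleting a vertex with only one neighbour does not destroy connectedness. -/
theorem ConnOn.erase (hA : ∀ a b, A a b → A b a) (hA' : ∀ a, ¬ A a a) {R : Finset ℕ} {u p : ℕ}
    (h : ConnOn A R) (hp : ∀ z ∈ R, A u z → z = p) : ConnOn A (R.erase u) := by
  intro a ha b hb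
  rw [Finset.mem_erase] at ha hb
  have key : ∀ c, Relation.ReflTransGen (fun a b => b ∈ R ∧ A a b) a c →
      c ∈ R ∧ (c ≠ u → Relation.ReflTransGen (fun a b => b ∈ R.erase u ∧ A a b) a c) ∧
      (c = u → Relation.ReflTransGen (fun a b => b ∈ R.erase u ∧ A a b) a p) := by
    intro c hc
    induction hc with
    | refl => exact ⟨ha.2, fun _ => .refl, fun e => absurd e ha.1⟩
    | @tail c d _ hcd ih =>
      refine ⟨hcd.1, fun hd => ?_, ?_⟩
      · by_cases hcu : c = u
        · rw [hp d hcd.1 (hcu ▸ hcd.2)]; exact ih.2.2 hcu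
        · exact (ih.2.1 hcu).tail ⟨Finset.mem_erase.2 ⟨hd, hcd.1⟩, hcd.2⟩
      · rintro rfl
        have hcu : c ≠ d := fun e => hA' d (e ▸ hcd.2)
        rw [← hp c ih.1 (hA _ _ hcd.2)]
        exact ih.2.1 hcu
  exact (key b (h a ha.2 b hb.2)).2.1 hb.1

open Classical in
/-- The sum of `g` over the neighbours in `R` of the vertex `y`. -/
noncomputable def nbSum (A : ℕ → ℕ → Prop) (g : ℕ → ℕ) (R : Finset ℕ) (y : ℕ) : ℕ :=
  ∑ z ∈ R with A y z, g z

open Classical in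
theorem nbSum_erase (g : ℕ → ℕ) {R : Finset ℕ} {u : ℕ} (hu : u ∈ R) (y : ℕ) :
    nbSum A g R y = nbSum A g (R.erase u) y + if A y u then g u else 0 := by
  simp only [nbSum, Finset.sum_filter]
  rw [← Finset.sum_erase_add _ _ hu]

/-- The nodes below `t` that are not among the first `i` ones of the queue `q`. -/
def remaining (t : ℕ) (q : ℕ → ℕ) (i : ℕ) : Finset ℕ :=
  (Finset.range t).filter fun y => ∀ j < i, q j ≠ y

theorem mem_remaining {t i y : ℕ} {q : ℕ → ℕ} :
    y ∈ remaining t q i ↔ y < t ∧ ∀ j < i, q j ≠ y := by simp [remaining]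

theorem remaining_succ (t i : ℕ) (q : ℕ → ℕ) :
    remaining t q (i + 1) = (remaining t q i).erase (q i) := by
  ext y
  simp only [mem_remaining, Finset.mem_erase]
  constructor
  · rintro ⟨h1, h2⟩
    exact ⟨(h2 i (by lia)).symm, h1, fun j hj => h2 j (by lia)⟩
  · rintro ⟨h0, h1, h2⟩
    refine ⟨h1, fun j hj => ?_⟩
    rcases Nat.lt_succ_iff_lt_or_eq.1 hj with h | rfl
    · exact h2 j h
    · exact h0.symm

theorem remaining_congr {t i : ℕ} {q q' : ℕ → ℕ} (h : ∀ j < i, q j = q' j) :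
    remaining t q i = remaining t q' i := by
  ext y
  simp only [mem_remaining]
  refine and_congr_right fun _ => forall₂_congr fun j hj => by rw [h j hj]

/-- The state of the peeling after `i` leaves have been removed: the queue `q` of length `k`
contains the removed nodes, followed by the remaining nodes with at most one remaining neighbour;
`dg` and `sm` are the number and the sum of the remaining neighbours; `par` gives the neighbour of
a leaf when it was removed, and `t` for the last node. -/
structure Peeled (A : ℕ → ℕ → Prop) (t : ℕ) (bag : ℕ → List ℕ) (i k : ℕ)
    (q dg sm par : ℕ → ℕ) : Prop where
  le : i ≤ k
  lt : ∀ j < k, q j < t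
  inj : ∀ j < k, ∀ j' < k, q j = q j' → j = j'
  card : (remaining t q i).card + i = t
  conn : ConnOn A (remaining t q i)
  sum : (remaining t q i).Nonempty →
    ∑ y ∈ remaining t q i, nbSum A (fun _ => 1) (remaining t q i) y + 2 =
      2 * (remaining t q i).card
  dg_eq : ∀ y ∈ remaining t q i, dg y = nbSum A (fun _ => 1) (remaining t q i) y
  sm_eq : ∀ y ∈ remaining t q i, sm y = nbSum A (fun z => z) (remaining t q i) y
  low : ∀ j, i ≤ j → j < k → dg (q j) ≤ 1
  queued : ∀ y ∈ remaining t q i, dg y ≤ 1 → ∃ j, i ≤ j ∧ j < k ∧ q j = y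
  dg_t : dg t = 0
  par_le : ∀ j < i, par (q j) ≤ t ∧ ∀ j' ≤ j, q j' ≠ par (q j)
  par_sep : ∀ j < i, ∀ v ∈ bag (q j), ∀ y < t, (∀ j' ≤ j, q j' ≠ y) → v ∈ bag y →
    v ∈ bag (par (q j))

namespace Peeled

variable {t : ℕ} {bag : ℕ → List ℕ} {i k : ℕ} {q dg sm par : ℕ → ℕ}

theorem le_t (h : Peeled A t bag i k q dg sm par) : k ≤ t := by
  have := Finset.card_le_card_of_injOn q (s := Finset.range k) (t := Finset.range t)
    (fun j hj => by simpa using h.lt j (by simpa using hj))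
    (fun j hj j' hj' e => h.inj j (by simpa using hj) j' (by simpa using hj') e)
  simpa using this

/-- As a tree with `m` vertices has `m - 1` edges, one of the degrees is at most `1`, and the queue
does not run empty. -/
theorem lt_length (h : Peeled A t bag i k q dg sm par) (hi : i < t) : i < k := by
  by_contra hk
  have hne : (remaining t q i).Nonempty := Finset.card_pos.1 (by have := h.card; lia)
  have h2 : ∀ y ∈ remaining t q i, 2 ≤ nbSum A (fun _ => 1) (remaining t q i) y := by
    intro y hy
    by_contra hlt
    obtain ⟨j, h1, h2, _⟩ := h.queued y hy (by rw [h.dg_eq y hy]; lia)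
    lia
  have := Finset.card_nsmul_le_sum _ _ _ h2
  have := h.sum hne
  simp only [smul_eq_mul] at *
  lia

theorem mem_remaining_of (h : Peeled A t bag i k q dg sm par) {j : ℕ} (hij : i ≤ j)
    (hj : j < k) : q j ∈ remaining t q i :=
  mem_remaining.2 ⟨h.lt j hj, fun j' hj' e => by
    have := h.inj j' (by lia) j hj e; lia⟩

open Classical in
/-- The result of removing the leaf at the head of the queue, except for the extension of the
queue. -/
theorem step_core (hA : ∀ a b, A a b → A b a) (hA' : ∀ a, ¬ A a a)
    (hbag : ∀ u p y v, A u p → p ≠ u →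
      Relation.ReflTransGen (fun a b => b ≠ u ∧ A a b) p y → v ∈ bag u → v ∈ bag y → v ∈ bag p)
    (h : Peeled A t bag i k q dg sm par) (hi : i < t) {u p : ℕ} (hu : u = q i)
    (hp : p = if dg u = 1 then sm u else t) :
    let dg' := Function.update dg p (dg p - 1)
    let sm' := Function.update sm p (sm p - u)
    let par' := Function.update par u p
    let R := remaining t q (i + 1)
    p ≤ t ∧ dg' t = 0 ∧ R.card + (i + 1) = t ∧ ConnOn A R ∧
    (R.Nonempty → ∑ y ∈ R, nbSum A (fun _ => 1) R y + 2 = 2 * R.card) ∧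
    (∀ y ∈ R, dg' y = nbSum A (fun _ => 1) R y) ∧
    (∀ y ∈ R, sm' y = nbSum A (fun z => z) R y) ∧
    (p ≠ t → p ∈ R) ∧
    (∀ j < i + 1, par' (q j) ≤ t ∧ ∀ j' ≤ j, q j' ≠ par' (q j)) ∧
    (∀ j < i + 1, ∀ v ∈ bag (q j), ∀ y < t, (∀ j' ≤ j, q j' ≠ y) → v ∈ bag y →
      v ∈ bag (par' (q j))) := by
  intro dg' sm' par' R
  have hik := h.lt_length hi
  have huR : u ∈ remaining t q i := hu ▸ h.mem_remaining_of le_rfl hik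
  have hR : R = (remaining t q i).erase u := hu ▸ remaining_succ t i q
  have hut : u < t := (mem_remaining.1 huR).1
  have hcard : R.card + (i + 1) = t := by
    have := h.card
    have h1 := Finset.card_erase_add_one huR
    rw [hR]; lia
  have hpar_lt : ∀ j < i, par' (q j) = par (q j) := fun j hj =>
    Function.update_of_ne ((mem_remaining.1 huR).2 j hj) _ _
  have hpar_i : par' (q i) = p := by rw [← hu]; exact Function.update_self ..
  have hRmem (y : ℕ) : y ∈ R ↔ y < t ∧ ∀ j ≤ i, q j ≠ y := by
    simp only [R, mem_remaining, Nat.lt_succ_iff]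
  -- the statements on `par'` need only be checked for the new leaf
  have finish (hpt : p ≤ t) (h1 : ∀ j' ≤ i, q j' ≠ p)
      (h2 : ∀ v ∈ bag u, ∀ y ∈ R, v ∈ bag y → v ∈ bag p) :
      (∀ j < i + 1, par' (q j) ≤ t ∧ ∀ j' ≤ j, q j' ≠ par' (q j)) ∧
      (∀ j < i + 1, ∀ v ∈ bag (q j), ∀ y < t, (∀ j' ≤ j, q j' ≠ y) → v ∈ bag y →
        v ∈ bag (par' (q j))) := by
    constructor
    · intro j hj
      rcases Nat.lt_succ_iff_lt_or_eq.1 hj with hj | rfl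
      · rw [hpar_lt j hj]; exact h.par_le j hj
      · rw [hpar_i]; exact ⟨hpt, h1⟩
    · intro j hj v hv y hy hyj hvy
      rcases Nat.lt_succ_iff_lt_or_eq.1 hj with hj | rfl
      · rw [hpar_lt j hj]; exact h.par_sep j hj v hv y hy hyj hvy
      · rw [hpar_i]; exact h2 v (hu ▸ hv) y ((hRmem y).2 ⟨hy, hyj⟩) hvy
  by_cases hd : dg u = 1
  · rw [if_pos hd] at hp
    obtain ⟨z, hz⟩ : ∃ z, (remaining t q i).filter (A u) = {z} := by
      rw [← Finset.card_eq_one]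
      have := h.dg_eq u huR
      rw [hd, nbSum] at this
      simpa using this.symm
    obtain rfl : p = z := by
      rw [hp, h.sm_eq u huR, nbSum, hz, Finset.sum_singleton]
    have hpz : p ∈ remaining t q i ∧ A u p := Finset.mem_filter.1 (hz ▸ Finset.mem_singleton_self p)
    have huniq : ∀ y ∈ remaining t q i, A u y → y = p := fun y hy ha =>
      Finset.mem_singleton.1 (hz ▸ Finset.mem_filter.2 ⟨hy, ha⟩)
    have hpu : p ≠ u := fun e => hA' u (e ▸ hpz.2)
    have hpR : p ∈ R := by rw [hR]; exact Finset.mem_erase.2 ⟨hpu, hpz.1⟩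
    have hpt : p < t := (mem_remaining.1 hpz.1).1
    have hsub {y : ℕ} (hy : y ∈ R) : y ∈ remaining t q i := by
      rw [hR] at hy; exact Finset.mem_of_mem_erase hy
    have hconn : ConnOn A R := by rw [hR]; exact h.conn.erase hA hA' huniq
    have hAyu {y : ℕ} (hy : y ∈ R) : A y u ↔ y = p :=
      ⟨fun ha => huniq y (hsub hy) (hA _ _ ha), fun e => e ▸ hA _ _ hpz.2⟩
    have hnb (g : ℕ → ℕ) {y : ℕ} (hy : y ∈ R) :
        nbSum A g (remaining t q i) y = nbSum A g R y + if y = p then g u else 0 := by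
      rw [nbSum_erase g huR, ← hR]
      simp only [hAyu hy]
    refine ⟨hpt.le, ?_, hcard, hconn, fun _ => ?_, fun y hy => ?_, fun y hy => ?_, fun _ => hpR,
      finish hpt.le ((hRmem p).1 hpR).2 fun v hv y hy hvy => ?_⟩
    · simp only [dg']
      rw [Function.update_of_ne hpt.ne', h.dg_t]
    · have h1 := h.sum ⟨u, huR⟩
      rw [← Finset.sum_erase_add _ _ huR, ← hR, Finset.sum_congr rfl fun y hy => hnb _ hy,
        Finset.sum_add_distrib, Finset.sum_ite_eq', if_pos hpR, ← h.dg_eq u huR, hd] at h1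
      have h2 := Finset.card_erase_add_one huR
      rw [← hR] at h2
      lia
    · have h1 := h.dg_eq y (hsub hy)
      rw [hnb _ hy] at h1
      simp only [dg', Function.update_apply]
      split_ifs with e
      · rw [if_pos e] at h1; rw [← e]; lia
      · rw [if_neg e] at h1; exact h1
    · have h1 := h.sm_eq y (hsub hy)
      rw [hnb _ hy] at h1
      simp only [sm', Function.update_apply]
      split_ifs with e
      · rw [if_pos e] at h1; rw [← e]; lia
      · rw [if_neg e] at h1; exact h1
    · refine hbag u p y v hpz.2 hpu ?_ hv hvy
      refine Relation.ReflTransGen.mono ?_ p y (hconn p hpR y hy)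
      refine fun a b hab => ⟨?_, hab.2⟩
      have := hab.1
      rw [hR] at this
      exact Finset.ne_of_mem_erase this
  · rw [if_neg hd] at hp
    subst hp
    have hd0 : nbSum A (fun _ => 1) (remaining p q i) u = 0 := by
      rw [← h.dg_eq u huR]
      have := h.low i le_rfl hik
      rw [← hu] at this
      lia
    have hRe : R = ∅ := by
      rw [Finset.eq_empty_iff_forall_notMem]
      intro y hy
      rw [hR, Finset.mem_erase] at hy
      rcases (h.conn u huR y hy.2).cases_head with e | ⟨z, ⟨hz, ha⟩, _⟩
      · exact hy.1 e.symm
      · have : (remaining p q i).filter (A u) = ∅ := by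
          rw [← Finset.card_eq_zero]; simpa [nbSum] using hd0
        exact Finset.notMem_empty z (this ▸ Finset.mem_filter.2 ⟨hz, ha⟩)
    refine ⟨le_rfl, by simp [dg', h.dg_t], hcard, ?_, ?_, ?_, ?_, fun e => absurd rfl e,
      finish le_rfl (fun j hj => (h.lt j (by lia)).ne) ?_⟩ <;> simp [hRe, ConnOn]

/-- Removing the leaf at the head of the queue; if its neighbour becomes a leaf, this neighbour is
added to the queue. -/
theorem step (hA : ∀ a b, A a b → A b a) (hA' : ∀ a, ¬ A a a)
    (hbag : ∀ u p y v, A u p → p ≠ u →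
      Relation.ReflTransGen (fun a b => b ≠ u ∧ A a b) p y → v ∈ bag u → v ∈ bag y → v ∈ bag p)
    (h : Peeled A t bag i k q dg sm par) (hi : i < t) {u p : ℕ} (hu : u = q i)
    (hp : p = if dg u = 1 then sm u else t) :
    (dg p - 1 = 1 → Peeled A t bag (i + 1) (k + 1) (Function.update q k p)
      (Function.update dg p (dg p - 1)) (Function.update sm p (sm p - u))
      (Function.update par u p)) ∧
    (dg p - 1 ≠ 1 → Peeled A t bag (i + 1) k q
      (Function.update dg p (dg p - 1)) (Function.update sm p (sm p - u))
      (Function.update par u p)) := by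
  obtain ⟨h1, h2, h3, h4, h5, h6, h7, h8, h9, h10⟩ := h.step_core hA hA' hbag hi hu hp
  have hik := h.lt_length hi
  have hdle (y : ℕ) : Function.update dg p (dg p - 1) y ≤ dg y := by
    rw [Function.update_apply]; split_ifs with e
    · rw [e]; lia
    · rfl
  have hold {y : ℕ} (hy : y ∈ remaining t q (i + 1)) (hy1 : dg y ≤ 1) :
      ∃ j, i + 1 ≤ j ∧ j < k ∧ q j = y := by
    rw [remaining_succ, Finset.mem_erase] at hy
    obtain ⟨j, hj1, hj2, hj3⟩ := h.queued y hy.2 hy1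
    refine ⟨j, ?_, hj2, hj3⟩
    rcases hj1.eq_or_lt with e | e
    · exact absurd (e ▸ hj3.symm) hy.1
    · exact e
  constructor
  · intro hd
    have hpt : p ≠ t := by rintro rfl; rw [h.dg_t] at hd; lia
    have hpR := h8 hpt
    have hpq : ∀ j < k, q j ≠ p := by
      intro j hj e
      by_cases hji : j < i + 1
      · exact (mem_remaining.1 hpR).2 j hji e
      · have := h.low j (by lia) hj
        rw [e] at this; lia
    have hq : ∀ j < k, Function.update q k p j = q j := fun j hj =>
      Function.update_of_ne hj.ne _ _
    have hqk : Function.update q k p k = p := Function.update_self ..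
    have hrem : remaining t (Function.update q k p) (i + 1) = remaining t q (i + 1) :=
      remaining_congr fun j hj => hq j (by lia)
    refine ⟨by lia, fun j hj => ?_, fun j hj j' hj' e => ?_, hrem ▸ h3, hrem ▸ h4, hrem ▸ h5,
      hrem ▸ h6, hrem ▸ h7, fun j hj hj' => ?_, fun y hy hy1 => ?_, h2, fun j hj => ?_,
      fun j hj => ?_⟩
    · rcases Nat.lt_succ_iff_lt_or_eq.1 hj with hj | rfl
      · rw [hq j hj]; exact h.lt j hj
      · rw [hqk]; exact (mem_remaining.1 hpR).1
    · rcases Nat.lt_succ_iff_lt_or_eq.1 hj with hj | rfl <;>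
        rcases Nat.lt_succ_iff_lt_or_eq.1 hj' with hj' | rfl
      · rw [hq j hj, hq j' hj'] at e; exact h.inj j hj j' hj' e
      · rw [hq j hj, hqk] at e; exact absurd e (hpq j hj)
      · rw [hq j' hj', hqk] at e; exact absurd e.symm (hpq j' hj')
      · rfl
    · rcases Nat.lt_succ_iff_lt_or_eq.1 hj' with hj' | rfl
      · rw [hq j hj']; exact (hdle _).trans (h.low j (by lia) hj')
      · rw [hqk, Function.update_self, hd]
    · rw [hrem] at hy
      by_cases e : y = p
      · exact ⟨k, by lia, by lia, by rw [hqk, e]⟩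
      · rw [Function.update_of_ne e] at hy1
        obtain ⟨j, hj1, hj2, hj3⟩ := hold hy hy1
        exact ⟨j, hj1, by lia, by rw [hq j hj2, hj3]⟩
    · rw [hq j (by lia)]
      refine ⟨(h9 j hj).1, fun j' hj' => ?_⟩
      rw [hq j' (by lia)]; exact (h9 j hj).2 j' hj'
    · rw [hq j (by lia)]
      intro v hv y hy hyj
      refine h10 j hj v hv y hy fun j' hj' => ?_
      rw [← hq j' (by lia)]; exact hyj j' hj'
  · intro hd
    refine ⟨by lia, h.lt, h.inj, h3, h4, h5, h6, h7, fun j hj hj' =>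
      (hdle _).trans (h.low j (by lia) hj'), fun y hy hy1 => hold hy ?_, h2, h9, h10⟩
    rw [Function.update_apply] at hy1
    split_ifs at hy1 with e
    · rw [e]; lia
    · exact hy1

end Peeled

end TreePeel

namespace SteinerInput

open TreePeel

variable {n t : ℕ} (X : SteinerInput n t)

/-- Adjacency in the tree of the decomposition, on natural numbers. -/
def treeAdj (a b : ℕ) : Prop := ∃ (ha : a < t) (hb : b < t), X.𝒯.tree.Adj ⟨a, ha⟩ ⟨b, hb⟩

theorem treeAdj_symm (a b : ℕ) (h : X.treeAdj a b) : X.treeAdj b a := by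
  obtain ⟨ha, hb, h⟩ := h; exact ⟨hb, ha, h.symm⟩

theorem not_treeAdj_self (a : ℕ) : ¬ X.treeAdj a a := fun ⟨_, _, h⟩ => X.𝒯.tree.loopless.irrefl _ h

theorem connOn_treeAdj : ConnOn X.treeAdj (Finset.range t) := by
  intro a ha b hb
  rw [Finset.mem_range] at ha hb
  obtain ⟨p⟩ := X.𝒯.isTree.1.preconnected ⟨a, ha⟩ ⟨b, hb⟩
  have key {a b : Fin t} (p : X.𝒯.tree.Walk a b) :
      Relation.ReflTransGen (fun a b => b ∈ Finset.range t ∧ X.treeAdj a b) (a : ℕ) (b : ℕ) := by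
    induction p with
    | nil => exact .refl
    | @cons a c b h _ ih => exact .head ⟨by simp, a.2, c.2, h⟩ ih
  exact key p

/-- If the vertex `v` lies in the bags of `u` and of a node that is reached from the neighbour `p`
of `u` without passing through `u`, then it lies in the bag of `p`. -/
theorem mem_bag_of_reach (u p y v : ℕ) (h : X.treeAdj u p) (hpu : p ≠ u)
    (hy : Relation.ReflTransGen (fun a b => b ≠ u ∧ X.treeAdj a b) p y)
    (hv : v ∈ X.bagList u) (hvy : v ∈ X.bagList y) : v ∈ X.bagList p := by
  obtain ⟨hu, hp, ha⟩ := h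
  have key : ∃ (hy : y < t) (w : X.𝒯.tree.Walk ⟨p, hp⟩ ⟨y, hy⟩), ⟨u, hu⟩ ∉ w.support := by
    clear hvy
    induction hy with
    | refl => exact ⟨hp, .nil, by simpa using fun e : u = p => hpu e.symm⟩
    | @tail b c _ hbc ih =>
      obtain ⟨hb, w, hw⟩ := ih
      obtain ⟨hcu, _, hc, hbc⟩ := hbc
      refine ⟨hc, w.concat hbc, ?_⟩
      rw [SimpleGraph.Walk.support_concat]
      simp only [List.mem_append, List.mem_singleton, Fin.mk.injEq, not_or]
      exact ⟨hw, fun e => hcu e.symm⟩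
  obtain ⟨hy, w, hw⟩ := key
  obtain ⟨_, hvn, hvu⟩ := X.mem_bagList.1 hv
  obtain ⟨_, _, hvy⟩ := X.mem_bagList.1 hvy
  classical
  have hb : ⟨u, hu⟩ ∉ w.bypass.support := fun h => hw (w.support_bypass_subset_support h)
  refine X.mem_bagList.2 ⟨hp, hvn, X.𝒯.path _ _ _ (.cons ha w.bypass)
    ((SimpleGraph.Walk.cons_isPath_iff _ _).2 ⟨w.bypass_isPath, hb⟩) hvu hvy _ ?_⟩
  simp

/-- What the tree edge `e` contributes to the sum of `g` over the neighbours of `y`. -/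
def linkTerm (g : ℕ → ℕ) (y : ℕ) (e : Fin t × Fin t) : ℕ :=
  (if (e.1 : ℕ) = y then g e.2 else 0) + if (e.2 : ℕ) = y then g e.1 else 0

open Classical in
theorem sum_linkTerm (g : ℕ → ℕ) {y : ℕ} (hy : y < t) :
    (X.links.map (linkTerm g y)).sum = nbSum X.treeAdj g (Finset.range t) y := by
  have h1 : ∀ e ∈ X.links, linkTerm g y e =
      ∑ z : Fin t, if s(e.1, e.2) = s((⟨y, hy⟩ : Fin t), z) then g z else 0 := by
    intro e he
    have hne : e.1 ≠ e.2 := by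
      have : X.𝒯.tree.Adj e.1 e.2 := (X.mem_links _ _).1 (List.mem_map.2 ⟨e, he, rfl⟩)
      exact this.ne
    obtain ⟨a, b⟩ := e
    simp only at hne
    have h2 (z : Fin t) : (if s(a, b) = s((⟨y, hy⟩ : Fin t), z) then g z else 0) =
        (if b = z then (if (a : ℕ) = y then g z else 0) else 0) +
        (if a = z then (if (b : ℕ) = y then g z else 0) else 0) := by
      have e1 (c : Fin t) : c = ⟨y, hy⟩ ↔ (c : ℕ) = y := Fin.ext_iff
      simp only [Sym2.eq_iff, e1]
      by_cases h1 : b = z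
      · subst h1
        simp [hne]
      · by_cases h2 : a = z
        · subst h2; simp [h1]
        · simp [h1, h2]
    rw [Finset.sum_congr rfl fun z _ => h2 z, Finset.sum_add_distrib]
    simp [linkTerm]
  have h2 (z : Fin t) : (X.links.map fun e =>
      if s(e.1, e.2) = s((⟨y, hy⟩ : Fin t), z) then g z else 0).sum =
      if X.𝒯.tree.Adj ⟨y, hy⟩ z then g z else 0 := by
    have h3 : (X.links.map fun e => if s(e.1, e.2) = s((⟨y, hy⟩ : Fin t), z) then g z else 0) =
        (X.links.map fun e => s(e.1, e.2)).map
          fun q => if q = s((⟨y, hy⟩ : Fin t), z) then g z else 0 := by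
      rw [List.map_map]; rfl
    rw [h3, ← List.sum_toFinset _ X.links_nodup, Finset.sum_ite_eq']
    simp only [List.mem_toFinset, X.mem_links]
  have h4 : (X.links.map (linkTerm g y)).sum = ∑ z : Fin t,
      (X.links.map fun e => if s(e.1, e.2) = s((⟨y, hy⟩ : Fin t), z) then g z else 0).sum := by
    rw [List.map_congr_left h1]
    induction X.links with
    | nil => simp
    | cons a l ih => simp only [List.map_cons, List.sum_cons, ih, Finset.sum_add_distrib]
  rw [h4, Finset.sum_congr rfl fun z _ => h2 z, nbSum, Finset.sum_filter, Finset.sum_range]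
  refine Finset.sum_congr rfl fun z _ => ?_
  simp [treeAdj, hy]

theorem length_links : X.links.length + 1 = t := by
  classical
  have h := X.𝒯.isTree.card_edgeFinset
  rw [Fintype.card_fin] at h
  refine Eq.trans ?_ h
  rw [← List.length_map (fun e : Fin t × Fin t => s(e.1, e.2)),
    ← List.toFinset_card_of_nodup X.links_nodup]
  congr 2
  ext q
  induction q with
  | _ a b =>
  rw [List.mem_toFinset, X.mem_links, SimpleGraph.mem_edgeFinset, SimpleGraph.mem_edgeSet]

theorem sum_degrees : ∑ y ∈ Finset.range t,
    nbSum X.treeAdj (fun _ => 1) (Finset.range t) y + 2 = 2 * t := by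
  have h1 : ∑ y ∈ Finset.range t, nbSum X.treeAdj (fun _ => 1) (Finset.range t) y =
      2 * X.links.length := by
    rw [Finset.sum_congr rfl fun y hy => (X.sum_linkTerm _ (Finset.mem_range.1 hy)).symm]
    induction X.links with
    | nil => simp
    | cons e l ih =>
      simp only [List.map_cons, List.sum_cons, Finset.sum_add_distrib, ih, List.length_cons]
      simp [linkTerm, Finset.sum_add_distrib]
      lia
  have := X.length_links
  lia

end SteinerInput

/-! ### The program

The word registers `0` to `3` are those of the input; `4` holds the size `m` of the largest bag,
`5` holds `Q = 4 ^ m`, `6` and `7` hold `t + 1` and `(t + 1) * Q`, `8` the first free address of the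
tables, `9` the address of the final table; the others are local. Beyond the arrays of the input
and of the output there are the word arrays `8` (sizes of the bags), `9` (`y * n + v` holds `0` if
`v` is not in the bag of `y`, and otherwise its position plus one), `10` (powers of `4`), `11`
(adjacency matrix), `12` and `13` (number and sum of the remaining neighbours of a node), `14`
(elimination order of the nodes), `15` (parents), `16`, `17`, `18` (tables: flags and the two
addresses from which an entry arose), `19` (addresses of the current tables of the nodes), `20`
(marks for the reconstruction of the solution), and the real array `1` (values of the tables). The
tables of the nodes `0, …, t` start at the addresses `0, Q, …, t * Q`; later tables follow. -/

namespace SteinerProg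

open RAM RAM.Prog

/-- Enter the bag of the node in register `10` into the array of positions. -/
def posLoop : Prog := forLoop 13 12
  (.storeWord 9 (.reg 10 * .reg 0 + .load 4 (.reg 11 + .reg 13)) (.reg 13 + 1))

/-- Read the offset and the size of the bag of the node in register `10`, and update the maximum. -/
def bagHead : Prog :=
  .setWord 11 (.load 3 (.reg 10)) ;;
  .setWord 12 (.load 3 (.reg 10 + 1) - .reg 11) ;;
  .storeWord 8 (.reg 10) (.reg 12) ;;
  .ite (.wlt (.reg 4) (.reg 12)) (.setWord 4 (.reg 12)) .skip

/-- Sizes of the bags and positions in the bags. -/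
def bagProg : Prog := forLoop 10 3 (bagHead ;; posLoop)

/-- The powers of `4`. -/
def powProg : Prog :=
  (.storeWord 10 0 1 ;; .setWord 5 1) ;;
  (forLoop 10 4 (.setWord 5 (.reg 5 * 4) ;; .storeWord 10 (.reg 10 + 1) (.reg 5)) ;;
  (.setWord 6 (.reg 3 + 1) ;; .setWord 7 (.reg 6 * .reg 5)))

/-- The adjacency matrix. -/
def arcProg : Prog := forLoop 10 1
  (.storeWord 11 (.load 0 (.reg 10) * .reg 0 + .load 1 (.reg 10)) 1)

/-- Enter the tree edge with the index in register `10` at both of its ends. -/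
def linkBody : Prog :=
  .setWord 12 (.load 5 (.reg 10)) ;;
  .setWord 13 (.load 6 (.reg 10)) ;;
  .storeWord 12 (.reg 12) (.load 12 (.reg 12) + 1) ;;
  .storeWord 12 (.reg 13) (.load 12 (.reg 13) + 1) ;;
  .storeWord 13 (.reg 12) (.load 13 (.reg 12) + .reg 13) ;;
  .storeWord 13 (.reg 13) (.load 13 (.reg 13) + .reg 12)

/-- The numbers and sums of the neighbours in the tree. -/
def linkProg : Prog := .setWord 11 (.reg 3 - 1) ;; forLoop 10 11 linkBody

/-- The leaves of the tree are put into the queue. -/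
def leafProg : Prog := .setWord 13 0 ;; forLoop 10 3
  (.ite (.wlt (.load 12 (.reg 10)) 2)
    (.storeWord 14 (.reg 13) (.reg 10) ;; .setWord 13 (.reg 13 + 1)) .skip)

/-- Remove the leaf at the position in register `10` of the queue. A node without remaining
neighbours gets the parent `t`; then the truncated subtractions keep the count at `t` equal to
`0`. -/
def peelBody : Prog :=
  .setWord 11 (.load 14 (.reg 10)) ;;
  .ite (.weq (.load 12 (.reg 11)) 1) (.setWord 12 (.load 13 (.reg 11))) (.setWord 12 (.reg 3)) ;;
  .storeWord 15 (.reg 11) (.reg 12) ;;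
  .storeWord 12 (.reg 12) (.load 12 (.reg 12) - 1) ;;
  .storeWord 13 (.reg 12) (.load 13 (.reg 12) - .reg 11) ;;
  .ite (.weq (.load 12 (.reg 12)) 1)
    (.storeWord 14 (.reg 13) (.reg 12) ;; .setWord 13 (.reg 13 + 1)) .skip

/-- The elimination order and the parents. -/
def peelProg : Prog := forLoop 10 3 peelBody

/-- The initial addresses of the tables. -/
def curProg : Prog := forLoop 10 6 (.storeWord 19 (.reg 10) (.reg 10 * .reg 5))

/-- Set register `19` if the vertex at the position in register `20` is selected and has an arc to
the vertex in register `17`. -/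
def satBody : Prog :=
  .setWord 21 (.load 4 (.reg 13 + .reg 20)) ;;
  .ite (.and (.weq (.load 11 (.reg 21 * .reg 0 + .reg 17)) 1)
      (.not (.weq (.reg 12 / .load 10 (.reg 20) % 4) 0)))
    (.setWord 19 1) .skip

def checkHead : Prog :=
  .setWord 17 (.load 4 (.reg 13 + .reg 16)) ;;
  .setWord 18 (.reg 12 / .load 10 (.reg 16) % 4) ;;
  .setWord 19 0

/-- Reject the state if a terminal is not selected, or if a vertex that claims to be satisfied is
not the root and has no selected in-neighbour in the bag. -/
def checkTail : Prog :=
  .ite (.and (.weq (.reg 18) 0) (.weq (.load 2 (.reg 17)) 1)) (.setWord 15 0) .skip ;;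
  .ite (.and (.wlt 1 (.reg 18)) (.and (.weq (.reg 19) 0) (.not (.weq (.reg 17) (.reg 2)))))
    (.setWord 15 0) .skip

/-- Check the state of the vertex at the position in register `16`. -/
def checkBody : Prog := checkHead ;; (forLoop 20 14 satBody ;; checkTail)

/-- Split the address in register `10` into a node and the code of a state, and look up the bag. -/
def decodeHead : Prog :=
  .setWord 11 (.reg 10 / .reg 5) ;;
  .setWord 12 (.reg 10 % .reg 5) ;;
  .setWord 13 (.load 3 (.reg 11)) ;;
  .setWord 14 (.load 8 (.reg 11)) ;;
  .setWord 15 1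

/-- The tables of the single bags. -/
def baseProg : Prog := forLoop 10 7
  (decodeHead ;; (forLoop 16 14 checkBody ;; .storeWord 16 (.reg 10) (.reg 15)))

/-- Replace the table entry with the address in register `29` by the value in real register `0`,
which arose from the entries with the addresses in the registers `21` and `28`, if this is an
improvement. -/
def relax : Prog :=
  .ite (.and (.weq (.load 16 (.reg 29)) 1) (.rle (.load 1 (.reg 29)) (.reg 0))) .skip
    (.storeWord 16 (.reg 29) 1 ;; .storeReal 1 (.reg 29) (.reg 0) ;;
      .storeWord 17 (.reg 29) (.reg 21) ;; .storeWord 18 (.reg 29) (.reg 28))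

def projHead : Prog :=
  .setWord 21 (.reg 13 + .reg 20) ;;
  .setWord 28 (.reg 21) ;;
  .setWord 22 (.load 16 (.reg 21)) ;;
  .setWord 29 (.reg 15) ;;
  .setReal 0 (.load 1 (.reg 21))

/-- Treat the vertex at the position in register `24`: if it is forgotten, check that it is not
unsatisfied and add its cost; otherwise enter its digit into the code for the parent. -/
def projBody : Prog :=
  .setWord 25 (.load 4 (.reg 18 + .reg 24)) ;;
  .setWord 26 (.reg 20 / .load 10 (.reg 24) % 4) ;;
  .setWord 27 (.load 9 (.reg 12 * .reg 0 + .reg 25)) ;;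
  .ite (.weq (.reg 27) 0)
    (.ite (.weq (.reg 26) 1) (.setWord 22 0) .skip ;;
      .ite (.weq (.reg 26) 0) .skip (.setReal 0 (.reg 0 + .load 0 (.reg 25))))
    (.setWord 29 (.reg 29 + .reg 26 * .load 10 (.reg 27 - 1)))

/-- Pass the table of a node on to its parent. -/
def projProg : Prog := forLoop 20 5
  (projHead ;; (forLoop 24 17 projBody ;; .ite (.weq (.reg 22) 1) relax .skip))

def joinHead : Prog :=
  .setWord 21 (.reg 14) ;;
  .setWord 28 (.reg 15) ;;
  .setWord 29 (.reg 16)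

/-- Add the digits of the vertex at the position in register `24` to the addresses, in the registers
`21`, `28` and `29`, of the two entries that are combined and of the result. -/
def joinBody : Prog :=
  .setWord 25 (.load 4 (.reg 18 + .reg 24)) ;;
  .setWord 23 (.load 10 (.reg 24)) ;;
  .setWord 26 (.reg 20 / .reg 23 % 4) ;;
  .setWord 27 (.load 9 (.reg 11 * .reg 0 + .reg 25)) ;;
  .ite (.weq (.reg 26) 3)
    (.setWord 21 (.reg 21 + .reg 23) ;;
      .ite (.weq (.reg 27) 0) (.setWord 29 (.reg 29 + .reg 23))
        (.setWord 29 (.reg 29 + 2 * .reg 23) ;; .setWord 28 (.reg 28 + 2 * .reg 23)))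
    (.setWord 21 (.reg 21 + .reg 26 * .reg 23) ;;
      .setWord 29 (.reg 29 + .reg 26 * .reg 23) ;;
      .ite (.weq (.reg 27) 0) .skip
        (.ite (.weq (.reg 26) 2) (.setWord 28 (.reg 28 + .reg 23))
          (.setWord 28 (.reg 28 + .reg 26 * .reg 23))))

def joinTail : Prog :=
  .setReal 0 (.load 1 (.reg 21) + .load 1 (.reg 28)) ;;
  .ite (.and (.weq (.load 16 (.reg 21)) 1) (.weq (.load 16 (.reg 28)) 1)) relax .skip

/-- Combine the table of a node with the table that was passed on to it. -/
def joinProg : Prog := forLoop 20 5 (joinHead ;; (forLoop 24 17 joinBody ;; joinTail))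

/-- Look up the next leaf, its parent, their tables, and the addresses of the two new tables. -/
def mergeHead : Prog :=
  .setWord 11 (.load 14 (.reg 10)) ;;
  .setWord 12 (.load 15 (.reg 11)) ;;
  .setWord 13 (.load 19 (.reg 11)) ;;
  .setWord 14 (.load 19 (.reg 12)) ;;
  .setWord 15 (.reg 8) ;;
  .setWord 16 (.reg 8 + .reg 5) ;;
  .setWord 17 (.load 8 (.reg 11)) ;;
  .setWord 18 (.load 3 (.reg 11))

/-- Look up the bag of the parent. -/
def mergeMid : Prog :=
  .setWord 17 (.load 8 (.reg 12)) ;;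
  .setWord 18 (.load 3 (.reg 12))

/-- The joined table becomes the table of the parent. -/
def mergeTail : Prog :=
  .storeWord 19 (.reg 12) (.reg 16) ;;
  .setWord 8 (.reg 16 + .reg 5)

def mergeBody : Prog := mergeHead ;; (projProg ;; (mergeMid ;; (joinProg ;; mergeTail)))

/-- Eliminate the nodes one by one. -/
def mergeProg : Prog := .setWord 8 (.reg 7) ;; forLoop 10 3 mergeBody

/-- Visit the next address downwards; if its entry is marked, mark the two entries from which it
arose. -/
def markBody : Prog :=
  .setWord 12 (.reg 8 - 1 - .reg 10) ;;
  .ite (.weq (.load 20 (.reg 12)) 1)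
    (.storeWord 20 (.load 17 (.reg 12)) 1 ;; .storeWord 20 (.load 18 (.reg 12)) 1) .skip

/-- Mark the table entries from which the optimal one arose. -/
def markProg : Prog :=
  (.storeWord 20 (.reg 9) 1 ;; .setWord 11 (.reg 8 - .reg 7)) ;; forLoop 10 11 markBody

def outInner : Prog := .ite (.weq (.reg 12 / .load 10 (.reg 16) % 4) 0) .skip
  (.storeWord 7 (.load 4 (.reg 13 + .reg 16)) 1)

/-- Output the vertices that are selected by the marked entries of the tables of single bags. -/
def outProg : Prog := forLoop 10 7
  (.ite (.weq (.load 20 (.reg 10)) 1) (decodeHead ;; forLoop 16 14 outInner) .skip)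

/-- Read off from the table of the virtual node whether there is a solution, and output it. -/
def finishProg : Prog :=
  .setWord 9 (.load 19 (.reg 3)) ;;
  .ite (.weq (.load 16 (.reg 9)) 1) (markProg ;; (outProg ;; .setWord 0 1)) (.setWord 0 0)

/-- The algorithm. -/
def mainProg : Prog :=
  bagProg ;; (powProg ;; (arcProg ;; (linkProg ;; (leafProg ;; (peelProg ;; (curProg ;;
    (baseProg ;; (mergeProg ;; finishProg))))))))

/-! ### The data that the program computes from the input -/

/-- The word length suffices for all the numbers that occur. -/
structure Room (W n t m : ℕ) : Prop where
  const : 100 < 2 ^ W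
  pos : (t + 2) * (n + 2) ≤ 2 ^ W
  arc : (n + 2) * (n + 2) ≤ 2 ^ W
  link : (t + 2) * (t + 2) ≤ 2 ^ W
  tab : (3 * t + 8) * 4 ^ m ≤ 2 ^ W

variable {n t : ℕ}

/-- The constant data of the dynamic program are in their places. -/
structure Env (X : SteinerInput n t) (W m : ℕ) (s : Store) : Prop where
  hn : s.word 0 = n
  hr : s.word 2 = X.I.r
  ht : s.word 3 = t
  hQ : s.word 5 = 4 ^ m
  ht1 : s.word 6 = t + 1
  htQ : s.word 7 = (t + 1) * 4 ^ m
  le : ∀ y, (X.bagList y).length ≤ m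
  term : ∀ v < n, s.wmem 2 v = 1 ↔ X.net.term v
  addr : ∀ y ≤ t, ∀ j < (X.bagList y).length, s.wmem 3 y + j < 2 ^ W
  elem : ∀ y ≤ t, ∀ j, (h : j < (X.bagList y).length) →
    s.wmem 4 (s.wmem 3 y + j) = (X.bagList y)[j]
  size : ∀ y ≤ t, s.wmem 8 y = (X.bagList y).length
  pos : ∀ y ≤ t, ∀ v < n, s.wmem 9 (y * n + v) =
    if v ∈ X.bagList y then (X.bagList y).idxOf v + 1 else 0
  pow : ∀ j ≤ m, s.wmem 10 j = 4 ^ j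
  adj : ∀ u < n, ∀ v < n, s.wmem 11 (u * n + v) = 1 ↔ X.net.adj u v
  cost : ∀ v < n, s.rmem 0 v = X.net.cost v

/-- The program does not assign to the constant data. -/
def keepsEnv (p : Prog) : Bool :=
  !(p.setsWord 0 || p.setsWord 2 || p.setsWord 3 || p.setsWord 5 || p.setsWord 6 ||
    p.setsWord 7 || p.putsWord 2 || p.putsWord 3 || p.putsWord 4 || p.putsWord 8 ||
    p.putsWord 9 || p.putsWord 10 || p.putsWord 11 || p.putsReal 0)

theorem Env.frame {X : SteinerInput n t} {W m : ℕ} {s s' : Store} {p : Prog}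
    (h : Env X W m s) (hf : Frame p s s') (hp : keepsEnv p = true) : Env X W m s' := by
  simp only [keepsEnv, Bool.not_eq_true', Bool.or_eq_false_iff] at hp
  obtain ⟨⟨⟨⟨⟨⟨⟨⟨⟨⟨⟨⟨⟨h0, h2⟩, h3⟩, h5⟩, h6⟩, h7⟩, a2⟩, a3⟩, a4⟩, a8⟩, a9⟩, a10⟩, a11⟩, r0⟩ := hp
  constructor
  · rw [hf.word 0 h0, h.hn]
  · rw [hf.word 2 h2, h.hr]
  · rw [hf.word 3 h3, h.ht]
  · rw [hf.word 5 h5, h.hQ]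
  · rw [hf.word 6 h6, h.ht1]
  · rw [hf.word 7 h7, h.htQ]
  · exact h.le
  · rw [hf.wmem 2 a2]; exact h.term
  · rw [hf.wmem 3 a3]; exact h.addr
  · rw [hf.wmem 3 a3, hf.wmem 4 a4]; exact h.elem
  · rw [hf.wmem 8 a8]; exact h.size
  · rw [hf.wmem 9 a9]; exact h.pos
  · rw [hf.wmem 10 a10]; exact h.pow
  · rw [hf.wmem 11 a11]; exact h.adj
  · rw [hf.rmem 0 r0]; exact h.cost

end SteinerProg

/-! ### The loops over the vertices of a bag -/

namespace SteinerProg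

open RAM RAM.Prog SteinerDP SteinerDP.Net

set_option linter.unusedSimpArgs false

theorem net_bag {n t : ℕ} (X : SteinerInput n t) : X.net.bag = X.bagList := rfl

variable {n t : ℕ} {X : SteinerInput n t} {W m : ℕ} {s : Store}

theorem getElem_lt (X : SteinerInput n t) {y j : ℕ} (h : j < (X.bagList y).length) :
    (X.bagList y)[j] < n := X.net.lt y _ (List.getElem_mem h)

theorem idxOf_getElem (X : SteinerInput n t) {y j : ℕ} (h : j < (X.bagList y).length) :
    (X.bagList y).idxOf (X.bagList y)[j] = j := (X.net.nodup y).idxOf_getElem j h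

/-- The digit at the position `j` of the list. -/
theorem Env.digit (h : Env X W m s) {y j : ℕ} (c : ℕ) (hj : j < (X.bagList y).length) :
    c / s.wmem 10 j % 4 = dec (X.bagList y) c (X.bagList y)[j] := by
  rw [dec, idxOf_getElem X hj, h.pow j (by have := h.le y; lia)]

theorem Room.mul_add_lt (hR : Room W n t m) {x v : ℕ} (hx : x ≤ t) (hv : v < n) :
    x * n + v < 2 ^ W := by
  have := hR.pos
  nlinarith

theorem Room.mul_add_lt' (hR : Room W n t m) {x v : ℕ} (hx : x < n) (hv : v < n) :
    x * n + v < 2 ^ W := by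
  have := hR.arc
  nlinarith

/-- The partial results of a loop that enters the digits of the vertices of the bag of `x` into a
code for the bag of `p`. -/
theorem exists_partialCode (henv : Env X W m s) (x p : ℕ) {f : ℕ → ℕ} (hf : ∀ v, f v < 4) :
    ∃ E : ℕ → ℕ, E 0 = 0 ∧
      E (X.bagList x).length = enc (X.bagList p) (fun u => if u ∈ X.bagList x then f u else 0) ∧
      (∀ j, (h : j < (X.bagList x).length) → E (j + 1) = E j +
        if (X.bagList x)[j] ∈ X.bagList p then
          f (X.bagList x)[j] * 4 ^ (X.bagList p).idxOf (X.bagList x)[j] else 0) ∧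
      ∀ j, E j < 4 ^ m := by
  refine ⟨fun j => enc (X.bagList p) fun u => if u ∈ (X.bagList x).take j then f u else 0,
    enc_take_zero _ _ _, ?_, fun j hj => enc_take_succ (X.net.nodup p) (X.net.nodup x) hj f,
    fun j => ?_⟩
  · simp
  · refine (enc_lt fun v _ => ?_).trans_le (Nat.pow_le_pow_right (by norm_num) (henv.le p))
    split_ifs
    · exact hf v
    · norm_num

/-- The partial results of a loop that checks a condition for all the elements of a list. -/
theorem exists_partialAll (l : List ℕ) (φ : ℕ → Prop) : ∃ P : ℕ → Prop, P 0 ∧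
    (P l.length ↔ ∀ v ∈ l, φ v) ∧ ∀ j, (h : j < l.length) → (P (j + 1) ↔ P j ∧ φ l[j]) := by
  refine ⟨fun j => ∀ v ∈ l.take j, φ v, by simp, by simp, fun j hj => ?_⟩
  dsimp only
  simp_rw [List.take_succ_eq_append_getElem hj, List.mem_append, List.mem_singleton]
  simp [or_imp, forall_and]

/-- The partial results of a loop that sums up over a list. -/
theorem exists_partialSum (l : List ℕ) (g : ℕ → ℝ) : ∃ G : ℕ → ℝ, G 0 = 0 ∧
    G l.length = (l.map g).sum ∧ ∀ j, (h : j < l.length) → G (j + 1) = G j + g l[j] := by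
  refine ⟨fun j => ((l.take j).map g).sum, by simp, by simp, fun j hj => ?_⟩
  dsimp only
  rw [List.take_succ_eq_append_getElem hj, List.map_append, List.sum_append]
  simp

theorem Room.ne_zero (hR : Room W n t m) : W ≠ 0 := by
  rintro rfl
  simpa using hR.const

theorem Room.one_lt (hR : Room W n t m) : 1 < 2 ^ W := lt_trans (by norm_num) hR.const

theorem sum_map_bagList (X : SteinerInput n t) (y : ℕ) (g : ℕ → ℝ) :
    ((X.bagList y).map g).sum = ∑ v ∈ (X.bagList y).toFinset, g v :=
  (List.sum_toFinset g (X.net.nodup y)).symm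

/-- The loop over the bag of `x` computes the address of the entry for the parent `p`, whether the
entry may be passed on, and its new value. -/
theorem runs_projLoop (hR : Room W n t m) (henv : Env X W m s) (hs : s.FitsIn W)
    {x p c ok b : ℕ} {a : ℝ} (hx : x ≤ t) (hp : p ≤ t)
    (h12 : s.word 12 = p) (h17 : s.word 17 = (X.bagList x).length)
    (h18 : s.word 18 = s.wmem 3 x) (h20 : s.word 20 = c) (h22 : s.word 22 = ok)
    (h29 : s.word 29 = b) (hb : b + 4 ^ m < 2 ^ W) (hr : s.real 0 = a) :
    Runs W (forLoop 24 17 projBody) s (m * 100 + 6) (fun s' =>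
      s'.word 29 = b + X.net.projCode x p c ∧
      (s'.word 22 = 1 ↔ ok = 1 ∧ X.net.ProjOK x p c) ∧
      s'.real 0 = a + X.net.forgetCost x p c) := by
  classical
  obtain ⟨E, E0, El, Es, Elt⟩ := exists_partialCode henv x p (dec_lt (X.bagList x) c)
  obtain ⟨P, P0, Pl, Ps⟩ := exists_partialAll (X.bagList x) fun v =>
    v ∉ X.bagList p → dec (X.bagList x) c v ≠ 1
  obtain ⟨G, G0, Gl, Gs⟩ := exists_partialSum (X.bagList x) fun v =>
    if v ∉ X.bagList p ∧ dec (X.bagList x) c v ≠ 0 then X.net.cost v else 0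
  refine (Runs.forLoop (N := (X.bagList x).length) (B := 92) (fun j s' =>
    s'.word 29 = b + E j ∧ (s'.word 22 = 1 ↔ ok = 1 ∧ P j) ∧ s'.real 0 = a + G j)
    hs ?_ h17 rfl rfl rfl ?_ ?_ fun s' _ _ h => h).mono ?_ ?_
  · exact hR.one_lt
  · simp [h22, h29, hr, E0, P0, G0]
  · rintro j s₁ hj hf hs₁ h24 ⟨i29, i22, ir⟩
    have henv₁ := henv.frame hf rfl
    have hv := henv₁.elem x hx j hj
    have hvn := getElem_lt X hj
    have hd := henv₁.digit c hj
    have hk := henv₁.pos p hp _ hvn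
    have e12 : s₁.word 12 = p := (hf.word 12 rfl).trans h12
    have e18 : s₁.word 18 = s₁.wmem 3 x := by rw [hf.word 18 rfl, hf.wmem 3 rfl, h18]
    have e20 : s₁.word 20 = c := (hf.word 20 rfl).trans h20
    have hcost := henv₁.cost _ hvn
    have hpw : (X.bagList x)[j] ∈ X.bagList p →
        s₁.wmem 10 ((X.bagList p).idxOf (X.bagList x)[j]) =
          4 ^ (X.bagList p).idxOf (X.bagList x)[j] := fun hq =>
      henv₁.pow _ ((List.idxOf_lt_length_iff.2 hq).le.trans (henv.le p))
    have hc := hR.const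
    have hW := hR.ne_zero
    have hpn := hR.mul_add_lt hp hvn
    have haddr := henv₁.addr x hx j hj
    have Es := Es j hj
    have Ps := Ps j hj
    have Gs := Gs j hj
    have Elt := Elt (j + 1)
    have hn := henv₁.hn
    clear henv henv₁
    obtain ⟨v, hvd⟩ : ∃ v, (X.bagList x)[j] = v := ⟨_, rfl⟩
    rw [Es] at Elt
    rw [Es, Gs, Ps]
    simp only [hvd] at *
    obtain ⟨d, hdd⟩ : ∃ d, dec (X.bagList x) c v = d := ⟨_, rfl⟩
    simp only [hdd] at *
    clear E0 El P0 Pl G0 Gl hvd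
    by_cases hq : v ∈ X.bagList p
    · simp only [hq, if_true] at hk Elt
      have := hpw hq
      refine Runs.of_run rfl hs₁ ?_ (by decide) ?_
      · simp [projBody, Prog.Safe, Prog.run, h24, e12, e18, e20, hv, hd, hk, hn, this, i29]
        lia
      · simp [projBody, Prog.run, h24, e12, e18, e20, hv, hd, hk, hn, hq, i22, ir, this, i29]
        lia
    · simp only [hq, if_false] at hk Elt
      refine Runs.of_run rfl hs₁ ?_ (by decide) ?_
      · simp [projBody, Prog.Safe, Prog.run, h24, e12, e18, e20, hv, hd, hk, hn]
        lia
      · by_cases h1 : d = 1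
        · simp [projBody, Prog.run, h24, e12, e18, e20, hv, hd, hk, hn, h1, i29, hq, ir, hcost]
          ring
        · by_cases h0 : d = 0
          · simp [projBody, Prog.run, h24, e12, e18, e20, hv, hd, hk, hn, h0, i29, hq, ir, i22]
          · simp [projBody, Prog.run, h24, e12, e18, e20, hv, hd, hk, hn, h1, h0, i29, hq, ir, hcost,
              i22]
            ring
  · have := Nat.mul_le_mul_right 100 (henv.le x)
    lia
  · rintro s' ⟨h1, h2, h3⟩
    refine ⟨by rw [h1, El]; rfl, by rw [h2, Pl]; rfl, ?_⟩
    rw [h3, Gl, sum_map_bagList, Net.forgetCost, Net.baseSet, Finset.filter_filter,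
      Finset.sum_filter]
    congr 1
    refine Finset.sum_congr rfl fun v _ => ?_
    simp only [and_comm]
    rfl

/-- The loop decides whether a vertex has a selected in-neighbour in the bag. -/
theorem runs_satLoop (hR : Room W n t m) (henv : Env X W m s) (hs : s.FitsIn W)
    {x c v : ℕ} (hx : x ≤ t) (hv : v < n) (h12 : s.word 12 = c)
    (h13 : s.word 13 = s.wmem 3 x) (h14 : s.word 14 = (X.bagList x).length)
    (h17 : s.word 17 = v) (h19 : s.word 19 = 0) :
    Runs W (forLoop 20 14 satBody) s (m * 60 + 6) (fun s' =>
      (s'.word 19 = 0 ↔ ¬ ∃ u ∈ X.bagList x, X.net.adj u v ∧ dec (X.bagList x) c u ≠ 0)) := by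
  classical
  obtain ⟨P, P0, Pl, Ps⟩ := exists_partialAll (X.bagList x) fun u =>
    ¬ (X.net.adj u v ∧ dec (X.bagList x) c u ≠ 0)
  refine (Runs.forLoop (N := (X.bagList x).length) (B := 52) (fun j s' =>
    (s'.word 19 = 0 ↔ P j)) hs hR.one_lt h14 rfl rfl rfl ?_ ?_ fun s' _ _ h => h).mono ?_ ?_
  · simp [h19, P0]
  · rintro j s₁ hj hf hs₁ h20 i19
    have henv₁ := henv.frame hf rfl
    have hu := henv₁.elem x hx j hj
    have hun := getElem_lt X hj
    have hd := henv₁.digit c hj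
    have hadj := henv₁.adj _ hun v hv
    have e12 : s₁.word 12 = c := (hf.word 12 rfl).trans h12
    have e13 : s₁.word 13 = s₁.wmem 3 x := by rw [hf.word 13 rfl, hf.wmem 3 rfl, h13]
    have e17 : s₁.word 17 = v := (hf.word 17 rfl).trans h17
    have hc := hR.const
    have hW := hR.ne_zero
    have hun' := hR.mul_add_lt' hun hv
    have haddr := henv₁.addr x hx j hj
    have Ps := Ps j hj
    have hn := henv₁.hn
    rw [Ps]
    obtain ⟨u, hud⟩ : ∃ u, (X.bagList x)[j] = u := ⟨_, rfl⟩
    simp only [hud] at *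
    refine Runs.of_run rfl hs₁ ?_ (by decide) ?_
    · simp [satBody, Prog.Safe, Prog.run, h20, e12, e13, e17, hu, hn]
      lia
    · by_cases ha : X.net.adj u v <;> by_cases h0 : dec (X.bagList x) c u = 0 <;>
        simp [satBody, Prog.run, h20, e12, e13, e17, hu, hd, hn, hadj, ha, h0, i19]
  · have := Nat.mul_le_mul_right 60 (henv.le x)
    lia
  · rintro s' h
    rw [h, Pl]
    push Not
    rfl

theorem checkTail_word (s : Store) : (checkTail.run s).word 15 =
    if s.word 18 = 0 ∧ s.wmem 2 (s.word 17) = 1 ∨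
      1 < s.word 18 ∧ s.word 19 = 0 ∧ s.word 17 ≠ s.word 2 then 0 else s.word 15 := by
  by_cases h1 : s.word 18 = 0 ∧ s.wmem 2 (s.word 17) = 1
  · simp [checkTail, Prog.run, h1]
  · by_cases h2 : 1 < s.word 18 ∧ s.word 19 = 0 ∧ s.word 17 ≠ s.word 2
    · simp [checkTail, Prog.run, h1, h2]
    · simp [checkTail, Prog.run, h1, h2]

/-- The loop decides whether a state is admissible in the table of a single bag. -/
theorem runs_checkLoop (hR : Room W n t m) (henv : Env X W m s) (hs : s.FitsIn W)
    {x c : ℕ} (hx : x ≤ t) (h12 : s.word 12 = c)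
    (h13 : s.word 13 = s.wmem 3 x) (h14 : s.word 14 = (X.bagList x).length)
    (h15 : s.word 15 = 1) :
    Runs W (forLoop 16 14 checkBody) s (m * (m * 60 + 100) + 6) (fun s' =>
      (s'.word 15 = 1 ↔ X.net.BaseOK x c)) := by
  classical
  obtain ⟨P, P0, Pl, Ps⟩ := exists_partialAll (X.bagList x) fun v =>
    (dec (X.bagList x) c v = 0 → ¬ X.net.term v) ∧
    (2 ≤ dec (X.bagList x) c v → v = X.net.r ∨
      ∃ u ∈ X.bagList x, X.net.adj u v ∧ dec (X.bagList x) c u ≠ 0)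
  refine (Runs.forLoop (N := (X.bagList x).length) (B := m * 60 + 92) (fun j s' =>
    (s'.word 15 = 1 ↔ P j)) hs hR.one_lt h14 rfl rfl rfl ?_ ?_ fun s' _ _ h => h).mono ?_ ?_
  · simp [h15, P0]
  · rintro j s₁ hj hf hs₁ h16 i15
    have henv₁ := henv.frame hf rfl
    have hv := henv₁.elem x hx j hj
    have hvn := getElem_lt X hj
    have hd := henv₁.digit c hj
    have e12 : s₁.word 12 = c := (hf.word 12 rfl).trans h12
    have e13 : s₁.word 13 = s₁.wmem 3 x := by rw [hf.word 13 rfl, hf.wmem 3 rfl, h13]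
    have e14 : s₁.word 14 = (X.bagList x).length := (hf.word 14 rfl).trans h14
    have hc := hR.const
    have hW := hR.ne_zero
    have haddr := henv₁.addr x hx j hj
    have Ps := Ps j hj
    have ht := henv₁.term _ hvn
    rw [Ps]
    obtain ⟨v, hvd⟩ : ∃ v, (X.bagList x)[j] = v := ⟨_, rfl⟩
    simp only [hvd] at *
    obtain ⟨d, hdd⟩ : ∃ d, dec (X.bagList x) c v = d := ⟨_, rfl⟩
    simp only [hdd] at *
    refine (Runs.run_seq (B := m * 60 + 6 + 50) rfl hs₁ ?_ fun hs₂ hf₂ => ?_).mono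
      (by have : checkHead.steps ≤ 30 := by decide
          lia) fun _ h => h
    · simp [checkHead, Prog.Safe, Prog.run, h16, e13, hv]
      lia
    · have henv₂ := henv₁.frame hf₂ rfl
      refine Runs.seq hs₂ (runs_satLoop hR henv₂ hs₂ hx hvn (c := c) ?_ ?_ ?_ ?_ ?_)
        fun s₃ hf₃ hs₃ h19 => ?_
      · simpa [checkHead, Prog.run] using e12
      · simpa [checkHead, Prog.run] using e13
      · simpa [checkHead, Prog.run] using e14
      · simp [checkHead, Prog.run, h16, e13, hv]
      · simp [checkHead, Prog.run]
      · have e15 : s₃.word 15 = s₁.word 15 := (hf₃.word 15 rfl).trans (hf₂.word 15 rfl)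
        have e17 : s₃.word 17 = v := by
          rw [hf₃.word 17 rfl]; simp [checkHead, Prog.run, h16, e13, hv]
        have e18 : s₃.word 18 = d := by
          rw [hf₃.word 18 rfl]; simp [checkHead, Prog.run, h16, e12, hd]
        have e2 : s₃.word 2 = X.net.r := (henv₂.frame hf₃ rfl).hr
        have em : s₃.wmem 2 v = 1 ↔ X.net.term v := (henv₂.frame hf₃ rfl).term v hvn
        refine Runs.of_run rfl hs₃ ?_ (by decide) ?_
        · simp [checkTail, Prog.Safe, Prog.run]
          lia
        · simp only [Store.setW_word, show (15 : ℕ) ≠ 16 by norm_num, if_false, checkTail_word,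
            e17, e18, e2, em, h19, e15]
          split_ifs with k
          · have : ¬ ((d = 0 → ¬ X.net.term v) ∧ (2 ≤ d → v = X.net.r ∨
                ∃ u ∈ X.bagList x, X.net.adj u v ∧ dec (X.bagList x) c u ≠ 0)) := by
              rintro ⟨k1, k2⟩
              rcases k with k | k
              · exact k1 k.1 k.2
              · exact (k2 k.1).elim k.2.2 k.2.1
            simp [this]
          · rw [i15, and_iff_left]
            rw [not_or] at k
            refine ⟨fun k1 k2 => k.1 ⟨k1, k2⟩, fun k1 => ?_⟩
            by_contra k2
            rw [not_or] at k2
            exact k.2 ⟨k1, k2.2, k2.1⟩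
  · have := Nat.mul_le_mul_right (m * 60 + 100) (henv.le x)
    lia
  · rintro s' h
    rw [h, Pl]
    rfl

/-- The loop over the bag of `p` computes the addresses of the two entries that are combined by the
code `c`, and of the result. -/
theorem runs_joinLoop (hR : Room W n t m) (henv : Env X W m s) (hs : s.FitsIn W)
    {x p c bL bR bZ : ℕ} (hx : x ≤ t) (hp : p ≤ t)
    (h11 : s.word 11 = x) (h17 : s.word 17 = (X.bagList p).length)
    (h18 : s.word 18 = s.wmem 3 p) (h20 : s.word 20 = c) (h21 : s.word 21 = bL)
    (h28 : s.word 28 = bR) (h29 : s.word 29 = bZ) (hL : bL + 4 ^ m < 2 ^ W)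
    (hRb : bR + 4 ^ m < 2 ^ W) (hZ : bZ + 4 ^ m < 2 ^ W) :
    Runs W (forLoop 24 17 joinBody) s (m * 150 + 6) (fun s' =>
      s'.word 21 = bL + X.net.joinL p c ∧ s'.word 28 = bR + X.net.joinR x p c ∧
      s'.word 29 = bZ + X.net.joinZ x p c) := by
  have hd4 := dec_lt (X.bagList p) c
  obtain ⟨EL, L0, Ll, Ls, Llt⟩ := exists_partialCode henv p p
    (f := fun v => digitL (dec (X.bagList p) c v))
    (fun v => (digitL_le (hd4 v)).trans_lt (by norm_num))
  obtain ⟨ER, R0, Rl, Rs, Rlt⟩ := exists_partialCode henv p p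
    (f := fun v => if v ∈ X.bagList x then digitR (dec (X.bagList p) c v) else 0)
    (fun v => by
      have := digitR_le (hd4 v)
      split_ifs <;> lia)
  obtain ⟨EZ, Z0, Zl, Zs, Zlt⟩ := exists_partialCode henv p p
    (f := fun v => if v ∈ X.bagList x then min (dec (X.bagList p) c v) 2
      else digitL (dec (X.bagList p) c v))
    (fun v => by
      have := digitL_le (hd4 v)
      split_ifs <;> lia)
  refine (Runs.forLoop (N := (X.bagList p).length) (B := 142) (fun j s' =>
    s'.word 21 = bL + EL j ∧ s'.word 28 = bR + ER j ∧ s'.word 29 = bZ + EZ j)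
    hs hR.one_lt h17 rfl rfl rfl ?_ ?_ fun s' _ _ h => h).mono ?_ ?_
  · simp [h21, h28, h29, L0, R0, Z0]
  · rintro j s₁ hj hf hs₁ h24 ⟨i21, i28, i29⟩
    have henv₁ := henv.frame hf rfl
    have hv := henv₁.elem p hp j hj
    have hvn := getElem_lt X hj
    have hd := henv₁.digit c hj
    have hk := henv₁.pos x hx _ hvn
    have e11 : s₁.word 11 = x := (hf.word 11 rfl).trans h11
    have e18 : s₁.word 18 = s₁.wmem 3 p := by rw [hf.word 18 rfl, hf.wmem 3 rfl, h18]
    have e20 : s₁.word 20 = c := (hf.word 20 rfl).trans h20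
    have hpw := henv₁.pow j (hj.le.trans (henv.le p))
    have hc := hR.const
    have hW := hR.ne_zero
    have hxn := hR.mul_add_lt hx hvn
    have haddr := henv₁.addr p hp j hj
    have Ls := Ls j hj
    have Rs := Rs j hj
    have Zs := Zs j hj
    have Llt := Llt (j + 1)
    have Rlt := Rlt (j + 1)
    have Zlt := Zlt (j + 1)
    have hn := henv₁.hn
    have hd4 := hd4 (X.bagList p)[j]
    rw [if_pos (List.getElem_mem hj), idxOf_getElem X hj] at Ls Rs Zs
    rw [Ls] at Llt
    rw [Rs] at Rlt
    rw [Zs] at Zlt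
    rw [Ls, Rs, Zs]
    clear henv henv₁
    obtain ⟨v, hvd⟩ : ∃ v, (X.bagList p)[j] = v := ⟨_, rfl⟩
    simp only [hvd] at *
    obtain ⟨d, hdd⟩ : ∃ d, dec (X.bagList p) c v = d := ⟨_, rfl⟩
    simp only [hdd] at *
    rw [hpw] at hd
    clear L0 R0 Z0 Ll Rl Zl hvd
    by_cases h3 : d = 3
    · by_cases hq : v ∈ X.bagList x
      · simp only [hq, if_true, h3, digitL, digitR] at hk Llt Rlt Zlt
        rw [min_eq_right (by norm_num)] at Zlt
        refine Runs.of_run rfl hs₁ ?_ (by decide) ?_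
        · simp [joinBody, Prog.Safe, Prog.run, h24, e11, e18, e20, hv, hd, hk, hn, hpw, h3, i21,
            i28, i29]
          and_intros <;> lia
        · simp [joinBody, Prog.run, h24, e11, e18, e20, hv, hd, hk, hn, hpw, h3, i21, i28, i29,
            digitL, digitR, hq]
          lia
      · simp only [hq, if_false, h3, digitL, if_true] at hk Llt Rlt Zlt
        refine Runs.of_run rfl hs₁ ?_ (by decide) ?_
        · simp [joinBody, Prog.Safe, Prog.run, h24, e11, e18, e20, hv, hd, hk, hn, hpw, h3, i21,
            i29]
          and_intros <;> lia
        · simp [joinBody, Prog.run, h24, e11, e18, e20, hv, hd, hk, hn, hpw, h3, i21, i28, i29,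
            digitL, hq]
          lia
    · by_cases hq : v ∈ X.bagList x
      · simp only [hq, if_true, h3, digitL, digitR, if_false] at hk Llt Rlt Zlt
        rw [min_eq_left (by lia)] at Zlt
        by_cases h2 : d = 2
        · simp only [h2, if_true] at hk Llt Rlt Zlt
          refine Runs.of_run rfl hs₁ ?_ (by decide) ?_
          · simp [joinBody, Prog.Safe, Prog.run, h24, e11, e18, e20, hv, hd, hk, hn, hpw, h2, i21,
              i28, i29]
            and_intros <;> lia
          · simp [joinBody, Prog.run, h24, e11, e18, e20, hv, hd, hk, hn, hpw, h2, i21, i28, i29,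
              digitL, digitR, hq]
            lia
        · simp only [h2, if_false] at hk Llt Rlt Zlt
          refine Runs.of_run rfl hs₁ ?_ (by decide) ?_
          · simp [joinBody, Prog.Safe, Prog.run, h24, e11, e18, e20, hv, hd, hk, hn, hpw, h3, h2,
              i21, i28, i29]
            and_intros <;> lia
          · simp [joinBody, Prog.run, h24, e11, e18, e20, hv, hd, hk, hn, hpw, h3, h2, i21, i28,
              i29, digitL, digitR, hq, min_eq_left (show d ≤ 2 by lia)]
            lia
      · simp only [hq, if_false, h3, digitL] at hk Llt Rlt Zlt
        refine Runs.of_run rfl hs₁ ?_ (by decide) ?_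
        · simp [joinBody, Prog.Safe, Prog.run, h24, e11, e18, e20, hv, hd, hk, hn, hpw, h3, i21,
            i29]
          and_intros <;> lia
        · simp [joinBody, Prog.run, h24, e11, e18, e20, hv, hd, hk, hn, hpw, h3, i21, i28, i29,
            digitL, hq]
          lia
  · have := Nat.mul_le_mul_right 150 (henv.le p)
    lia
  · rintro s' ⟨h1, h2, h3⟩
    rw [h1, h2, h3, Ll, Rl, Zl]
    refine ⟨?_, ?_, ?_⟩ <;> congr 1 <;> refine enc_congr fun v hv => ?_ <;>
      exact if_pos hv

end SteinerProg

/-! ### Filling the tables -/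

namespace SteinerProg

open RAM RAM.Prog SteinerDP SteinerDP.Net

set_option linter.unusedSimpArgs false

/-- The contents of the tables: the entry with the address `i` is present if `fl i = 1`; then it
has the value `vl i` and arose from the entries with the addresses `p1 i` and `p2 i`. -/
structure Tab where
  fl : ℕ → ℕ
  vl : ℕ → ℝ
  p1 : ℕ → ℕ
  p2 : ℕ → ℕ

/-- The tables in the memory. -/
def tab (s : Store) : Tab := ⟨s.wmem 16, s.rmem 1, s.wmem 17, s.wmem 18⟩

open Classical in
/-- The entry `z` is replaced if its value is improved. -/
noncomputable def Tab.relax (T : Tab) (z : ℕ) (a : ℝ) (i j : ℕ) : Tab :=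
  if T.fl z = 1 ∧ T.vl z ≤ a then T else
    ⟨Function.update T.fl z 1, Function.update T.vl z a, Function.update T.p1 z i,
      Function.update T.p2 z j⟩

theorem tab_relax (s : Store) : tab (relax.run s) =
    (tab s).relax (s.word 29) (s.real 0) (s.word 21) (s.word 28) := by
  by_cases h : s.wmem 16 (s.word 29) = 1 ∧ s.rmem 1 (s.word 29) ≤ s.real 0
  · simp [relax, Prog.run, Tab.relax, tab, h]
  · simp [relax, Prog.run, Tab.relax, tab, h]

theorem tab_setW (s : Store) (x v : ℕ) : tab (s.setW x v) = tab s := rfl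

theorem tab_frame {s s' : Store} {p : Prog} (hf : Frame p s s')
    (hp : (p.putsWord 16 || p.putsWord 17 || p.putsWord 18 || p.putsReal 1) = false) :
    tab s' = tab s := by
  simp only [Bool.or_eq_false_iff] at hp
  simp only [tab, hf.wmem 16 hp.1.1.1, hf.wmem 17 hp.1.1.2, hf.wmem 18 hp.1.2, hf.rmem 1 hp.2]

variable {n t : ℕ} (X : SteinerInput n t) (m : ℕ)

/-- The set `S i` is the one that is represented by the entry `i`, and the addresses from `A` on
are free. -/
structure TabOK (T : Tab) (S : ℕ → Finset ℕ) (A : ℕ) : Prop where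
  base : ∀ i, T.fl i = 1 → i < (t + 1) * 4 ^ m → S i = X.net.baseSet (i / 4 ^ m) (i % 4 ^ m)
  ptr : ∀ i, T.fl i = 1 → (t + 1) * 4 ^ m ≤ i → T.p1 i < i ∧ T.p2 i < i ∧ T.fl (T.p1 i) = 1 ∧
    T.fl (T.p2 i) = 1 ∧ S i = S (T.p1 i) ∪ S (T.p2 i)
  free : ∀ i, A ≤ i → T.fl i ≠ 1

/-- The entries below `A` have not been changed. -/
def Extends (T₀ : Tab) (S₀ : ℕ → Finset ℕ) (T : Tab) (S : ℕ → Finset ℕ) (A : ℕ) : Prop :=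
  ∀ i < A, T.fl i = T₀.fl i ∧ T.vl i = T₀.vl i ∧ S i = S₀ i

/-- The table that starts at the address `b` describes the partial solutions on the part `N`, by
their states on the bag of `y`. -/
structure TableAt (T : Tab) (S : ℕ → Finset ℕ) (y : ℕ) (N : Set ℕ) (b : ℕ) : Prop where
  sound : ∀ c < 4 ^ m, T.fl (b + c) = 1 → X.net.Sound y N c (T.vl (b + c)) (S (b + c))
  complete : X.net.Complete y N (fun c => T.fl (b + c)) (fun c => T.vl (b + c))

variable {X m}

theorem enc_lt_pow (hle : ∀ y, (X.bagList y).length ≤ m) {y : ℕ} {N : Set ℕ} {F : Finset ℕ}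
    {σ : ℕ → ℕ} (h : X.net.IsState y N F σ) : enc (X.bagList y) σ < 4 ^ m :=
  (enc_lt h.lt_four).trans_le (Nat.pow_le_pow_right (by norm_num) (hle y))

theorem TableAt.of_extends {T₀ T : Tab} {S₀ S : ℕ → Finset ℕ} {A y b : ℕ} {N : Set ℕ}
    (hle : ∀ y, (X.bagList y).length ≤ m)
    (h : TableAt X m T₀ S₀ y N b) (he : Extends T₀ S₀ T S A) (hb : b + 4 ^ m ≤ A) :
    TableAt X m T S y N b where
  sound c hc h1 := by
    obtain ⟨e1, e2, e3⟩ := he (b + c) (by lia)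
    rw [e1] at h1
    rw [e2, e3]
    exact h.sound c hc h1
  complete F hF σ hσ := by
    have hlt := enc_lt_pow hle hσ
    obtain ⟨e1, e2, _⟩ := he (b + enc (X.bagList y) σ) (by lia)
    have := h.complete F hF σ hσ
    simp only [net_bag] at this ⊢
    rwa [e1, e2]

theorem Extends.trans {T₀ T T' : Tab} {S₀ S S' : ℕ → Finset ℕ} {A A' : ℕ}
    (h : Extends T₀ S₀ T S A) (h' : Extends T S T' S' A') (hA : A ≤ A') :
    Extends T₀ S₀ T' S' A := fun i hi => by
  obtain ⟨e1, e2, e3⟩ := h i hi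
  obtain ⟨e4, e5, e6⟩ := h' i (hi.trans_le hA)
  exact ⟨e4.trans e1, e5.trans e2, e6.trans e3⟩

variable (X m)

/-- The state of the filling of the table at the address `A`: all the entries are `Good`, and they
are at most the candidates that arose so far. -/
def Filling (T₀ : Tab) (S₀ : ℕ → Finset ℕ) (A : ℕ) (Good : ℕ → ℝ → Finset ℕ → Prop)
    (Cand : ℕ → ℕ → ℝ → Prop) (k : ℕ) (T : Tab) : Prop :=
  ∃ S, TabOK X m T S (A + 4 ^ m) ∧ Extends T₀ S₀ T S A ∧
    (∀ i, T.fl i = 1 → A ≤ i → T.p1 i < A ∧ T.p2 i < A) ∧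
    (∀ z < 4 ^ m, T.fl (A + z) = 1 → Good z (T.vl (A + z)) (S (A + z))) ∧
    ∀ c < k, ∀ z a, Cand c z a → T.fl (A + z) = 1 ∧ T.vl (A + z) ≤ a

variable {X m} {T₀ T : Tab} {S₀ : ℕ → Finset ℕ} {A k : ℕ} {Good : ℕ → ℝ → Finset ℕ → Prop}
  {Cand : ℕ → ℕ → ℝ → Prop}

theorem Filling.zero (h : TabOK X m T₀ S₀ A) : Filling X m T₀ S₀ A Good Cand 0 T₀ :=
  ⟨S₀, ⟨h.base, h.ptr, fun i hi => h.free i (by lia)⟩, fun _ _ => ⟨rfl, rfl, rfl⟩,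
    fun i h1 hi => absurd h1 (h.free i hi), fun z _ h1 => absurd h1 (h.free _ (by lia)),
    fun c hc => absurd hc (by lia)⟩

theorem Filling.skip (h : Filling X m T₀ S₀ A Good Cand k T) (hk : ∀ z a, ¬ Cand k z a) :
    Filling X m T₀ S₀ A Good Cand (k + 1) T := by
  obtain ⟨S, h1, h2, h2', h3, h4⟩ := h
  refine ⟨S, h1, h2, h2', h3, fun c hc z a hca => ?_⟩
  rcases Nat.lt_succ_iff_lt_or_eq.1 hc with hc | rfl
  · exact h4 c hc z a hca
  · exact absurd hca (hk z a)

theorem Filling.relax (h : Filling X m T₀ S₀ A Good Cand k T) (hA : (t + 1) * 4 ^ m ≤ A)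
    {z i j : ℕ} {a : ℝ} (hz : z < 4 ^ m) (hk : ∀ z' a', Cand k z' a' → z' = z ∧ a' = a)
    (hi : i < A) (hj : j < A) (hfi : T₀.fl i = 1) (hfj : T₀.fl j = 1)
    (hgood : Good z a (S₀ i ∪ S₀ j)) :
    Filling X m T₀ S₀ A Good Cand (k + 1) (T.relax (A + z) a i j) := by
  obtain ⟨S, h1, h2, h2', h3, h4⟩ := h
  unfold Tab.relax
  split_ifs with hc
  · refine ⟨S, h1, h2, h2', h3, fun c hck z' a' hca => ?_⟩
    rcases Nat.lt_succ_iff_lt_or_eq.1 hck with hck | rfl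
    · exact h4 c hck z' a' hca
    · obtain ⟨rfl, rfl⟩ := hk z' a' hca
      exact hc
  · refine ⟨Function.update S (A + z) (S₀ i ∪ S₀ j), ⟨?_, ?_, ?_⟩, ?_, ?_, ?_, ?_⟩
    · intro l hl hlt
      have hne : l ≠ A + z := by lia
      simp only [Function.update_of_ne hne] at hl ⊢
      exact h1.base l hl hlt
    · intro l hl hle
      by_cases e : l = A + z
      · subst e
        simp only [Function.update_self, Function.update_of_ne (show i ≠ A + z by lia),
          Function.update_of_ne (show j ≠ A + z by lia)]
        obtain ⟨e1, -, e3⟩ := h2 i hi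
        obtain ⟨e4, -, e6⟩ := h2 j hj
        exact ⟨by lia, by lia, e1.trans hfi, e4.trans hfj, by rw [e3, e6]⟩
      · simp only [Function.update_of_ne e] at hl ⊢
        obtain ⟨g1, g2, g3, g4, g5⟩ := h1.ptr l hl hle
        refine ⟨g1, g2, ?_, ?_, ?_⟩
        · rw [Function.update_apply]; split_ifs <;> [rfl; exact g3]
        · rw [Function.update_apply]; split_ifs <;> [rfl; exact g4]
        · have : T.p1 l < A ∧ T.p2 l < A := by
            rcases lt_or_ge l A with hlA | hlA
            · lia
            · exact h2' l hl hlA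
          rw [g5, Function.update_of_ne (show T.p1 l ≠ A + z by lia),
            Function.update_of_ne (show T.p2 l ≠ A + z by lia)]
    · intro l hl
      have hne : l ≠ A + z := by lia
      simp only [Function.update_of_ne hne]
      exact h1.free l hl
    · intro l hl
      have hne : l ≠ A + z := by lia
      simp only [Function.update_of_ne hne]
      exact h2 l hl
    · intro l hl hlA
      by_cases e : l = A + z
      · subst e
        simp only [Function.update_self]
        exact ⟨hi, hj⟩
      · simp only [Function.update_of_ne e] at hl ⊢
        exact h2' l hl hlA
    · intro z' hz' hf
      by_cases e : z' = z
      · subst e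
        simpa only [Function.update_self] using hgood
      · have hne : A + z' ≠ A + z := by lia
        simp only [Function.update_of_ne hne] at hf ⊢
        exact h3 z' hz' hf
    · intro c hck z' a' hca
      by_cases e : z' = z
      · subst e
        simp only [Function.update_self, true_and]
        rcases Nat.lt_succ_iff_lt_or_eq.1 hck with hck | rfl
        · have := h4 c hck z' a' hca
          rw [not_and] at hc
          exact (lt_of_not_ge (hc this.1)).le.trans this.2
        · exact (hk z' a' hca).2.ge
      · have hne : A + z' ≠ A + z := by lia
        simp only [Function.update_of_ne hne]
        rcases Nat.lt_succ_iff_lt_or_eq.1 hck with hck | rfl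
        · exact h4 c hck z' a' hca
        · exact absurd (hk z' a' hca).1 e

theorem Filling.eq_of_lt (h : Filling X m T₀ S₀ A Good Cand k T) {i : ℕ} (hi : i < A) :
    T.fl i = T₀.fl i ∧ T.vl i = T₀.vl i := by
  obtain ⟨S, _, h2, _⟩ := h
  exact ⟨(h2 i hi).1, (h2 i hi).2.1⟩

theorem code_lt (hle : ∀ y, (X.bagList y).length ≤ m) (y : ℕ) {σ : ℕ → ℕ}
    (h : ∀ v, σ v < 4) : enc (X.bagList y) σ < 4 ^ m :=
  (enc_lt fun v _ => h v).trans_le (Nat.pow_le_pow_right (by norm_num) (hle y))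

theorem projCode_lt (hle : ∀ y, (X.bagList y).length ≤ m) (x p c : ℕ) :
    X.net.projCode x p c < 4 ^ m :=
  code_lt hle p fun v => by
    split_ifs
    · exact dec_lt ..
    · norm_num

theorem joinL_lt (hle : ∀ y, (X.bagList y).length ≤ m) (p c : ℕ) : X.net.joinL p c < 4 ^ m :=
  code_lt hle p fun v => (digitL_le (dec_lt ..)).trans_lt (by norm_num)

theorem joinR_lt (hle : ∀ y, (X.bagList y).length ≤ m) (x p c : ℕ) :
    X.net.joinR x p c < 4 ^ m :=
  code_lt hle p fun v => by
    have := digitR_le (dec_lt (X.bagList p) c v)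
    dsimp only [net_bag]
    split_ifs <;> lia

theorem joinZ_lt (hle : ∀ y, (X.bagList y).length ≤ m) (x p c : ℕ) :
    X.net.joinZ x p c < 4 ^ m :=
  code_lt hle p fun v => by
    have := digitL_le (dec_lt (X.bagList p) c v)
    dsimp only [net_bag]
    split_ifs <;> lia

/-- Passing the table of `x` on to its parent `p`: the new table describes the same part of the tree
by states of the bag of `p`. -/
theorem runs_proj {W : ℕ} {s : Store} (hR : Room W n t m) (henv : Env X W m s) (hs : s.FitsIn W)
    {x p b A : ℕ} {N : Set ℕ} {S : ℕ → Finset ℕ} (hx : x ≤ t) (hp : p ≤ t)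
    (h12 : s.word 12 = p) (h13 : s.word 13 = b) (h15 : s.word 15 = A)
    (h17 : s.word 17 = (X.bagList x).length) (h18 : s.word 18 = s.wmem 3 x)
    (hb : b + 4 ^ m ≤ A) (hA : (t + 1) * 4 ^ m ≤ A) (hA' : A + 4 ^ m < 2 ^ W)
    (hT : TabOK X m (tab s) S A) (hxT : TableAt X m (tab s) S x N b) (hxN : x ∈ N)
    (hsep : ∀ v ∈ X.net.bag p, X.net.Covered N v → v ∈ X.net.bag x)
    (hforget : ∀ v ∈ X.net.bag x, v ∉ X.net.bag p → ∀ z ≤ X.net.t, v ∈ X.net.bag z → z ∈ N) :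
    Runs W projProg s (4 ^ m * (m * 100 + 200) + 6) (fun s' => ∃ S',
      TabOK X m (tab s') S' (A + 4 ^ m) ∧ Extends (tab s) S (tab s') S' A ∧
      TableAt X m (tab s') S' p N A) := by
  have hle := henv.le
  let Cand : ℕ → ℕ → ℝ → Prop := fun c z a => (tab s).fl (b + c) = 1 ∧ X.net.ProjOK x p c ∧
    z = X.net.projCode x p c ∧ a = (tab s).vl (b + c) + X.net.forgetCost x p c
  refine (Runs.forLoop (N := 4 ^ m) (B := m * 100 + 192) (fun c s' =>
    Filling X m (tab s) S A (X.net.Sound p N) Cand c (tab s'))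
    hs hR.one_lt henv.hQ rfl rfl rfl (Filling.zero hT) ?_ fun s' _ _ h => h).mono le_rfl ?_
  · intro c s₁ hc hf hs₁ h20 hI
    have henv₁ := henv.frame hf rfl
    obtain ⟨efl, evl⟩ := hI.eq_of_lt (i := b + c) (by lia)
    have e12 : s₁.word 12 = p := (hf.word 12 rfl).trans h12
    have e13 : s₁.word 13 = b := (hf.word 13 rfl).trans h13
    have e15 : s₁.word 15 = A := (hf.word 15 rfl).trans h15
    have e17 : s₁.word 17 = (X.bagList x).length := (hf.word 17 rfl).trans h17
    have e18 : s₁.word 18 = s₁.wmem 3 x := by rw [hf.word 18 rfl, hf.wmem 3 rfl, h18]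
    refine (Runs.run_seq (B := m * 100 + 6 + 100) rfl hs₁ ?_ fun hs₂ hf₂ => ?_).mono
      (by have : projHead.steps ≤ 50 := by decide
          lia) fun _ h => h
    · simp [projHead, Prog.Safe, Prog.run, e13, h20]
      lia
    · have henv₂ := henv₁.frame hf₂ rfl
      refine Runs.seq hs₂ (runs_projLoop hR henv₂ hs₂ hx hp (c := c)
        (ok := (tab s).fl (b + c)) (b := A) (a := (tab s).vl (b + c)) ?_ ?_ ?_ ?_ ?_ ?_ hA' ?_)
        fun s₃ hf₃ hs₃ ⟨h29, h22, h0⟩ => ?_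
      · simpa [projHead, Prog.run] using e12
      · simpa [projHead, Prog.run] using e17
      · simpa [projHead, Prog.run] using e18
      · simpa [projHead, Prog.run] using h20
      · rw [← efl]
        simp [projHead, Prog.run, e13, h20, tab]
      · simpa [projHead, Prog.run] using e15
      · rw [← evl]
        simp [projHead, Prog.run, e13, h20, tab]
      have e21 : s₃.word 21 = b + c := by
        rw [hf₃.word 21 rfl]; simp [projHead, Prog.run, e13, h20]
      have e28 : s₃.word 28 = b + c := by
        rw [hf₃.word 28 rfl]; simp [projHead, Prog.run, e13, h20]
      have et : tab s₃ = tab s₁ := (tab_frame hf₃ rfl).trans (tab_frame hf₂ rfl)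
      refine Runs.of_run rfl hs₃ ?_ (by decide) ?_
      · have := hR.ne_zero
        simp [relax, Prog.Safe, Prog.run, this]
      · rw [tab_setW]
        by_cases hok : s₃.word 22 = 1
        · have e : Prog.run (.ite (.weq (.reg 22) 1) relax .skip) s₃ = relax.run s₃ := if_pos hok
          obtain ⟨hfl, hproj⟩ := h22.1 hok
          rw [e, tab_relax, et, h29, h0, e21, e28]
          refine hI.relax hA (projCode_lt hle x p c) ?_ (by lia) (by lia) hfl hfl ?_
          · rintro z a ⟨-, -, rfl, rfl⟩; exact ⟨rfl, rfl⟩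
          · rw [Finset.union_self]
            exact (hxT.sound c hc hfl).proj hproj hsep
        · have e : Prog.run (.ite (.weq (.reg 22) 1) relax .skip) s₃ = s₃ := if_neg hok
          rw [e, et]
          exact hI.skip fun z a hca => hok (h22.2 ⟨hca.1, hca.2.1⟩)
  · rintro s' ⟨S', h1, h2, -, h3, h4⟩
    refine ⟨S', h1, h2, h3, fun F hF σ hσ => ?_⟩
    obtain ⟨τ, hτ, hok, hcode, hcost⟩ := hσ.proj hF hxN hsep hforget
    obtain ⟨g1, g2⟩ := hxT.complete F hF τ hτ
    obtain ⟨g3, g4⟩ := h4 _ (enc_lt_pow hle hτ) _ _ ⟨g1, hok, rfl, rfl⟩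
    rw [net_bag] at *
    rw [hcode] at g3 g4
    refine ⟨g3, g4.trans ?_⟩
    rw [← hcost]
    exact add_le_add_left g2 _

/-- Combining the table of `p` with the table passed on from its child `x`: the new table describes
the union of the two parts. -/
theorem runs_join {W : ℕ} {s : Store} (hR : Room W n t m) (henv : Env X W m s) (hs : s.FitsIn W)
    {x p b bM A : ℕ} {N N' : Set ℕ} {S : ℕ → Finset ℕ} (hx : x ≤ t) (hp : p ≤ t)
    (h11 : s.word 11 = x) (h14 : s.word 14 = b) (h15 : s.word 15 = bM) (h16 : s.word 16 = A)
    (h17 : s.word 17 = (X.bagList p).length) (h18 : s.word 18 = s.wmem 3 p)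
    (hb : b + 4 ^ m ≤ A) (hbM : bM + 4 ^ m ≤ A) (hA : (t + 1) * 4 ^ m ≤ A)
    (hA' : A + 4 ^ m < 2 ^ W)
    (hT : TabOK X m (tab s) S A) (hpT : TableAt X m (tab s) S p N b)
    (hMT : TableAt X m (tab s) S p N' bM) (hpN : p ∈ N) (hxN : x ∈ N')
    (hchild : ∀ v ∈ X.net.bag p, X.net.Covered N' v → v ∈ X.net.bag x)
    (hsep : ∀ v, X.net.Covered N v → X.net.Covered N' v → v ∈ X.net.bag p) :
    Runs W joinProg s (4 ^ m * (m * 150 + 200) + 6) (fun s' => ∃ S',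
      TabOK X m (tab s') S' (A + 4 ^ m) ∧ Extends (tab s) S (tab s') S' A ∧
      TableAt X m (tab s') S' p (N ∪ N') A) := by
  have hle := henv.le
  let Cand : ℕ → ℕ → ℝ → Prop := fun c z a =>
    (tab s).fl (b + X.net.joinL p c) = 1 ∧ (tab s).fl (bM + X.net.joinR x p c) = 1 ∧
    z = X.net.joinZ x p c ∧
    a = (tab s).vl (b + X.net.joinL p c) + (tab s).vl (bM + X.net.joinR x p c)
  refine (Runs.forLoop (N := 4 ^ m) (B := m * 150 + 192) (fun c s' =>
    Filling X m (tab s) S A (X.net.Sound p (N ∪ N')) Cand c (tab s'))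
    hs hR.one_lt henv.hQ rfl rfl rfl (Filling.zero hT) ?_ fun s' _ _ h => h).mono le_rfl ?_
  · intro c s₁ hc hf hs₁ h20 hI
    have henv₁ := henv.frame hf rfl
    have hLlt := joinL_lt hle p c
    have hRlt := joinR_lt hle x p c
    obtain ⟨efl, evl⟩ := hI.eq_of_lt (i := b + X.net.joinL p c) (by lia)
    obtain ⟨efl', evl'⟩ := hI.eq_of_lt (i := bM + X.net.joinR x p c) (by lia)
    have e11 : s₁.word 11 = x := (hf.word 11 rfl).trans h11
    have e14 : s₁.word 14 = b := (hf.word 14 rfl).trans h14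
    have e15 : s₁.word 15 = bM := (hf.word 15 rfl).trans h15
    have e16 : s₁.word 16 = A := (hf.word 16 rfl).trans h16
    have e17 : s₁.word 17 = (X.bagList p).length := (hf.word 17 rfl).trans h17
    have e18 : s₁.word 18 = s₁.wmem 3 p := by rw [hf.word 18 rfl, hf.wmem 3 rfl, h18]
    refine (Runs.run_seq (B := m * 150 + 6 + 150) rfl hs₁ ?_ fun hs₂ hf₂ => ?_).mono
      (by have : joinHead.steps ≤ 30 := by decide
          lia) fun _ h => h
    · simp [joinHead, Prog.Safe, Prog.run]
    · have henv₂ := henv₁.frame hf₂ rfl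
      refine Runs.seq hs₂ (runs_joinLoop hR henv₂ hs₂ hx hp (c := c) (bL := b) (bR := bM)
        (bZ := A) ?_ ?_ ?_ ?_ ?_ ?_ ?_ (by lia) (by lia) hA')
        fun s₃ hf₃ hs₃ ⟨h21, h28, h29⟩ => ?_
      · simpa [joinHead, Prog.run] using e11
      · simpa [joinHead, Prog.run] using e17
      · simpa [joinHead, Prog.run] using e18
      · simpa [joinHead, Prog.run] using h20
      · simpa [joinHead, Prog.run] using e14
      · simpa [joinHead, Prog.run] using e15
      · simpa [joinHead, Prog.run] using e16
      have et : tab s₃ = tab s₁ := (tab_frame hf₃ rfl).trans (tab_frame hf₂ rfl)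
      rw [← et] at efl evl efl' evl'
      refine Runs.of_run rfl hs₃ ?_ (by decide) ?_
      · have := hR.ne_zero
        simp [joinTail, relax, Prog.Safe, Prog.run, this]
      · rw [tab_setW]
        let s₄ := s₃.setR 0 (s₃.rmem 1 (s₃.word 21) + s₃.rmem 1 (s₃.word 28))
        by_cases hok : s₃.wmem 16 (s₃.word 21) = 1 ∧ s₃.wmem 16 (s₃.word 28) = 1
        · have e : Prog.run joinTail s₃ = relax.run s₄ := if_pos hok
          have e0 : s₄.real 0 = (tab s).vl (b + X.net.joinL p c) +
              (tab s).vl (bM + X.net.joinR x p c) := by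
            rw [← evl, ← evl', ← h21, ← h28]; simp [s₄, tab]
          have hok' := hok
          rw [h21, h28] at hok'
          rw [e, tab_relax, e0]
          change Filling _ _ _ _ _ _ _ _ (Tab.relax (tab s₃) (s₃.word 29) _ (s₃.word 21)
            (s₃.word 28))
          rw [et, h29, h21, h28]
          have f1 := efl.symm.trans hok'.1
          have f2 := efl'.symm.trans hok'.2
          refine hI.relax hA (joinZ_lt hle x p c) ?_ (by lia) (by lia) f1 f2 ?_
          · rintro z a ⟨-, -, rfl, rfl⟩; exact ⟨rfl, rfl⟩
          · exact (hpT.sound _ hLlt f1).join (hMT.sound _ hRlt f2) hsep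
        · have e : Prog.run joinTail s₃ = s₄ := if_neg hok
          rw [e]
          change Filling _ _ _ _ _ _ _ _ (tab s₃)
          rw [et]
          refine hI.skip fun z a hca => hok ?_
          rw [h21, h28]
          exact ⟨efl.trans hca.1, efl'.trans hca.2.1⟩
  · rintro s' ⟨S', h1, h2, -, h3, h4⟩
    refine ⟨S', h1, h2, h3, fun F hF σ hσ => ?_⟩
    obtain ⟨c, hc, ⟨τ, hτ, hL⟩, ⟨τ', hτ', hR'⟩, hZ, hcost⟩ := hσ.join hpN hxN hchild hsep
    obtain ⟨g1, g2⟩ := hpT.complete F hF τ hτ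
    obtain ⟨g1', g2'⟩ := hMT.complete F hF τ' hτ'
    rw [← hL] at g1 g2
    rw [← hR'] at g1' g2'
    obtain ⟨g3, g4⟩ := h4 c (hc.trans_le (Nat.pow_le_pow_right (by norm_num) (hle p))) _ _
      ⟨g1, g1', rfl, rfl⟩
    rw [hZ] at g3 g4
    refine ⟨g3, g4.trans ?_⟩
    rw [← hcost]
    exact add_le_add g2 g2'

end SteinerProg

/-! ### The tables of the single bags and the elimination of the nodes -/

namespace SteinerProg

open RAM RAM.Prog SteinerDP SteinerDP.Net TreePeel

set_option linter.unusedSimpArgs false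

variable {n t m W : ℕ} {X : SteinerInput n t} {s : Store}

theorem Room.table_lt (hR : Room W n t m) {i : ℕ} (hi : i ≤ 3 * t + 7) : (i + 1) * 4 ^ m ≤ 2 ^ W :=
  (Nat.mul_le_mul_right _ (by lia)).trans hR.tab

theorem decodeHead_safe (hR : Room W n t m) : decodeHead.Safe W s := by
  simp [decodeHead, Prog.Safe, Prog.run, hR.ne_zero]

/-- The tables of the single bags are correct. As no vertex has been forgotten yet, all the values
are `0`, which is what the memory holds at the start. -/
theorem runs_base (hR : Room W n t m) (henv : Env X W m s) (hs : s.FitsIn W)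
    (h0 : ∀ i, s.wmem 16 i = 0) (hr : ∀ i, s.rmem 1 i = 0) :
    Runs W baseProg s ((t + 1) * 4 ^ m * (m * (m * 60 + 100) + 100) + 6) (fun s' =>
      TabOK X m (tab s') (fun i => X.net.baseSet (i / 4 ^ m) (i % 4 ^ m)) ((t + 1) * 4 ^ m) ∧
      ∀ y ≤ t, TableAt X m (tab s') (fun i => X.net.baseSet (i / 4 ^ m) (i % 4 ^ m)) y {y}
        (y * 4 ^ m)) := by
  have hQ : 0 < 4 ^ m := by positivity
  refine (Runs.forLoop (N := (t + 1) * 4 ^ m) (B := m * (m * 60 + 100) + 92) (fun i s' =>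
    ∀ j, s'.wmem 16 j = 1 ↔ j < i ∧ X.net.BaseOK (j / 4 ^ m) (j % 4 ^ m))
    (Q := fun s' => Frame baseProg s s' ∧
      ∀ j, s'.wmem 16 j = 1 ↔ j < (t + 1) * 4 ^ m ∧ X.net.BaseOK (j / 4 ^ m) (j % 4 ^ m))
    hs hR.one_lt henv.htQ rfl rfl rfl (by simp [h0]) ?_ fun s' _ hf h => ⟨hf, h⟩).mono le_rfl ?_
  · intro i s₁ hi hf hs₁ h10 hI
    have henv₁ := henv.frame hf rfl
    have hy : i / 4 ^ m ≤ t := by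
      rw [← Nat.lt_succ_iff]; exact (Nat.div_lt_iff_lt_mul hQ).2 hi
    have e5 := henv₁.hQ
    refine (Runs.run_seq (B := m * (m * 60 + 100) + 6 + 10) rfl hs₁ (decodeHead_safe hR)
      fun hs₂ hf₂ => ?_).mono
      (by have : decodeHead.steps ≤ 50 := by decide
          lia) fun _ h => h
    have henv₂ := henv₁.frame hf₂ rfl
    have e := hf₂.wmem
    refine Runs.seq hs₂ (runs_checkLoop hR henv₂ hs₂ hy (c := i % 4 ^ m) ?_ ?_ ?_ ?_)
      fun s₃ hf₃ hs₃ h15 => ?_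
    · simp [decodeHead, Prog.run, h10, e5]
    · simp [decodeHead, Prog.run, h10, e5]
    · simp [decodeHead, Prog.run, h10, e5, henv₁.size _ hy]
    · simp [decodeHead, Prog.run]
    · have e10 : s₃.word 10 = i := by rw [hf₃.word 10 rfl, hf₂.word 10 rfl, h10]
      have e16 : s₃.wmem 16 = s₁.wmem 16 := by rw [hf₃.wmem 16 rfl, hf₂.wmem 16 rfl]
      refine Runs.of_run rfl hs₃ (by simp [Prog.Safe]) (by decide) ?_
      intro j
      by_cases hj : j = i
      · subst hj
        simpa [Prog.run, e10] using h15
      · simp only [Prog.run, Store.setW_wmem, Store.putW_wmem, WExp.eval_reg, e10, e16]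
        have := hI j
        simp [hj, this]
        intro _; lia
  · rintro s' ⟨hf, hI⟩
    have er : ∀ i, (tab s').vl i = 0 := fun i => by
      change s'.rmem 1 i = 0
      rw [hf.rmem 1 rfl, hr]
    refine ⟨⟨fun _ _ _ => rfl, fun i h1 hi => absurd ((hI i).1 h1).1 (by lia),
      fun i hi h1 => absurd ((hI i).1 h1).1 (by lia)⟩, fun y hy => ⟨fun c hc h1 => ?_, ?_⟩⟩
    · have e1 : (y * 4 ^ m + c) / 4 ^ m = y := by
        rw [mul_comm, Nat.mul_add_div hQ, Nat.div_eq_of_lt hc, add_zero]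
      have e2 : (y * 4 ^ m + c) % 4 ^ m = c := by
        rw [mul_comm, Nat.mul_add_mod, Nat.mod_eq_of_lt hc]
      have := ((hI _).1 h1).2
      rw [e1, e2] at this
      rw [er, e1, e2]
      exact this.sound
    · intro F hF σ hσ
      have hc := enc_lt_pow henv.le hσ
      rw [net_bag]
      have e1 : (y * 4 ^ m + enc (X.bagList y) σ) / 4 ^ m = y := by
        rw [mul_comm, Nat.mul_add_div hQ, Nat.div_eq_of_lt hc, add_zero]
      have e2 : (y * 4 ^ m + enc (X.bagList y) σ) % 4 ^ m = enc (X.bagList y) σ := by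
        rw [mul_comm, Nat.mul_add_mod, Nat.mod_eq_of_lt hc]
      refine ⟨(hI _).2 ⟨?_, ?_⟩, ?_⟩
      · have : (y + 1) * 4 ^ m ≤ (t + 1) * 4 ^ m := Nat.mul_le_mul_right _ (by lia)
        lia
      · rw [e1, e2]
        exact hσ.baseOK hF
      · dsimp only
        rw [er]
        exact partCost_nonneg _ _ _

theorem runs_cur (hR : Room W n t m) (henv : Env X W m s) (hs : s.FitsIn W) :
    Runs W curProg s ((t + 1) * 100 + 6) (fun s' => ∀ y ≤ t, s'.wmem 19 y = y * 4 ^ m) := by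
  refine (Runs.forLoop (N := t + 1) (B := 50) (fun i s' => ∀ y < i, s'.wmem 19 y = y * 4 ^ m)
    hs hR.one_lt henv.ht1 rfl rfl rfl (by simp) ?_ fun s' _ hf h y hy => h y (by lia)).mono
    (by lia) fun _ h => h
  intro i s₁ hi hf hs₁ h10 hI
  have henv₁ := henv.frame hf rfl
  have h5 := henv₁.hQ
  refine Runs.of_run rfl hs₁ ?_ (by decide) ?_
  · have := hR.table_lt (i := i) (by lia)
    have : 0 < 4 ^ m := by positivity
    simp [Prog.Safe, h10, h5]
    lia
  · intro y hy
    by_cases e : y = i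
    · subst e; simp [Prog.run, h10, h5]
    · have := hI y (by lia)
      simp [Prog.run, h10, h5, e, this]

/-- The nodes that have not been eliminated after `i` steps, including the virtual node `t`. -/
def Alive (t : ℕ) (q : ℕ → ℕ) (i y : ℕ) : Prop := y ≤ t ∧ ∀ j < i, q j ≠ y

variable (X m) in
/-- The state of the elimination after `i` steps, with the parts `N` and with the sets `S` that are
represented by the table entries. -/
structure Merged (q : ℕ → ℕ) (i : ℕ) (s : Store) (N : ℕ → Set ℕ) (S : ℕ → Finset ℕ) :
    Prop where
  addr : s.word 8 = (t + 1 + 2 * i) * 4 ^ m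
  parts : X.net.Parts (Alive t q i) N
  ok : TabOK X m (tab s) S ((t + 1 + 2 * i) * 4 ^ m)
  cur_le : ∀ y, Alive t q i y → s.wmem 19 y + 4 ^ m ≤ (t + 1 + 2 * i) * 4 ^ m
  table : ∀ y, Alive t q i y → TableAt X m (tab s) S y (N y) (s.wmem 19 y)

/-- One step of the elimination: the part of the leaf `x` is merged into that of its parent `p`. The
new tables are placed at the addresses `A` and `A + 4 ^ m`. -/
theorem runs_mergeBody (hR : Room W n t m) (henv : Env X W m s) (hs : s.FitsIn W)
    {A : ℕ → ℕ → Prop} {k : ℕ} {dg sm : ℕ → ℕ}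
    (hP : Peeled A t X.bagList t k (s.wmem 14) dg sm (s.wmem 15)) {i : ℕ} (hi : i < t)
    (h10 : s.word 10 = i) {N : ℕ → Set ℕ} {S : ℕ → Finset ℕ} (hM : Merged m X (s.wmem 14) i s N S) :
    Runs W mergeBody s (4 ^ m * (m * 250 + 500) + 200) (fun s' =>
      ∃ N' S', Merged m X (s.wmem 14) (i + 1) s' N' S') := by
  obtain ⟨x, hx⟩ : ∃ x, x = s.wmem 14 i := ⟨_, rfl⟩
  obtain ⟨p, hp⟩ : ∃ p, p = s.wmem 15 x := ⟨_, rfl⟩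
  obtain ⟨A, hA⟩ : ∃ A, A = (t + 1 + 2 * i) * 4 ^ m := ⟨_, rfl⟩
  have hQ : 0 < 4 ^ m := by positivity
  have hik : i < k := lt_of_lt_of_le hi hP.le
  have hxt : x < t := hx ▸ hP.lt i hik
  obtain ⟨hpt, hpj⟩ := hP.par_le i hi
  have hsep := hP.par_sep i hi
  rw [← hx, ← hp] at hpt hpj hsep
  have hxA : Alive t (s.wmem 14) i x :=
    ⟨hxt.le, fun j hj e => by
      have := hP.inj j (by lia) i hik (by rw [e, hx]); lia⟩
  have hpA : Alive t (s.wmem 14) i p := ⟨hpt, fun j hj => hpj j (by lia)⟩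
  have hpx : p ≠ x := fun e => hpj i le_rfl (by rw [← hx, e])
  -- a vertex of the bag of the leaf that also lies in a remaining bag lies in the bag of `p`
  have hbag : ∀ v ∈ X.net.bag x, ∀ y, Alive t (s.wmem 14) i y → y ≠ x → v ∈ X.net.bag y →
      v ∈ X.net.bag p := by
    intro v hv y hy hyx hvy
    have hyt : y < t := by
      by_contra h
      rw [X.net.virt y (not_lt.1 h)] at hvy
      simp at hvy
    refine hsep v hv y hyt (fun j hj => ?_) hvy
    rcases hj.lt_or_eq with h | rfl
    · exact hy.2 j h
    · rw [← hx]; exact hyx.symm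
  have hAt : (t + 1) * 4 ^ m ≤ A := by rw [hA]; exact Nat.mul_le_mul_right _ (by lia)
  have hAW : A + 2 * 4 ^ m < 2 ^ W := by
    have := hR.table_lt (i := t + 3 + 2 * i) (by lia)
    rw [hA]
    have e : (t + 3 + 2 * i + 1) * 4 ^ m = (t + 1 + 2 * i) * 4 ^ m + 2 * 4 ^ m + 4 ^ m := by ring
    lia
  have hok := hM.ok
  have htx := hM.table x hxA
  have htp := hM.table p hpA
  have hcx := hM.cur_le x hxA
  have hcp := hM.cur_le p hpA
  have h8 := hM.addr
  have h5 := henv.hQ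
  rw [← hA] at hok hcx hcp h8
  refine (Runs.run_seq (B := 4 ^ m * (m * 100 + 200) + 6 + (mergeMid.steps +
    (4 ^ m * (m * 150 + 200) + 6 + 20))) rfl hs ?_ fun hs₂ hf₂ => ?_).mono ?_ fun _ h => h
  · have := hR.ne_zero
    simp [mergeHead, Prog.Safe, Prog.run, h8, h5]
    lia
  · have henv₂ := henv.frame hf₂ rfl
    obtain ⟨s₂, hs₂e⟩ : ∃ s₂, s₂ = mergeHead.run s := ⟨_, rfl⟩
    have et : tab s₂ = tab s := hs₂e ▸ tab_frame hf₂ rfl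
    have g11 : s₂.word 11 = x := by simp [hs₂e, mergeHead, Prog.run, h10, hx]
    have g12 : s₂.word 12 = p := by simp [hs₂e, mergeHead, Prog.run, h10, hp, hx]
    have g13 : s₂.word 13 = s.wmem 19 x := by simp [hs₂e, mergeHead, Prog.run, h10, hx]
    have g14 : s₂.word 14 = s.wmem 19 p := by simp [hs₂e, mergeHead, Prog.run, h10, hp, hx]
    have g15 : s₂.word 15 = A := by simp [hs₂e, mergeHead, Prog.run, h8]
    have g16 : s₂.word 16 = A + 4 ^ m := by simp [hs₂e, mergeHead, Prog.run, h8, h5]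
    have g17 : s₂.word 17 = (X.bagList x).length := by
      rw [← henv.size x hxt.le]; simp [hs₂e, mergeHead, Prog.run, h10, hx]
    have g18 : s₂.word 18 = s₂.wmem 3 x := by simp [hs₂e, mergeHead, Prog.run, h10, hx]
    rw [← hs₂e] at hs₂ hf₂ henv₂ ⊢
    refine Runs.seq hs₂ (runs_proj hR henv₂ hs₂ hxt.le hpt g12 g13 g15 g17 g18 hcx hAt
      (by lia) (et ▸ hok) (et ▸ htx) (hM.parts.self x hxA)
      (fun v hv hc => hM.parts.mem_child hxA hpA hpx.symm hv hc)
      (fun v hv hv' z hz hvz => hM.parts.mem_of_forgotten hxA hbag hv hv' hz hvz))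
      fun s₃ hf₃ hs₃ ⟨S₁, ok₁, ext₁, tab₁⟩ => ?_
    have henv₃ := henv₂.frame hf₃ rfl
    refine Runs.run_seq rfl hs₃ ?_ fun hs₄ hf₄ => ?_
    · simp [mergeMid, Prog.Safe, Prog.run]
    have henv₄ := henv₃.frame hf₄ rfl
    have g12' : s₃.word 12 = p := (hf₃.word 12 rfl).trans g12
    obtain ⟨s₄, hs₄e⟩ : ∃ s₄, s₄ = mergeMid.run s₃ := ⟨_, rfl⟩
    have k17 : s₄.word 17 = (X.bagList p).length := by
      rw [← henv₃.size p hpt]; simp [hs₄e, mergeMid, Prog.run, g12']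
    have k18 : s₄.word 18 = s₄.wmem 3 p := by simp [hs₄e, mergeMid, Prog.run, g12']
    rw [← hs₄e] at hs₄ hf₄ henv₄ ⊢
    have et₄ : tab s₄ = tab s₃ := tab_frame hf₄ rfl
    have j (x : ℕ) (h3 : projProg.setsWord x = false) (h4 : mergeMid.setsWord x = false) :
        s₄.word x = s₂.word x := (hf₄.word x h4).trans (hf₃.word x h3)
    rw [et] at ext₁
    have htp₁ := htp.of_extends henv.le ext₁ hcp
    refine Runs.seq hs₄ (runs_join hR henv₄ hs₄ hxt.le hpt ((j 11 rfl rfl).trans g11)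
      ((j 14 rfl rfl).trans g14) ((j 15 rfl rfl).trans g15) ((j 16 rfl rfl).trans g16) k17 k18
      (by lia) (by lia) (by lia) (by lia) (et₄ ▸ ok₁) (et₄ ▸ htp₁) (et₄ ▸ tab₁)
      (hM.parts.self p hpA) (hM.parts.self x hxA)
      (fun v hv hc => hM.parts.mem_child hxA hpA hpx.symm hv hc)
      (fun v h1 h2 => hM.parts.mem_parent hxA hpA hpx.symm h1 h2))
      fun s₅ hf₅ hs₅ ⟨S₂, ok₂, ext₂, tab₂⟩ => ?_
    rw [et₄] at ext₂
    have g16' : s₅.word 16 = A + 4 ^ m := ((hf₅.word 16 rfl).trans (j 16 rfl rfl)).trans g16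
    have g12'' : s₅.word 12 = p := ((hf₅.word 12 rfl).trans (j 12 rfl rfl)).trans g12
    have g5 : s₅.word 5 = 4 ^ m := (henv₄.frame hf₅ rfl).hQ
    have g19 : s₅.wmem 19 = s.wmem 19 := by
      rw [hf₅.wmem 19 rfl, hf₄.wmem 19 rfl, hf₃.wmem 19 rfl, hf₂.wmem 19 rfl]
    have eA : (t + 1 + 2 * (i + 1)) * 4 ^ m = A + 4 ^ m + 4 ^ m := by rw [hA]; ring
    have ext₃ : Extends (tab s) S (tab s₅) S₂ A := ext₁.trans ext₂ (by lia)
    refine Runs.of_run rfl hs₅ ?_ (by decide)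
      ⟨Function.update N p (N p ∪ N x), S₂, ?_⟩
    · simp [mergeTail, Prog.Safe, Prog.run, g16', g5]
      lia
    · have hal : ∀ y, Alive t (s.wmem 14) (i + 1) y ↔ Alive t (s.wmem 14) i y ∧ y ≠ x := by
        intro y
        constructor
        · exact fun h => ⟨⟨h.1, fun j hj => h.2 j (by lia)⟩,
            fun e => h.2 i (by lia) (by rw [e, hx])⟩
        · refine fun h => ⟨h.1.1, fun j hj => ?_⟩
          rcases Nat.lt_succ_iff_lt_or_eq.1 hj with hj | rfl
          · exact h.1.2 j hj
          · rw [← hx]; exact h.2.symm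
      have etab : tab (mergeTail.run s₅) = tab s₅ := by
        simp [tab, mergeTail, Prog.run]
      have ecur : ∀ y, (mergeTail.run s₅).wmem 19 y = if y = p then A + 4 ^ m else s.wmem 19 y := by
        intro y
        simp [mergeTail, Prog.run, g12'', g16', g19, Function.update_apply]
      have hal' : Alive t (s.wmem 14) (i + 1) = fun y => Alive t (s.wmem 14) i y ∧ y ≠ x :=
        funext fun y => propext (hal y)
      refine ⟨?_, ?_, ?_, ?_, ?_⟩
      · rw [eA]; simp [mergeTail, Prog.run, g16', g5]
      · rw [hal']
        exact hM.parts.merge hxA hpA hpx.symm hbag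
      · rw [eA, etab]; exact ok₂
      · intro y hy
        have := hM.cur_le y ((hal y).1 hy).1
        rw [ecur, eA]
        rw [← hA] at this
        split_ifs <;> lia
      · intro y hy
        rw [ecur, etab, Function.update_apply]
        split_ifs with e
        · rw [e]; exact tab₂
        · have hc := hM.cur_le y ((hal y).1 hy).1
          rw [← hA] at hc
          exact (hM.table y ((hal y).1 hy).1).of_extends henv.le ext₃ hc
  · have h1 : mergeHead.steps ≤ 80 := by decide
    have h2 : mergeMid.steps ≤ 20 := by decide
    nlinarith

/-- The elimination of all the nodes of the tree. -/
theorem runs_merge (hR : Room W n t m) (henv : Env X W m s) (hs : s.FitsIn W)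
    {A : ℕ → ℕ → Prop} {k : ℕ} {dg sm : ℕ → ℕ}
    (hP : Peeled A t X.bagList t k (s.wmem 14) dg sm (s.wmem 15)) {S₀ : ℕ → Finset ℕ}
    (hok : TabOK X m (tab s) S₀ ((t + 1) * 4 ^ m))
    (hcur : ∀ y ≤ t, s.wmem 19 y = y * 4 ^ m)
    (htab : ∀ y ≤ t, TableAt X m (tab s) S₀ y {y} (y * 4 ^ m)) :
    Runs W mergeProg s (t * (4 ^ m * (m * 250 + 500) + 208) + 10) (fun s' =>
      ∃ N S, Merged m X (s.wmem 14) t s' N S) := by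
  refine (Runs.run_seq rfl hs (by simp [Prog.Safe]) fun hs₂ hf₂ => ?_).mono
    (B := _ + (t * (4 ^ m * (m * 250 + 500) + 200 + 8) + 6)) ?_ fun _ h => h
  · have henv₂ := henv.frame hf₂ rfl
    have h7 := henv.htQ
    have e14 := hf₂.wmem 14 rfl
    have e15 := hf₂.wmem 15 rfl
    have e19 := hf₂.wmem 19 rfl
    have et := tab_frame hf₂ rfl
    have g8 : (Prog.run (.setWord 8 (.reg 7)) s).word 8 = (t + 1) * 4 ^ m := by
      simp [Prog.run, h7]
    generalize Prog.run (.setWord 8 (.reg 7)) s = s₂ at *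
    refine Runs.forLoop (fun i s' => ∃ N S, Merged m X (s.wmem 14) i s' N S)
      hs₂ hR.one_lt henv₂.ht rfl rfl rfl ?_ ?_ fun s' _ hf h => h
    · refine ⟨fun y => {y}, S₀, ?_, ?_, ?_, ?_, ?_⟩
      · simpa using g8
      · have : Alive t (s.wmem 14) 0 = fun y => y ≤ X.net.t := by
          funext y; simp [Alive, SteinerInput.net]
        rw [this]
        exact Parts.singletons _
      · rw [tab_setW, et]; simpa using hok
      · rintro y ⟨hy, -⟩
        simp only [Store.setW_wmem, e19, hcur y hy]
        have := Nat.mul_le_mul_right (4 ^ m) (show y + 1 ≤ t + 1 + 2 * 0 by lia)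
        lia
      · rintro y ⟨hy, -⟩
        rw [tab_setW, et, Store.setW_wmem, e19, hcur y hy]
        exact htab y hy
    · rintro i s₁ hi hf hs₁ h10 ⟨N, S, hM⟩
      have e14' : s₁.wmem 14 = s.wmem 14 := (hf.wmem 14 rfl).trans e14
      have e15' : s₁.wmem 15 = s.wmem 15 := (hf.wmem 15 rfl).trans e15
      rw [← e14', ← e15'] at hP
      rw [← e14'] at hM ⊢
      refine (runs_mergeBody hR (henv₂.frame hf rfl) hs₁ hP hi h10 hM).mono le_rfl ?_
      rintro s' ⟨N', S', hM'⟩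
      exact ⟨N', S', ⟨by simpa using hM'.addr, hM'.parts, hM'.ok, hM'.cur_le, hM'.table⟩⟩
  · have : Prog.steps (.setWord 8 (.reg 7)) = 2 := rfl
    rw [this]
    lia

end SteinerProg

/-! ### The reconstruction of an optimal solution -/

namespace SteinerProg

open RAM RAM.Prog SteinerDP SteinerDP.Net TreePeel

set_option linter.unusedSimpArgs false

variable {n t m W : ℕ} {X : SteinerInput n t} {s : Store}

/-- The set that is represented by the table entry `b` is the union of the sets that are selected
by the marked entries of the tables of single bags. -/
theorem runs_mark (hR : Room W n t m) (henv : Env X W m s) (hs : s.FitsIn W)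
    {S : ℕ → Finset ℕ} {A b : ℕ} (hA : s.word 8 = A) (hA' : A = (t + 1 + 2 * t) * 4 ^ m)
    (hb : s.word 9 = b) (hbA : b < A) (hT : TabOK X m (tab s) S A) (hfb : (tab s).fl b = 1)
    (h20 : ∀ i, s.wmem 20 i = 0) :
    Runs W markProg s (2 * t * 4 ^ m * 70 + 30) (fun s' =>
      ∀ v, v ∈ S b ↔ ∃ j < (t + 1) * 4 ^ m, s'.wmem 20 j = 1 ∧
        v ∈ X.net.baseSet (j / 4 ^ m) (j % 4 ^ m)) := by
  have eA : A = (t + 1) * 4 ^ m + 2 * t * 4 ^ m := by rw [hA']; ring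
  have h7 := henv.htQ
  refine (Runs.run_seq (B := 2 * t * 4 ^ m * (62 + 8) + 6) rfl hs ?_ fun hs₂ hf₂ => ?_).mono
    (by have : Prog.steps (.storeWord 20 (.reg 9) 1 ;; .setWord 11 (.reg 8 - .reg 7)) ≤ 20 := by
          decide
        lia) fun _ h => h
  · have := hR.const
    simp [Prog.Safe, Prog.run]
    all_goals lia
  have henv₂ := henv.frame hf₂ rfl
  have et : tab (Prog.run (.storeWord 20 (.reg 9) 1 ;; .setWord 11 (.reg 8 - .reg 7)) s) = tab s :=
    tab_frame hf₂ rfl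
  have g8 := hf₂.word 8 rfl
  have g11 : (Prog.run (.storeWord 20 (.reg 9) 1 ;; .setWord 11 (.reg 8 - .reg 7)) s).word 11 =
      2 * t * 4 ^ m := by
    simp [Prog.run, hA, h7, eA]
  have g20 : ∀ j,
      (Prog.run (.storeWord 20 (.reg 9) 1 ;; .setWord 11 (.reg 8 - .reg 7)) s).wmem 20 j =
        if j = b then 1 else 0 := by
    intro j
    simp [Prog.run, hb, Function.update_apply, h20]
  generalize Prog.run (.storeWord 20 (.reg 9) 1 ;; .setWord 11 (.reg 8 - .reg 7)) s = s₂ at *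
  -- the entries above `A - i` have been resolved into entries below
  refine (Runs.forLoop (N := 2 * t * 4 ^ m) (B := 62) (fun i s' =>
    (∀ j, s'.wmem 20 j = 1 → (tab s).fl j = 1) ∧
    ∀ v, v ∈ S b ↔ ∃ j < A - i, s'.wmem 20 j = 1 ∧ v ∈ S j)
    hs₂ hR.one_lt g11 rfl rfl rfl ?_ ?_ fun s' _ _ h => h).mono le_rfl ?_
  · simp only [Store.setW_wmem, g20]
    constructor
    · intro j hj
      split_ifs at hj with e
      · rw [e]; exact hfb
    · intro v
      constructor
      · exact fun hv => ⟨b, by lia, by simp, hv⟩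
      · rintro ⟨j, -, hj, hv⟩
        split_ifs at hj with e
        · exact e ▸ hv
  · rintro i s₁ hi hf hs₁ h10 ⟨hI, hI'⟩
    have et₁ : tab s₁ = tab s := (tab_frame hf rfl).trans et
    have e8 : s₁.word 8 = A := by rw [hf.word 8 rfl, g8, hA]
    obtain ⟨d, hd⟩ : ∃ d, d = A - 1 - i := ⟨_, rfl⟩
    have hd' : A - i = d + 1 := by lia
    have hdA : A - (i + 1) = d := by lia
    have e17 : s₁.wmem 17 d = (tab s).p1 d := by rw [← et₁]; rfl
    have e18 : s₁.wmem 18 d = (tab s).p2 d := by rw [← et₁]; rfl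
    rw [hd'] at hI'
    refine Runs.of_run rfl hs₁ ?_ (by decide) ?_
    · have := hR.ne_zero
      simp [markBody, Prog.Safe, Prog.run, this]
    · simp only [Store.setW_wmem, hdA]
      by_cases hM : s₁.wmem 20 d = 1
      · have e20 : ∀ j, (markBody.run s₁).wmem 20 j =
            if j = (tab s).p2 d then 1 else if j = (tab s).p1 d then 1 else s₁.wmem 20 j := by
          intro j
          simp [markBody, Prog.run, e8, h10, ← hd, hM, Function.update_apply, e17, e18]
        simp only [e20]
        obtain ⟨q1, q2, q3, q4, q5⟩ := hT.ptr d (hI d hM) (by lia)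
        refine ⟨fun j hj => ?_, fun v => (hI' v).trans ?_⟩
        · split_ifs at hj with e e'
          · rw [e]; exact q4
          · rw [e']; exact q3
          · exact hI j hj
        · constructor
          · rintro ⟨j, hj, hjM, hv⟩
            rcases Nat.lt_succ_iff_lt_or_eq.1 hj with hj | rfl
            · exact ⟨j, hj, by simp [hjM], hv⟩
            · rw [q5, Finset.mem_union] at hv
              rcases hv with hv | hv
              · exact ⟨_, q1, by simp, hv⟩
              · exact ⟨_, q2, by simp, hv⟩
          · rintro ⟨j, hj, hjM, hv⟩
            split_ifs at hjM with e e'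
            · exact ⟨d, by lia, hM, by rw [q5, Finset.mem_union]; exact .inr (e ▸ hv)⟩
            · exact ⟨d, by lia, hM, by rw [q5, Finset.mem_union]; exact .inl (e' ▸ hv)⟩
            · exact ⟨j, by lia, hjM, hv⟩
      · have e20 : (markBody.run s₁).wmem 20 = s₁.wmem 20 := by
          simp [markBody, Prog.run, e8, h10, ← hd, hM]
        rw [e20]
        refine ⟨hI, fun v => (hI' v).trans ?_⟩
        constructor
        · rintro ⟨j, hj, hjM, hv⟩
          rcases Nat.lt_succ_iff_lt_or_eq.1 hj with hj | rfl
          · exact ⟨j, hj, hjM, hv⟩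
          · exact absurd hjM hM
        · rintro ⟨j, hj, h⟩
          exact ⟨j, by lia, h⟩
  · rintro s' ⟨hI, hI'⟩ v
    rw [hI' v, show A - 2 * t * 4 ^ m = (t + 1) * 4 ^ m by lia]
    refine exists_congr fun j => and_congr_right fun hj => and_congr_right fun hM => ?_
    rw [hT.base j (hI j hM) hj]

theorem runs_outLoop (hR : Room W n t m) (henv : Env X W m s) (hs : s.FitsIn W)
    {y c : ℕ} (hy : y ≤ t) (h12 : s.word 12 = c) (h13 : s.word 13 = s.wmem 3 y)
    (h14 : s.word 14 = (X.bagList y).length) :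
    Runs W (forLoop 16 14 outInner) s (m * 100 + 6) (fun s' =>
      ∀ v, s'.wmem 7 v = 1 ↔ s.wmem 7 v = 1 ∨ v ∈ X.net.baseSet y c) := by
  refine (Runs.forLoop (N := (X.bagList y).length) (B := 92) (fun j s' =>
    ∀ v, s'.wmem 7 v = 1 ↔ s.wmem 7 v = 1 ∨
      v ∈ (X.bagList y).take j ∧ dec (X.bagList y) c v ≠ 0) hs hR.one_lt h14 rfl rfl rfl
    (by simp) ?_ fun s' _ _ h => h).mono
      (by have := henv.le y; nlinarith) fun s' h v => by
        rw [h v, List.take_length, mem_baseSet, net_bag]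
  intro j s₁ hj hf hs₁ h16 hI
  have henv₁ := henv.frame hf rfl
  have hv := henv₁.elem y hy j hj
  have ha := henv₁.addr y hy j hj
  have hd := henv₁.digit c hj
  have e12 : s₁.word 12 = c := (hf.word 12 rfl).trans h12
  have e13 : s₁.word 13 = s₁.wmem 3 y := by rw [hf.word 13 rfl, hf.wmem 3 rfl, h13]
  simp_rw [List.take_succ_eq_append_getElem hj, List.mem_append, List.mem_singleton]
  obtain ⟨u, hu⟩ : ∃ u, (X.bagList y)[j] = u := ⟨_, rfl⟩
  simp only [hu] at *
  refine Runs.of_run rfl hs₁ ?_ (by decide) ?_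
  · have := hR.ne_zero
    have := hR.const
    simp [outInner, Prog.Safe, Prog.run, h16, e13, ha]
    and_intros <;> lia
  · intro v
    by_cases h0 : dec (X.bagList y) c u = 0
    · simp [outInner, Prog.run, e12, h16, hd, h0, hI]
      grind
    · simp [outInner, Prog.run, e12, e13, h16, hd, h0, hv, Function.update_apply]
      have := hI v
      grind

/-- The output is the set that is selected by the marked entries of the tables of single bags. -/
theorem runs_out (hR : Room W n t m) (henv : Env X W m s) (hs : s.FitsIn W)
    (h7 : ∀ v, s.wmem 7 v = 0) :
    Runs W outProg s ((t + 1) * 4 ^ m * (m * 100 + 100) + 6) (fun s' =>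
      ∀ v, s'.wmem 7 v = 1 ↔ ∃ j < (t + 1) * 4 ^ m, s.wmem 20 j = 1 ∧
        v ∈ X.net.baseSet (j / 4 ^ m) (j % 4 ^ m)) := by
  have hQ : 0 < 4 ^ m := by positivity
  refine (Runs.forLoop (N := (t + 1) * 4 ^ m) (B := m * 100 + 92) (fun i s' =>
    ∀ v, s'.wmem 7 v = 1 ↔ ∃ j < i, s.wmem 20 j = 1 ∧
        v ∈ X.net.baseSet (j / 4 ^ m) (j % 4 ^ m))
    hs hR.one_lt henv.htQ rfl rfl rfl (by simp [h7]) ?_ fun s' _ hf h => h).mono le_rfl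
    fun _ h => h
  intro i s₁ hi hf hs₁ h10 hI
  have henv₁ := henv.frame hf rfl
  have hy : i / 4 ^ m ≤ t := by
    rw [← Nat.lt_succ_iff]; exact (Nat.div_lt_iff_lt_mul hQ).2 hi
  have e5 := henv₁.hQ
  have e20 : s₁.wmem 20 = s.wmem 20 := hf.wmem 20 rfl
  refine (Runs.ite (B := decodeHead.steps + (m * 100 + 6)) hs₁ ?_ ?_ ?_).mono
    (by have : decodeHead.steps ≤ 50 := by decide
        simp [Test.time, WExp.time]
        lia) fun _ h => h
  · have := hR.ne_zero
    simp [this]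
  · intro hM
    replace hM : s₁.wmem 20 (s₁.word 10) = 1 := hM
    rw [h10, e20] at hM
    refine Runs.run_seq rfl hs₁ (decodeHead_safe hR) fun hs₂ hf₂ => ?_
    have henv₂ := henv₁.frame hf₂ rfl
    refine (runs_outLoop hR henv₂ hs₂ hy (c := i % 4 ^ m) ?_ ?_ ?_).mono le_rfl ?_
    · simp [decodeHead, Prog.run, h10, e5]
    · simp [decodeHead, Prog.run, h10, e5]
    · simp [decodeHead, Prog.run, h10, e5, henv₁.size _ hy]
    · intro s' h v
      have := h v
      rw [hf₂.wmem 7 rfl, hI v] at this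
      rw [Store.setW_wmem, this]
      constructor
      · rintro (⟨j, hj, h'⟩ | h')
        · exact ⟨j, by lia, h'⟩
        · exact ⟨i, by lia, hM, h'⟩
      · rintro ⟨j, hj, h'⟩
        rcases Nat.lt_succ_iff_lt_or_eq.1 hj with hj | rfl
        · exact .inl ⟨j, hj, h'⟩
        · exact .inr h'.2
  · intro hM
    replace hM : ¬ s₁.wmem 20 (s₁.word 10) = 1 := hM
    rw [h10, e20] at hM
    refine Runs.of_run rfl hs₁ trivial (by simp [Prog.steps]; lia) ?_
    intro v
    rw [Store.setW_wmem]
    refine (hI v).trans ⟨fun ⟨j, hj, h'⟩ => ⟨j, by lia, h'⟩, fun ⟨j, hj, h'⟩ => ?_⟩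
    rcases Nat.lt_succ_iff_lt_or_eq.1 hj with hj | rfl
    · exact ⟨j, hj, h'⟩
    · exact absurd h'.1 hM

/-- In the table of the virtual node `t` for all the nodes there is an entry if and only if there
is a locally feasible set, and it is an optimal one. -/
theorem TableAt.final {T : Tab} {S : ℕ → Finset ℕ} {N : Set ℕ} {b : ℕ}
    (h : TableAt X m T S t N b) (hN : ∀ z ≤ t, z ∈ N) :
    (T.fl b = 1 → X.net.LocallyFeasible (S b)) ∧
    ∀ F, X.net.LocallyFeasible F →
      T.fl b = 1 ∧ ∑ v ∈ S b, X.net.cost v ≤ ∑ v ∈ F, X.net.cost v := by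
  have hbag : X.net.bag t = [] := X.net.virt t le_rfl
  have hcov : ∀ v < n, X.net.Covered N v := fun v hv => by
    obtain ⟨y, hy, hvy⟩ := X.net.cover v hv
    exact ⟨y, hN y hy.le, hvy⟩
  have hsound := h.sound 0 (by positivity)
  rw [add_zero] at hsound
  constructor
  · intro h1
    have hS := hsound h1
    refine ⟨fun v hv => ?_, fun v hv => hS.term v (hcov v (X.net.term_lt v hv)) hv,
      fun v hv => hS.forgotten v hv (by simp [hbag])⟩
    obtain ⟨z, _, hz⟩ := hS.covered v hv
    exact X.net.lt z v hz
  · intro F hF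
    have hc := h.complete F hF (fun _ => 0) (by intro v hv; simp [hbag] at hv)
    rw [hbag] at hc
    have e0 : enc [] (fun _ => 0) = 0 := enc_zero ..
    simp only [e0, add_zero] at hc
    refine ⟨hc.1, ?_⟩
    have e := (hsound hc.1).cost
    simp only [hbag, List.not_mem_nil, not_false_eq_true, Finset.filter_true] at e
    rw [← e]
    refine hc.2.trans ?_
    exact Finset.sum_le_sum_of_subset_of_nonneg (by classical exact Finset.filter_subset _ _)
      fun v _ _ => X.net.cost_nonneg v

/-- If the elimination has been done correctly, the last phase solves the instance. -/
theorem runs_finish (hR : Room W n t m) (henv : Env X W m s) (hs : s.FitsIn W)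
    {q : ℕ → ℕ} (hq : ∀ y, Alive t q t y ↔ y = t) {N : ℕ → Set ℕ} {S : ℕ → Finset ℕ}
    (hM : Merged m X q t s N S) (h20 : ∀ i, s.wmem 20 i = 0) (h7 : ∀ v, s.wmem 7 v = 0) :
    Runs W finishProg s ((t + 1) * 4 ^ m * (m * 100 + 300) + 200) X.I.SolvedBy := by
  have hQ : 0 < 4 ^ m := by positivity
  obtain ⟨b, hb⟩ : ∃ b, b = s.wmem 19 t := ⟨_, rfl⟩
  have hal : Alive t q t t := (hq t).2 rfl
  have hN : ∀ z ≤ t, z ∈ N t := fun z hz => by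
    obtain ⟨y, hy, hzy⟩ := hM.parts.cover z hz
    rwa [(hq y).1 hy] at hzy
  have htab := hM.table t hal
  have hle := hM.cur_le t hal
  rw [← hb] at htab hle
  obtain ⟨hfl, hmin⟩ := htab.final hN
  have ht := henv.ht
  have e9 : (Prog.run (.setWord 9 (.load 19 (.reg 3))) s).word 9 = b := by
    simp [Prog.run, ht, hb]
  refine (Runs.run_seq (B := (t + 1) * 4 ^ m * (m * 100 + 300) + 150) rfl hs
    (by simp [Prog.Safe]) fun hs₂ hf₂ => ?_).mono
    (by have : Prog.steps (.setWord 9 (.load 19 (.reg 3))) ≤ 20 := by decide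
        lia) fun _ h => h
  have et : tab (Prog.run (.setWord 9 (.load 19 (.reg 3))) s) = tab s := tab_frame hf₂ rfl
  generalize Prog.run (.setWord 9 (.load 19 (.reg 3))) s = s₂ at *
  have henv₂ := henv.frame hf₂ rfl
  have e16 : s₂.wmem 16 (s₂.word 9) = (tab s).fl b := by rw [← et, e9]; rfl
  refine (Runs.ite (B := 2 * t * 4 ^ m * 70 + 30 + ((t + 1) * 4 ^ m * (m * 100 + 100) + 6 + 20))
    hs₂ ?_ ?_ ?_).mono ?_ fun _ h => h
  · have := hR.ne_zero
    simp [this]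
  · intro h1
    replace h1 : s₂.wmem 16 (s₂.word 9) = 1 := h1
    rw [e16] at h1
    refine Runs.seq hs₂ (runs_mark hR henv₂ hs₂ ((hf₂.word 8 rfl).trans hM.addr) rfl e9
      (by lia) (et ▸ hM.ok) (et ▸ h1) (by rw [hf₂.wmem 20 rfl]; exact h20))
      fun s₃ hf₃ hs₃ hmark => ?_
    refine Runs.seq hs₃ (runs_out hR (henv₂.frame hf₃ rfl) hs₃
      (by rw [hf₃.wmem 7 rfl, hf₂.wmem 7 rfl]; exact h7)) fun s₄ hf₄ hs₄ hout => ?_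
    have := hR.ne_zero
    refine Runs.of_run rfl hs₄ (by simp [Prog.Safe, this]) (by decide) ?_
    have hset : RAM.Store.outSet n (Prog.run (.setWord 0 1) s₄) =
        SteinerInput.toVerts n (S b) := by
      ext v
      simp only [RAM.Store.outSet, SteinerInput.toVerts, Finset.mem_filter, Finset.mem_univ,
        true_and]
      exact (hout v).trans (hmark v).symm
    refine ⟨fun _ => ⟨by simp [Prog.run], ?_⟩, fun hno =>
      absurd ⟨_, X.feasible_of_locallyFeasible (hfl h1)⟩ hno⟩
    rw [hset]
    exact X.optimal_toVerts (hfl h1) fun F hF => (hmin F hF).2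
  · intro h1
    replace h1 : ¬ s₂.wmem 16 (s₂.word 9) = 1 := h1
    rw [e16] at h1
    refine Runs.of_run rfl hs₂ (by simp [Prog.Safe]) (by simp [Prog.steps, WExp.time]; lia) ?_
    refine ⟨fun ⟨F, hF⟩ => ?_, fun _ => by simp [Prog.run]⟩
    obtain ⟨G, hG, -⟩ := X.exists_locallyFeasible hF
    exact absurd (hmin G hG).1 h1
  · simp only [Test.time, WExp.time]
    nlinarith

end SteinerProg

/-! ### The input in the memory -/

namespace SteinerProg

open RAM RAM.Prog SteinerDP SteinerDP.Net TreePeel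

set_option linter.unusedSimpArgs false

variable {n t m W : ℕ} {X : SteinerInput n t} {s : Store}

/-- The part of the input that is never overwritten is in its place. -/
structure Input (X : SteinerInput n t) (s : Store) : Prop where
  hn : s.word 0 = n
  ha : s.word 1 = X.arcs.length
  hr : s.word 2 = X.I.r
  ht : s.word 3 = t
  tail : ∀ i, (h : i < X.arcs.length) → s.wmem 0 i = X.arcs[i].1
  head : ∀ i, (h : i < X.arcs.length) → s.wmem 1 i = X.arcs[i].2
  term : ∀ v < n, s.wmem 2 v = 1 ↔ X.net.term v
  off : ∀ y < t, s.wmem 3 (y + 1) = s.wmem 3 y + (X.bagList y).length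
  addr : ∀ y ≤ t, s.wmem 3 y + (X.bagList y).length ≤ t * n
  elem : ∀ y ≤ t, ∀ j, (h : j < (X.bagList y).length) →
    s.wmem 4 (s.wmem 3 y + j) = (X.bagList y)[j]
  link₁ : ∀ i, (h : i < X.links.length) → s.wmem 5 i = X.links[i].1
  link₂ : ∀ i, (h : i < X.links.length) → s.wmem 6 i = X.links[i].2
  cost : ∀ v < n, s.rmem 0 v = X.net.cost v

/-- The program does not assign to the input. -/
def keepsInput (p : Prog) : Bool :=
  !(p.setsWord 0 || p.setsWord 1 || p.setsWord 2 || p.setsWord 3 || p.putsWord 0 ||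
    p.putsWord 1 || p.putsWord 2 || p.putsWord 3 || p.putsWord 4 || p.putsWord 5 ||
    p.putsWord 6 || p.putsReal 0)

theorem Input.frame {s' : Store} {p : Prog} (h : Input X s) (hf : Frame p s s')
    (hp : keepsInput p = true) : Input X s' := by
  simp only [keepsInput, Bool.not_eq_true', Bool.or_eq_false_iff] at hp
  obtain ⟨⟨⟨⟨⟨⟨⟨⟨⟨⟨⟨w0, w1⟩, w2⟩, w3⟩, a0⟩, a1⟩, a2⟩, a3⟩, a4⟩, a5⟩, a6⟩, r0⟩ := hp
  constructor
  · rw [hf.word 0 w0, h.hn]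
  · rw [hf.word 1 w1, h.ha]
  · rw [hf.word 2 w2, h.hr]
  · rw [hf.word 3 w3, h.ht]
  · rw [hf.wmem 0 a0]; exact h.tail
  · rw [hf.wmem 1 a1]; exact h.head
  · rw [hf.wmem 2 a2]; exact h.term
  · rw [hf.wmem 3 a3]; exact h.off
  · rw [hf.wmem 3 a3]; exact h.addr
  · rw [hf.wmem 3 a3, hf.wmem 4 a4]; exact h.elem
  · rw [hf.wmem 5 a5]; exact h.link₁
  · rw [hf.wmem 6 a6]; exact h.link₂
  · rw [hf.rmem 0 r0]; exact h.cost

/-- An element of a concatenation of lists, by its position in its own list. -/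
theorem getElem?_flatten {α : Type*} (L : List (List α)) (y j : ℕ) (hy : y < L.length)
    (hj : j < L[y].length) :
    L.flatten[((L.take y).map List.length).sum + j]? = some L[y][j] := by
  induction L generalizing y with
  | nil => simp at hy
  | cons l L ih =>
    cases y with
    | zero => simpa using by rw [List.getElem?_append_left (by simpa using hj)]; simp
    | succ y =>
      simp only [List.take_succ_cons, List.map_cons, List.sum_cons, List.flatten_cons,
        List.getElem_cons_succ]
      rw [add_assoc, List.getElem?_append_right (by lia), Nat.add_sub_cancel_left]
      exact ih y (by simpa using hy) (by simpa using hj)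

theorem bagList_eq (X : SteinerInput n t) {y : ℕ} (hy : y < t) :
    X.bagList y = (X.bags ⟨y, hy⟩).map Fin.val := by
  simp [SteinerInput.bagList, hy]

theorem length_bag_le (X : SteinerInput n t) (y : Fin t) : (X.bags y).length ≤ n := by
  simpa using (X.bags_nodup y).length_le_card

theorem store_offset (X : SteinerInput n t) {y : ℕ} (hy : y ≤ t) :
    X.store.wmem 3 y = (((List.ofFn X.bags).take y).map List.length).sum := by
  simp [SteinerInput.store, SteinerInput.offsets, List.getElem?_range (show y < t + 1 by lia)]

theorem store_offset_succ (X : SteinerInput n t) {y : ℕ} (hy : y < t) :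
    X.store.wmem 3 (y + 1) = X.store.wmem 3 y + (X.bagList y).length := by
  rw [store_offset X hy, store_offset X hy.le, bagList_eq X hy,
    List.take_succ_eq_append_getElem (by simpa using hy)]
  simp

theorem store_offset_le (X : SteinerInput n t) {y : ℕ} (hy : y ≤ t) :
    X.store.wmem 3 y ≤ y * n := by
  induction y with
  | zero => rw [store_offset X hy]; simp
  | succ y ih =>
    have := ih (by lia)
    rw [store_offset_succ X hy, bagList_eq X hy, List.length_map]
    have := length_bag_le X ⟨y, hy⟩
    lia

/-- In the definition of the initial state the concatenation of the bags is coerced to a list of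
numbers before the (then trivial) map. -/
theorem store_bags (X : SteinerInput n t) (i : ℕ) :
    X.store.wmem 4 i = ((List.ofFn X.bags).flatten.map Fin.val).getD i 0 := by
  rw [List.map_eq_flatMap]
  simp [SteinerInput.store]

theorem input_store (X : SteinerInput n t) : Input X X.store where
  hn := rfl
  ha := rfl
  hr := rfl
  ht := rfl
  tail i h := by simp [SteinerInput.store, h]
  head i h := by simp [SteinerInput.store, h]
  term v hv := by
    simp [SteinerInput.store, SteinerInput.net, hv]
  off y hy := store_offset_succ X hy
  addr y hy := by
    rcases hy.lt_or_eq with h | rfl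
    · rw [← store_offset_succ X h]
      exact (store_offset_le X h).trans (Nat.mul_le_mul_right _ h)
    · simpa [SteinerInput.bagList] using store_offset_le X hy
  elem y hy j hj := by
    rcases hy.lt_or_eq with h | rfl
    · have hj' : j < (X.bags ⟨y, h⟩).length := by simpa [bagList_eq X h] using hj
      have := getElem?_flatten (List.ofFn X.bags) y j (by simpa using h) (by simpa using hj')
      rw [store_offset X hy, store_bags, List.getD_eq_getElem?_getD, List.getElem?_map, this]
      simp [bagList_eq X h]
    · simp [SteinerInput.bagList] at hj
  link₁ i h := by simp [SteinerInput.store, h]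
  link₂ i h := by simp [SteinerInput.store, h]
  cost v hv := by simp [SteinerInput.store, SteinerInput.net, hv]

theorem store_wmem (X : SteinerInput n t) {a : ℕ} (ha : 7 ≤ a) (i : ℕ) : X.store.wmem a i = 0 := by
  obtain ⟨a, rfl⟩ := Nat.exists_eq_add_of_le' ha
  rfl

theorem store_word (X : SteinerInput n t) {x : ℕ} (hx : 4 ≤ x) : X.store.word x = 0 := by
  obtain ⟨x, rfl⟩ := Nat.exists_eq_add_of_le' hx
  rfl

theorem store_rmem (X : SteinerInput n t) {a : ℕ} (ha : 1 ≤ a) (i : ℕ) : X.store.rmem a i = 0 := by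
  simp [SteinerInput.store, show a ≠ 0 by lia]

theorem getD_zero_lt {l : List ℕ} {B : ℕ} (hB : 0 < B) (h : ∀ x ∈ l, x < B) (i : ℕ) :
    l.getD i 0 < B := by
  rw [List.getD_eq_getElem?_getD]
  rcases lt_or_ge i l.length with hi | hi
  · rw [List.getElem?_eq_getElem hi]
    exact h _ (List.getElem_mem hi)
  · rw [List.getElem?_eq_none hi]
    exact hB

theorem length_arcs_le (X : SteinerInput n t) : X.arcs.length ≤ n * n := by
  simpa using X.arcs_nodup.length_le_card

theorem store_fitsIn (hR : Room W n t m) (X : SteinerInput n t) : X.store.FitsIn W := by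
  have h1 := hR.pos
  have h2 := hR.arc
  have h3 := hR.const
  have hn : n < 2 ^ W := by nlinarith
  have ht : t < 2 ^ W := by nlinarith
  have hnt : t * n < 2 ^ W := by nlinarith
  have ha : X.arcs.length < 2 ^ W := by have := length_arcs_le X; nlinarith
  have h0 : 0 < 2 ^ W := by positivity
  constructor
  · intro x
    refine getD_zero_lt h0 ?_ x
    simp only [List.mem_cons, List.not_mem_nil, or_false]
    rintro y (rfl | rfl | rfl | rfl)
    exacts [hn, ha, X.I.r.2.trans hn, ht]
  · intro a i
    by_cases h3 : a = 3
    · subst h3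
      rcases le_or_gt i t with h | h
      · refine (store_offset_le X h).trans_lt (lt_of_le_of_lt ?_ hnt)
        exact Nat.mul_le_mul_right _ h
      · simp [SteinerInput.store, SteinerInput.offsets,
          List.getElem?_eq_none (l := List.range (t + 1)) (i := i) (by simpa using h)]
    by_cases h4 : a = 4
    · subst h4
      rw [store_bags]
      refine getD_zero_lt h0 ?_ i
      simp only [List.mem_map]
      rintro _ ⟨e, -, rfl⟩; exact e.2.trans hn
    refine getD_zero_lt h0 ?_ i
    rcases a with _ | _ | _ | _ | _ | _ | _ | a
    · simp only [List.getD_cons_zero, List.mem_map]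
      rintro _ ⟨e, -, rfl⟩; exact e.1.2.trans hn
    · simp only [List.getD_cons_zero, List.getD_cons_succ, List.mem_map]
      rintro _ ⟨e, -, rfl⟩; exact e.2.2.trans hn
    · simp only [List.getD_cons_zero, List.getD_cons_succ, List.mem_ofFn]
      rintro _ ⟨e, rfl⟩; split_ifs <;> lia
    · exact absurd rfl h3
    · exact absurd rfl h4
    · simp only [List.getD_cons_zero, List.getD_cons_succ, List.mem_map]
      rintro _ ⟨e, -, rfl⟩; exact e.1.2.trans ht
    · simp only [List.getD_cons_zero, List.getD_cons_succ, List.mem_map]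
      rintro _ ⟨e, -, rfl⟩; exact e.2.2.trans ht
    · simp

end SteinerProg

/-! ### The preprocessing of the bags and of the arcs -/

namespace SteinerProg

open RAM RAM.Prog SteinerDP SteinerDP.Net TreePeel

set_option linter.unusedSimpArgs false

variable {n t m W : ℕ} {X : SteinerInput n t} {s : Store}

theorem Room.mono {m' : ℕ} (hR : Room W n t m) (h : m' ≤ m) : Room W n t m' :=
  ⟨hR.const, hR.pos, hR.arc, hR.link,
    (Nat.mul_le_mul_left _ (Nat.pow_le_pow_right (by norm_num) h)).trans hR.tab⟩

/-- The positions in the bag of `y` are entered, and other entries of the array are not changed. -/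
theorem runs_posLoop (hR : Room W n t m) (hin : Input X s) (hs : s.FitsIn W) {y : ℕ} (hy : y < t)
    (h10 : s.word 10 = y) (h11 : s.word 11 = s.wmem 3 y)
    (h12 : s.word 12 = (X.bagList y).length) (hm : (X.bagList y).length ≤ m)
    (h9 : ∀ v < n, s.wmem 9 (y * n + v) = 0) :
    Runs W posLoop s (m * 60 + 6) (fun s' =>
      (∀ v < n, s'.wmem 9 (y * n + v) =
        if v ∈ X.bagList y then (X.bagList y).idxOf v + 1 else 0) ∧
      ∀ a, (∀ v < n, a ≠ y * n + v) → s'.wmem 9 a = s.wmem 9 a) := by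
  refine (Runs.forLoop (N := (X.bagList y).length) (B := 52) (fun j s' =>
    (∀ v < n, s'.wmem 9 (y * n + v) =
        if v ∈ (X.bagList y).take j then (X.bagList y).idxOf v + 1 else 0) ∧
      ∀ a, (∀ v < n, a ≠ y * n + v) → s'.wmem 9 a = s.wmem 9 a) hs hR.one_lt h12 rfl rfl rfl
    ⟨by simpa using h9, fun _ _ => rfl⟩ ?_ fun s' _ _ h => h).mono
      (by nlinarith) fun s' h => by rwa [List.take_length] at h
  rintro j s₁ hj hf hs₁ h13 ⟨hI, hI'⟩
  have hin₁ := hin.frame hf rfl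
  have hv := hin₁.elem y hy.le j hj
  have ha := hin₁.addr y hy.le
  have hvn := getElem_lt X hj
  have hidx := idxOf_getElem X hj
  have e0 := hin₁.hn
  have e10 : s₁.word 10 = y := (hf.word 10 rfl).trans h10
  have e11 : s₁.word 11 = s₁.wmem 3 y := by rw [hf.word 11 rfl, hf.wmem 3 rfl, h11]
  have hpos := hR.pos
  have hyn := hR.mul_add_lt hy.le hvn
  simp_rw [List.take_succ_eq_append_getElem hj, List.mem_append, List.mem_singleton]
  obtain ⟨u, hu⟩ : ∃ u, (X.bagList y)[j] = u := ⟨_, rfl⟩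
  simp only [hu] at *
  refine Runs.of_run rfl hs₁ ?_ (by decide) ?_
  · have := hR.const
    have h1 : y * n ≤ t * n := Nat.mul_le_mul_right _ hy.le
    have h2 : (t + 2) * (n + 2) = t * n + 2 * t + 2 * n + 4 := by ring
    have h3 : (X.bagList y).length ≤ n := by
      rw [bagList_eq X hy, List.length_map]; exact length_bag_le X _
    simp [Prog.Safe, Prog.run, h13, e10, e11, e0, hv]
    and_intros <;> lia
  · simp only [Prog.run, Store.setW_wmem]
    have e : ∀ a, ((Prog.storeWord 9 (.reg 10 * .reg 0 + .load 4 (.reg 11 + .reg 13))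
        (.reg 13 + 1)).run s₁).wmem 9 a = if a = y * n + u then j + 1 else s₁.wmem 9 a := by
      intro a
      simp [Prog.run, h13, e10, e11, e0, hv, Function.update_apply]
    simp only [Prog.run] at e
    simp only [e]
    constructor
    · intro v hvn'
      simp only [Nat.add_left_cancel_iff, hI v hvn']
      by_cases h : v = u
      · subst h; simp [hidx]
      · simp [h]
    · intro a ha'
      rw [if_neg (ha' u hvn), hI' a ha']

theorem runs_bag (hR : Room W n t m) (hin : Input X s) (hs : s.FitsIn W)
    (hm : ∀ y, (X.bagList y).length ≤ m) (h4 : s.word 4 = 0) (h8 : ∀ i, s.wmem 8 i = 0)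
    (h9 : ∀ i, s.wmem 9 i = 0) :
    Runs W bagProg s (t * (m * 60 + 150) + 6) (fun s' =>
      s'.word 4 ≤ m ∧ (∀ y, (X.bagList y).length ≤ s'.word 4) ∧
      (∀ y ≤ t, s'.wmem 8 y = (X.bagList y).length) ∧
      ∀ y ≤ t, ∀ v < n, s'.wmem 9 (y * n + v) =
        if v ∈ X.bagList y then (X.bagList y).idxOf v + 1 else 0) := by
  have hvirt : ∀ y, t ≤ y → X.bagList y = [] := X.net.virt
  have hne : ∀ y v y' v', y < y' → v < n → v' < n → y * n + v ≠ y' * n + v' := by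
    intro y v y' v' h hv hv'
    have := Nat.mul_le_mul_right n (show y + 1 ≤ y' from h)
    lia
  refine (Runs.forLoop (N := t) (B := m * 60 + 142) (fun i s' =>
    s'.word 4 ≤ m ∧ (∀ y < i, (X.bagList y).length ≤ s'.word 4) ∧
      (∀ y, s'.wmem 8 y = if y < i then (X.bagList y).length else 0) ∧
      (∀ y < i, ∀ v < n, s'.wmem 9 (y * n + v) =
        if v ∈ X.bagList y then (X.bagList y).idxOf v + 1 else 0) ∧
      ∀ y ≥ i, ∀ v < n, s'.wmem 9 (y * n + v) = 0) hs hR.one_lt hin.ht rfl rfl rfl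
    (by simp [h4, h8, h9]) ?_ fun s' _ _ h => h).mono (by lia) ?_
  · rintro y s₁ hy hf hs₁ h10 ⟨I4, I4', I8, I9, I9'⟩
    have hin₁ := hin.frame hf rfl
    have hoff := hin₁.off y hy
    have hmy := hm y
    have ht : t < 2 ^ W := by have := hs.1 3; rwa [hin.ht] at this
    refine (Runs.run_seq (B := m * 60 + 6) rfl hs₁ ?_ fun hs₂ hf₂ => ?_).mono
      (by have : bagHead.steps ≤ 100 := by decide
          lia) fun _ h => h
    · have := hR.ne_zero
      simp [bagHead, Prog.Safe, Prog.run, h10, hR.ne_zero]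
      lia
    have hin₂ := hin₁.frame hf₂ rfl
    refine (runs_posLoop hR hin₂ hs₂ hy ?_ ?_ ?_ hmy ?_).mono_frame hs₂ le_rfl ?_
    · rw [hf₂.word 10 rfl, h10]
    · by_cases h : s₁.word 4 < (X.bagList y).length <;>
        simp [bagHead, Prog.run, h10, hoff, h]
    · by_cases h : s₁.word 4 < (X.bagList y).length <;>
        simp [bagHead, Prog.run, h10, hoff, h]
    · rw [hf₂.wmem 9 rfl]
      exact I9' y le_rfl
    · intro s' hf' _ h
      have e4 : s'.word 4 = max (s₁.word 4) (X.bagList y).length := by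
        rw [hf'.word 4 rfl]
        by_cases h : s₁.word 4 < (X.bagList y).length
        · simp [bagHead, Prog.run, h10, hoff, h, h.le]
        · simp [bagHead, Prog.run, h10, hoff, h, not_lt.1 h]
      have e8 : ∀ z, s'.wmem 8 z = if z = y then (X.bagList y).length else s₁.wmem 8 z := by
        intro z
        rw [hf'.wmem 8 rfl]
        by_cases h : s₁.word 4 < (X.bagList y).length <;>
          simp [bagHead, Prog.run, h10, hoff, h, Function.update_apply]
      have e9 := hf₂.wmem 9 rfl
      simp only [Store.setW_wmem, Store.setW_word, show (4 : ℕ) ≠ 10 by decide, if_false]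
      refine ⟨by lia, fun z hz => ?_, fun z => ?_, fun z hz v hv => ?_, fun z hz v hv => ?_⟩
      · rcases Nat.lt_succ_iff_lt_or_eq.1 hz with hz | rfl
        · have := I4' z hz
          lia
        · lia
      · rw [e8, I8]
        by_cases h : z = y
        · subst h; simp
        · rw [if_neg h]
          congr 1
          exact propext ⟨fun h' => by lia, fun h' => by lia⟩
      · rcases Nat.lt_succ_iff_lt_or_eq.1 hz with hz | rfl
        · rw [h.2 _ fun v' hv' => hne z v y v' hz hv hv', e9, I9 z hz v hv]
        · exact h.1 v hv
      · rw [h.2 _ fun v' hv' => (hne y v' z v hz hv' hv).symm, e9, I9' z (by lia) v hv]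
  · rintro s' ⟨h1, h2, h3, h4, h5⟩
    refine ⟨h1, fun y => ?_, fun y hy => ?_, fun y hy => ?_⟩
    · rcases lt_or_ge y t with h | h
      · exact h2 y h
      · simp [hvirt y h]
    · rw [h3]
      rcases hy.lt_or_eq with h | rfl
      · simp [h]
      · simp [hvirt y le_rfl]
    · rcases hy.lt_or_eq with h | rfl
      · exact h4 y h
      · simpa [hvirt y le_rfl] using h5 y le_rfl

theorem runs_pow (hR : Room W n t m) (hin : Input X s) (hs : s.FitsIn W) (h4 : s.word 4 = m) :
    Runs W powProg s (m * 60 + 100) (fun s' => s'.word 5 = 4 ^ m ∧ s'.word 6 = t + 1 ∧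
      s'.word 7 = (t + 1) * 4 ^ m ∧ ∀ j ≤ m, s'.wmem 10 j = 4 ^ j) := by
  refine (Runs.run_seq (B := m * 50 + 6 + 50) rfl hs ?_ fun hs₂ hf₂ => ?_).mono
    (by have : Prog.steps (.storeWord 10 0 1 ;; .setWord 5 1) ≤ 20 := by decide
        lia) fun _ h => h
  · simp [Prog.Safe, Prog.run, hR.ne_zero]
  have hin₂ := hin.frame hf₂ rfl
  have g4 := (hf₂.word 4 rfl).trans h4
  have g5 : (Prog.run (.storeWord 10 0 1 ;; .setWord 5 1) s).word 5 = 1 := by simp [Prog.run]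
  have g10 : (Prog.run (.storeWord 10 0 1 ;; .setWord 5 1) s).wmem 10 0 = 1 := by simp [Prog.run]
  generalize Prog.run (.storeWord 10 0 1 ;; .setWord 5 1) s = s₂ at *
  refine Runs.seq hs₂ ((Runs.forLoop (N := m) (B := 42) (fun i s' =>
    s'.word 5 = 4 ^ i ∧ ∀ j ≤ i, s'.wmem 10 j = 4 ^ j) hs₂ hR.one_lt g4 rfl rfl rfl
    (by simp [g5, g10]) ?_ fun s' _ _ h => h).mono (by lia) fun _ h => h)
    fun s₃ hf₃ hs₃ ⟨i5, i10⟩ => ?_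
  · rintro i s₁ hi hf hs₁ h10 ⟨I5, I10⟩
    refine Runs.of_run rfl hs₁ ?_ (by decide) ⟨?_, ?_⟩
    · have h1 := hR.tab
      have h2 : 4 ^ (i + 1) ≤ 4 ^ m := Nat.pow_le_pow_right (by norm_num) hi
      rw [pow_succ] at h2
      have h3 : (3 * t + 8) * 4 ^ m = 3 * t * 4 ^ m + 8 * 4 ^ m := by ring
      have h4 : i < 4 ^ i := Nat.lt_pow_self (by norm_num)
      have := hR.const
      simp [Prog.Safe, Prog.run, h10, I5, hR.ne_zero]
      and_intros <;> lia
    · simp [Prog.run, I5, pow_succ]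
    · intro j hj
      by_cases e : j = i + 1
      · subst e; simp [Prog.run, I5, h10, pow_succ]
      · simp [Prog.run, h10, e, I10 j (by lia)]
  · have g3 := (hin₂.frame hf₃ rfl).ht
    refine Runs.of_run rfl hs₃ ?_ (by decide) ⟨?_, ?_, ?_, ?_⟩
    · have h1 := hR.table_lt (i := t) (by lia)
      have h3 := hR.table_lt (i := t + 1) (by lia)
      have h4 : (t + 1 + 1) * 4 ^ m = (t + 1) * 4 ^ m + 4 ^ m := by ring
      have h2 : 0 < 4 ^ m := by positivity
      have h5 := hR.link
      simp [Prog.Safe, Prog.run, g3, i5, hR.ne_zero]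
      and_intros
      · nlinarith
      · lia
    · simp [Prog.run, i5]
    · simp [Prog.run, g3]
    · simp [Prog.run, g3, i5]
    · simpa [Prog.run] using i10

theorem runs_arc (hR : Room W n t m) (hin : Input X s) (hs : s.FitsIn W)
    (h11 : ∀ i, s.wmem 11 i = 0) :
    Runs W arcProg s (X.arcs.length * 60 + 6) (fun s' => ∀ u < n, ∀ v < n,
      s'.wmem 11 (u * n + v) = 1 ↔ X.net.adj u v) := by
  refine (Runs.forLoop (N := X.arcs.length) (B := 52) (fun i s' => ∀ u v : Fin n,
    s'.wmem 11 (u * n + v) = 1 ↔ (u, v) ∈ X.arcs.take i) hs hR.one_lt hin.ha rfl rfl rfl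
    (by simp [h11]) ?_ fun s' _ _ h => h).mono (by lia) ?_
  · intro i s₁ hi hf hs₁ h10 hI
    have hin₁ := hin.frame hf rfl
    have e1 := hin₁.tail i hi
    have e2 := hin₁.head i hi
    have e0 := hin₁.hn
    simp_rw [List.take_succ_eq_append_getElem hi, List.mem_append, List.mem_singleton]
    obtain ⟨⟨a, b⟩, he⟩ : ∃ e, X.arcs[i] = e := ⟨_, rfl⟩
    simp only [he] at *
    refine Runs.of_run rfl hs₁ ?_ (by decide) ?_
    · have h1 := hR.arc
      have h2 : (n + 2) * (n + 2) = n * n + 4 * n + 4 := by ring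
      have h3 : (a : ℕ) * n ≤ n * n := Nat.mul_le_mul_right _ a.2.le
      have := b.2
      simp [Prog.Safe, Prog.run, h10, e1, e2, e0, hR.ne_zero]
      and_intros <;> lia
    · intro u v
      have key : (u : ℕ) * n + v = a * n + b ↔ (u, v) = (a, b) := by
        constructor
        · intro h
          have h1 := congrArg (· % n) h
          have h2 := congrArg (· / n) h
          have hn : 0 < n := a.pos
          simp only [mul_comm _ n, Nat.mul_add_mod, Nat.mod_eq_of_lt v.2, Nat.mod_eq_of_lt b.2,
            Nat.mul_add_div hn, Nat.div_eq_of_lt v.2, Nat.div_eq_of_lt b.2, add_zero] at h1 h2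
          rw [Fin.ext h1, Fin.ext h2]
        · intro h
          rw [(Prod.mk.inj h).1, (Prod.mk.inj h).2]
      have := hI u v
      simp [Prog.run, h10, e1, e2, e0, Function.update_apply, key]
      grind
  · intro s' h u hu v hv
    have := h ⟨u, hu⟩ ⟨v, hv⟩
    rw [List.take_length, X.mem_arcs] at this
    simpa [SteinerInput.net, hu, hv] using this

end SteinerProg

/-! ### The elimination order -/

namespace SteinerProg

open RAM RAM.Prog SteinerDP SteinerDP.Net TreePeel SteinerInput

set_option linter.unusedSimpArgs false

variable {n t m W : ℕ} {X : SteinerInput n t} {s : Store}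

theorem nbSum_le {A : ℕ → ℕ → Prop} {g : ℕ → ℕ} {t b : ℕ} (hg : ∀ z < t, g z ≤ b) (y : ℕ) :
    nbSum A g (Finset.range t) y ≤ t * b := by
  classical
  rw [nbSum]
  refine (Finset.sum_le_sum_of_subset (Finset.filter_subset _ _)).trans ?_
  refine (Finset.sum_le_card_nsmul _ _ b fun z hz => hg z (Finset.mem_range.1 hz)).trans ?_
  simp

theorem sum_take_linkTerm_le (X : SteinerInput n t) {g : ℕ → ℕ} {b : ℕ} (hg : ∀ z < t, g z ≤ b)
    (i : ℕ) {y : ℕ} (hy : y < t) :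
    ((X.links.take i).map (linkTerm g y)).sum ≤ t * b :=
  (((List.take_sublist i X.links).map _).sum_le_sum fun _ _ => Nat.zero_le _).trans
    (X.sum_linkTerm g hy ▸ nbSum_le hg y)

/-- After all the tree edges have been entered, the arrays hold the numbers and the sums of the
neighbours. -/
theorem runs_link (hR : Room W n t m) (hin : Input X s) (hs : s.FitsIn W)
    (h12 : ∀ i, s.wmem 12 i = 0) (h13 : ∀ i, s.wmem 13 i = 0) :
    Runs W linkProg s (t * 100 + 20) (fun s' =>
      (∀ y < t, s'.wmem 12 y = nbSum X.treeAdj (fun _ => 1) (Finset.range t) y) ∧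
      (∀ y < t, s'.wmem 13 y = nbSum X.treeAdj (fun z => z) (Finset.range t) y) ∧
      s'.wmem 12 t = 0) := by
  have hlen := X.length_links
  refine (Runs.run_seq (B := X.links.length * 88 + 6) rfl hs ?_ fun hs₂ hf₂ => ?_).mono
    (by have : Prog.steps (.setWord 11 (.reg 3 - 1)) ≤ 10 := by decide
        lia) fun _ h => h
  · simp [Prog.Safe, hR.ne_zero]
  have hin₂ := hin.frame hf₂ rfl
  have g11 : (Prog.run (.setWord 11 (.reg 3 - 1)) s).word 11 = X.links.length := by
    simp [Prog.run, hin.ht]; lia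
  have g12 := hf₂.wmem 12 rfl
  have g13 := hf₂.wmem 13 rfl
  generalize Prog.run (.setWord 11 (.reg 3 - 1)) s = s₂ at *
  refine (Runs.forLoop (N := X.links.length) (B := 80) (fun i s' =>
    (∀ y, s'.wmem 12 y = ((X.links.take i).map (linkTerm (fun _ => 1) y)).sum) ∧
    ∀ y, s'.wmem 13 y = ((X.links.take i).map (linkTerm (fun z => z) y)).sum)
    hs₂ hR.one_lt g11 rfl rfl rfl (by simp [g12, g13, h12, h13]) ?_ fun s' _ _ h => h).mono
    (by lia) ?_
  · rintro i s₁ hi hf hs₁ h10 ⟨I12, I13⟩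
    have hin₁ := hin₂.frame hf rfl
    have e1 := hin₁.link₁ i hi
    have e2 := hin₁.link₂ i hi
    have hne : X.links[i].1 ≠ X.links[i].2 := by
      have : X.𝒯.tree.Adj X.links[i].1 X.links[i].2 :=
        (X.mem_links _ _).1 (List.mem_map.2 ⟨_, List.getElem_mem hi, rfl⟩)
      exact this.ne
    have b1 (y : Fin t) := sum_take_linkTerm_le X (g := fun _ => 1) (b := 1) (by simp) (i + 1) y.2
    have b2 (y : Fin t) := sum_take_linkTerm_le X (g := fun z => z) (b := t) (fun z hz => hz.le)
      (i + 1) y.2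
    simp only [List.take_succ_eq_append_getElem hi, List.map_append, List.sum_append,
      List.map_singleton, List.sum_singleton, ← I12, ← I13] at b1 b2 ⊢
    obtain ⟨⟨a, b⟩, he⟩ : ∃ e, X.links[i] = e := ⟨_, rfl⟩
    simp only [he] at *
    have hab : (a : ℕ) ≠ b := fun h => hne (Fin.ext h)
    have c1 := b1 a
    have c2 := b1 b
    have c3 := b2 a
    have c4 := b2 b
    simp [linkTerm, hab, hab.symm] at c1 c2 c3 c4
    refine Runs.of_run rfl hs₁ ?_ (by decide) ⟨fun y => ?_, fun y => ?_⟩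
    · have h1 := hR.link
      have h2 : (t + 2) * (t + 2) = t * t + 4 * t + 4 := by ring
      simp [linkBody, Prog.Safe, Prog.run, h10, e1, e2, hR.ne_zero, hab, hab.symm,
        Function.update_apply]
      and_intros <;> lia
    · by_cases h1 : y = a
      · subst h1
        simp [linkBody, Prog.run, h10, e1, e2, hab, hab.symm, Function.update_apply, linkTerm]
      · by_cases h2 : y = b
        · subst h2
          simp [linkBody, Prog.run, h10, e1, e2, hab, hab.symm, Function.update_apply, linkTerm]
        · simp [linkBody, Prog.run, h10, e1, e2, h1, h2, Ne.symm h1, Ne.symm h2,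
            Function.update_apply, linkTerm]
    · by_cases h1 : y = a
      · subst h1
        simp [linkBody, Prog.run, h10, e1, e2, hab, hab.symm, Function.update_apply, linkTerm]
      · by_cases h2 : y = b
        · subst h2
          simp [linkBody, Prog.run, h10, e1, e2, hab, hab.symm, Function.update_apply, linkTerm]
        · simp [linkBody, Prog.run, h10, e1, e2, h1, h2, Ne.symm h1, Ne.symm h2,
            Function.update_apply, linkTerm]
  · rintro s' ⟨I12, I13⟩
    rw [List.take_length] at I12 I13
    refine ⟨fun y hy => ?_, fun y hy => ?_, ?_⟩
    · rw [I12, X.sum_linkTerm _ hy]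
    · rw [I13, X.sum_linkTerm _ hy]
    · rw [I12, List.sum_eq_zero]
      simp only [List.mem_map]
      rintro _ ⟨e, -, rfl⟩
      simp [linkTerm, e.1.2.ne, e.2.2.ne]

/-- The queue contains exactly the nodes with at most one neighbour, without repetitions. -/
theorem runs_leaf (hR : Room W n t m) (hin : Input X s) (hs : s.FitsIn W) :
    Runs W leafProg s (t * 60 + 20) (fun s' => ∃ k, s'.word 13 = k ∧
      (∀ j < k, s'.wmem 14 j < t ∧ s.wmem 12 (s'.wmem 14 j) ≤ 1) ∧
      (∀ j < k, ∀ j' < k, s'.wmem 14 j = s'.wmem 14 j' → j = j') ∧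
      ∀ y < t, s.wmem 12 y ≤ 1 → ∃ j < k, s'.wmem 14 j = y) := by
  refine (Runs.run_seq (B := t * 58 + 6) rfl hs ?_ fun hs₂ hf₂ => ?_).mono
    (by have : Prog.steps (.setWord 13 0) ≤ 10 := by decide
        lia) fun _ h => h
  · simp [Prog.Safe]
  have hin₂ := hin.frame hf₂ rfl
  have g13 : (Prog.run (.setWord 13 0) s).word 13 = 0 := by simp [Prog.run]
  have g12 := hf₂.wmem 12 rfl
  generalize Prog.run (.setWord 13 0) s = s₂ at *
  refine (Runs.forLoop (N := t) (B := 50) (fun i s' => ∃ k, s'.word 13 = k ∧ k ≤ i ∧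
      (∀ j < k, s'.wmem 14 j < i ∧ s.wmem 12 (s'.wmem 14 j) ≤ 1) ∧
      (∀ j < k, ∀ j' < k, s'.wmem 14 j = s'.wmem 14 j' → j = j') ∧
      ∀ y < i, s.wmem 12 y ≤ 1 → ∃ j < k, s'.wmem 14 j = y)
    hs₂ hR.one_lt hin₂.ht rfl rfl rfl ⟨0, by simp [g13]⟩ ?_
    fun s' _ _ ⟨k, h1, _, h2⟩ => ⟨k, h1, h2⟩).mono (by lia) fun _ h => h
  rintro i s₁ hi hf hs₁ h10 ⟨k, h13, hki, I1, I2, I3⟩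
  have e12 : s₁.wmem 12 = s.wmem 12 := (hf.wmem 12 rfl).trans g12
  have ht : t < 2 ^ W := by have := hs.1 3; rwa [hin.ht] at this
  refine Runs.of_run rfl hs₁ ?_ (by decide) ?_
  · have := hR.const
    simp [Prog.Safe, Prog.run, h10, h13, hR.ne_zero]
    and_intros <;> lia
  · by_cases hd : s.wmem 12 i < 2
    · refine ⟨k + 1, by simp [Prog.run, h10, e12, hd, h13], by lia, ?_⟩
      have e14 : ∀ j, (Prog.run (.ite (.wlt (.load 12 (.reg 10)) 2)
          (.storeWord 14 (.reg 13) (.reg 10) ;; .setWord 13 (.reg 13 + 1)) .skip) s₁).wmem 14 j =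
          if j = k then i else s₁.wmem 14 j := by
        intro j
        simp [Prog.run, h10, e12, hd, h13, Function.update_apply]
      simp only [Store.setW_wmem, e14]
      refine ⟨fun j hj => ?_, fun j hj j' hj' h => ?_, fun y hy hy1 => ?_⟩
      · split_ifs with h
        · exact ⟨by lia, by lia⟩
        · have := I1 j (by lia)
          exact ⟨by lia, this.2⟩
      · split_ifs at h with h1 h2 h2
        · lia
        · have := (I1 j' (by lia)).1
          lia
        · have := (I1 j (by lia)).1
          lia
        · exact I2 j (by lia) j' (by lia) h
      · rcases Nat.lt_succ_iff_lt_or_eq.1 hy with hy | rfl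
        · obtain ⟨j, hj, e⟩ := I3 y hy hy1
          exact ⟨j, by lia, by rw [if_neg (by lia), e]⟩
        · exact ⟨k, by lia, by simp⟩
    · refine ⟨k, by simp [Prog.run, h10, e12, hd, h13], by lia, ?_⟩
      have e14 : (Prog.run (.ite (.wlt (.load 12 (.reg 10)) 2)
          (.storeWord 14 (.reg 13) (.reg 10) ;; .setWord 13 (.reg 13 + 1)) .skip) s₁).wmem 14 =
          s₁.wmem 14 := by
        simp [Prog.run, h10, e12, hd]
      simp only [Store.setW_wmem, e14]
      refine ⟨fun j hj => ⟨?_, (I1 j hj).2⟩, I2, fun y hy hy1 => ?_⟩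
      · have := (I1 j hj).1
        lia
      · rcases Nat.lt_succ_iff_lt_or_eq.1 hy with hy | rfl
        · exact I3 y hy hy1
        · lia

/-- The situation before the first leaf is removed. -/
theorem peeled_zero (X : SteinerInput n t) {k : ℕ} {q dg sm par : ℕ → ℕ}
    (hdg : ∀ y < t, dg y = nbSum X.treeAdj (fun _ => 1) (Finset.range t) y)
    (hsm : ∀ y < t, sm y = nbSum X.treeAdj (fun z => z) (Finset.range t) y)
    (hdt : dg t = 0) (hq : ∀ j < k, q j < t ∧ dg (q j) ≤ 1)
    (hinj : ∀ j < k, ∀ j' < k, q j = q j' → j = j')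
    (hall : ∀ y < t, dg y ≤ 1 → ∃ j < k, q j = y) :
    Peeled X.treeAdj t X.bagList 0 k q dg sm par := by
  have h0 : remaining t q 0 = Finset.range t := by ext; simp [mem_remaining]
  constructor
  · lia
  · exact fun j hj => (hq j hj).1
  · exact hinj
  · simp [h0]
  · rw [h0]; exact X.connOn_treeAdj
  · intro _
    rw [h0, X.sum_degrees, Finset.card_range]
  · rw [h0]; exact fun y hy => hdg y (Finset.mem_range.1 hy)
  · rw [h0]; exact fun y hy => hsm y (Finset.mem_range.1 hy)
  · exact fun j _ hj => (hq j hj).2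
  · rw [h0]
    intro y hy h1
    obtain ⟨j, hj, e⟩ := hall y (Finset.mem_range.1 hy) h1
    exact ⟨j, by lia, hj, e⟩
  · exact hdt
  · intro j hj; lia
  · intro j hj; lia

theorem runs_peel (hR : Room W n t m) (hin : Input X s) (hs : s.FitsIn W) {k : ℕ}
    (h13 : s.word 13 = k)
    (hP : Peeled X.treeAdj t X.bagList 0 k (s.wmem 14) (s.wmem 12) (s.wmem 13) (s.wmem 15)) :
    Runs W peelProg s (t * 120 + 6) (fun s' => ∃ k,
      Peeled X.treeAdj t X.bagList t k (s'.wmem 14) (s'.wmem 12) (s'.wmem 13) (s'.wmem 15)) := by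
  refine (Runs.forLoop (N := t) (B := 112) (fun i s' => ∃ k, s'.word 13 = k ∧
    Peeled X.treeAdj t X.bagList i k (s'.wmem 14) (s'.wmem 12) (s'.wmem 13) (s'.wmem 15))
    hs hR.one_lt hin.ht rfl rfl rfl ⟨k, by simpa using h13, hP⟩ ?_
    fun s' _ _ ⟨k, h⟩ => ⟨k, h.2⟩).mono
    (by lia) fun _ h => h
  rintro i s₁ hi hf hs₁ h10 ⟨k, h13, hI⟩
  have hin₁ := hin.frame hf rfl
  have ht := hin₁.ht
  have hkt := hI.le_t
  have htW : t < 2 ^ W := by have := hs.1 3; rwa [hin.ht] at this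
  have hk1 : k + 1 < 2 ^ W := by
    have := hR.link
    nlinarith
  obtain ⟨u, hu⟩ : ∃ u, u = s₁.wmem 14 i := ⟨_, rfl⟩
  obtain ⟨p, hp⟩ : ∃ p, p = if s₁.wmem 12 u = 1 then s₁.wmem 13 u else t := ⟨_, rfl⟩
  have hstep := hI.step X.treeAdj_symm X.not_treeAdj_self X.mem_bag_of_reach hi hu hp
  have hpW : p < 2 ^ W := by
    rw [hp]; split_ifs
    · exact hs₁.2 _ _
    · exact htW
  refine Runs.of_run rfl hs₁ ?_ (by decide) ?_
  · have := hR.const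
    by_cases h1 : s₁.wmem 12 u = 1
    · rw [if_pos h1] at hp
      simp [peelBody, Prog.Safe, Prog.run, h10, h13, ← hu, h1, ← hp, hR.ne_zero]
      exact fun _ => hk1
    · rw [if_neg h1] at hp
      subst hp
      simp [peelBody, Prog.Safe, Prog.run, h10, h13, ← hu, h1, ht, hR.ne_zero]
      exact fun _ => hk1
  · by_cases h2 : s₁.wmem 12 p - 1 = 1
    · refine ⟨k + 1, ?_, ?_⟩
      · by_cases h1 : s₁.wmem 12 u = 1
        · rw [if_pos h1] at hp
          simp [peelBody, Prog.run, h10, h13, ← hu, h1, ← hp, h2]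
        · rw [if_neg h1] at hp
          subst hp
          simp [peelBody, Prog.run, h10, h13, ← hu, h1, ht, h2]
      · convert hstep.1 h2 using 1 <;>
        · by_cases h1 : s₁.wmem 12 u = 1
          · rw [if_pos h1] at hp
            simp [peelBody, Prog.run, h10, h13, ← hu, h1, ← hp, h2]
          · rw [if_neg h1] at hp
            subst hp
            simp [peelBody, Prog.run, h10, h13, ← hu, h1, ht, h2]
    · refine ⟨k, ?_, ?_⟩
      · by_cases h1 : s₁.wmem 12 u = 1
        · rw [if_pos h1] at hp
          simp [peelBody, Prog.run, h10, h13, ← hu, h1, ← hp, h2]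
        · rw [if_neg h1] at hp
          subst hp
          simp [peelBody, Prog.run, h10, h13, ← hu, h1, ht, h2]
      · convert hstep.2 h2 using 1 <;>
        · by_cases h1 : s₁.wmem 12 u = 1
          · rw [if_pos h1] at hp
            simp [peelBody, Prog.run, h10, h13, ← hu, h1, ← hp, h2]
          · rw [if_neg h1] at hp
            subst hp
            simp [peelBody, Prog.run, h10, h13, ← hu, h1, ht, h2]

/-- After the last step only the virtual node is left. -/
theorem alive_iff {A : ℕ → ℕ → Prop} {bag : ℕ → List ℕ} {k : ℕ} {q dg sm par : ℕ → ℕ}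
    (h : Peeled A t bag t k q dg sm par) (y : ℕ) : Alive t q t y ↔ y = t := by
  have h0 : remaining t q t = ∅ := Finset.card_eq_zero.1 (by have := h.card; lia)
  constructor
  · rintro ⟨hy, hq⟩
    rcases hy.lt_or_eq with hy | hy
    · have : y ∈ remaining t q t := mem_remaining.2 ⟨hy, hq⟩
      simp [h0] at this
    · exact hy
  · rintro rfl
    exact ⟨le_rfl, fun j hj e => (h.lt j (hj.trans_le h.le)).ne e⟩

end SteinerProg

/-! ### Correctness and running time -/

namespace SteinerProg

open RAM RAM.Prog SteinerDP SteinerDP.Net TreePeel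

variable {n t m W : ℕ} {X : SteinerInput n t} {s : Store}

/-- The program solves the instance in time `O(t * 4 ^ m * (m + 1) ^ 2)`, plus linear time for the
arcs, if the bags have at most `m` elements. -/
theorem runs_main (hR : Room W n t m) (hm : ∀ y, (X.bagList y).length ≤ m) :
    Runs W mainProg X.store (3000 * ((t + 1) * (4 ^ m * (m + 1) ^ 2)) + X.arcs.length * 60)
      X.I.SolvedBy := by
  have hin := input_store X
  have hs := store_fitsIn hR X
  have h0 (a : ℕ) (ha : 7 ≤ a) (i : ℕ) := store_wmem X ha i
  have hr (i : ℕ) := store_rmem X le_rfl i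
  refine (Runs.seq hs (runs_bag hR hin hs hm (store_word X le_rfl) (h0 8 (by lia))
    (h0 9 (by lia))) (B' := (m * 60 + 100) + ((X.arcs.length * 60 + 6) + ((t * 100 + 20) +
      ((t * 60 + 20) + ((t * 120 + 6) + (((t + 1) * 100 + 6) +
      (((t + 1) * 4 ^ m * (m * (m * 60 + 100) + 100) + 6) +
      ((t * (4 ^ m * (m * 250 + 500) + 208) + 10) +
      ((t + 1) * 4 ^ m * (m * 100 + 300) + 200)))))))))
    fun s₁ hf₁ hs₁ ⟨b1, b2, b3, b4⟩ => ?_).mono ?_ fun _ h => h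
  · obtain ⟨m', hm'⟩ : ∃ m', s₁.word 4 = m' := ⟨_, rfl⟩
    rw [hm'] at b1 b2
    have hR' := hR.mono b1
    have hpow : 4 ^ m' ≤ 4 ^ m := Nat.pow_le_pow_right (by norm_num) b1
    have hin₁ := hin.frame hf₁ rfl
    refine Runs.seq hs₁ ((runs_pow hR' hin₁ hs₁ hm').mono (by lia) fun _ h => h)
      fun s₂ hf₂ hs₂ ⟨p1, p2, p3, p4⟩ => ?_
    have hin₂ := hin₁.frame hf₂ rfl
    refine Runs.seq hs₂ (runs_arc hR' hin₂ hs₂ ?_) fun s₃ hf₃ hs₃ h11 => ?_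
    · rw [hf₂.wmem 11 rfl, hf₁.wmem 11 rfl]; exact h0 11 (by lia)
    have hin₃ := hin₂.frame hf₃ rfl
    have henv : Env X W m' s₃ := by
      refine ⟨hin₃.hn, hin₃.hr, hin₃.ht, ?_, ?_, ?_, b2, hin₃.term, ?_, hin₃.elem, ?_, ?_, ?_,
        h11, hin₃.cost⟩
      · rw [hf₃.word 5 rfl, p1]
      · rw [hf₃.word 6 rfl, p2]
      · rw [hf₃.word 7 rfl, p3]
      · intro y hy j hj
        have h1 := hin₃.addr y hy
        have h2 := hR.pos
        have h3 : (t + 2) * (n + 2) = t * n + 2 * t + 2 * n + 4 := by ring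
        lia
      · rw [hf₃.wmem 8 rfl, hf₂.wmem 8 rfl]; exact b3
      · rw [hf₃.wmem 9 rfl, hf₂.wmem 9 rfl]; exact b4
      · rw [hf₃.wmem 10 rfl]; exact p4
    refine Runs.seq hs₃ (runs_link hR' hin₃ hs₃ ?_ ?_) fun s₄ hf₄ hs₄ ⟨l1, l2, l3⟩ => ?_
    · rw [hf₃.wmem 12 rfl, hf₂.wmem 12 rfl, hf₁.wmem 12 rfl]; exact h0 12 (by lia)
    · rw [hf₃.wmem 13 rfl, hf₂.wmem 13 rfl, hf₁.wmem 13 rfl]; exact h0 13 (by lia)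
    have hin₄ := hin₃.frame hf₄ rfl
    have henv₄ := henv.frame hf₄ rfl
    refine Runs.seq hs₄ (runs_leaf hR' hin₄ hs₄) fun s₅ hf₅ hs₅ ⟨k, q0, q1, q2, q3⟩ => ?_
    have hin₅ := hin₄.frame hf₅ rfl
    have henv₅ := henv₄.frame hf₅ rfl
    refine Runs.seq hs₅ (runs_peel hR' hin₅ hs₅ q0 ?_) fun s₆ hf₆ hs₆ ⟨k', hP⟩ => ?_
    · rw [hf₅.wmem 12 rfl, hf₅.wmem 13 rfl]
      exact peeled_zero X l1 l2 l3 q1 q2 q3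
    have henv₆ := henv₅.frame hf₆ rfl
    refine Runs.seq hs₆ (runs_cur hR' henv₆ hs₆) fun s₇ hf₇ hs₇ hcur => ?_
    have henv₇ := henv₆.frame hf₇ rfl
    refine Runs.seq hs₇ ((runs_base hR' henv₇ hs₇ ?_ ?_).mono ?_ fun _ h => h)
      fun s₈ hf₈ hs₈ ⟨hok, htab⟩ => ?_
    · rw [hf₇.wmem 16 rfl, hf₆.wmem 16 rfl, hf₅.wmem 16 rfl, hf₄.wmem 16 rfl, hf₃.wmem 16 rfl,
        hf₂.wmem 16 rfl, hf₁.wmem 16 rfl]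
      exact h0 16 (by lia)
    · rw [hf₇.rmem 1 rfl, hf₆.rmem 1 rfl, hf₅.rmem 1 rfl, hf₄.rmem 1 rfl, hf₃.rmem 1 rfl,
        hf₂.rmem 1 rfl, hf₁.rmem 1 rfl]
      exact hr
    · gcongr
    have henv₈ := henv₇.frame hf₈ rfl
    rw [← hf₇.wmem 14 rfl, ← hf₇.wmem 15 rfl, ← hf₈.wmem 14 rfl, ← hf₈.wmem 15 rfl] at hP
    refine Runs.seq hs₈ ((runs_merge hR' henv₈ hs₈ hP hok ?_ htab).mono ?_ fun _ h => h)
      fun s₉ hf₉ hs₉ ⟨N, S, hM⟩ => ?_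
    · rw [hf₈.wmem 19 rfl]; exact hcur
    · gcongr
    refine (runs_finish hR' (henv₈.frame hf₉ rfl) hs₉ (alive_iff hP) hM ?_ ?_).mono ?_ fun _ h => h
    · rw [hf₉.wmem 20 rfl, hf₈.wmem 20 rfl, hf₇.wmem 20 rfl, hf₆.wmem 20 rfl, hf₅.wmem 20 rfl,
        hf₄.wmem 20 rfl, hf₃.wmem 20 rfl, hf₂.wmem 20 rfl, hf₁.wmem 20 rfl]
      exact h0 20 (by lia)
    · rw [hf₉.wmem 7 rfl, hf₈.wmem 7 rfl, hf₇.wmem 7 rfl, hf₆.wmem 7 rfl, hf₅.wmem 7 rfl,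
        hf₄.wmem 7 rfl, hf₃.wmem 7 rfl, hf₂.wmem 7 rfl, hf₁.wmem 7 rfl]
      exact h0 7 (by lia)
    · gcongr
  · have hE : 1 ≤ 4 ^ m := Nat.one_le_pow _ _ (by norm_num)
    generalize 4 ^ m = E at *
    obtain ⟨T, hT⟩ : ∃ T, T = t + 1 := ⟨_, rfl⟩
    obtain ⟨G, hG⟩ : ∃ G, G = (m + 1) ^ 2 := ⟨_, rfl⟩
    have hG1 : m + 1 ≤ G := by rw [hG]; nlinarith
    have hG2 : m * m ≤ G := by rw [hG]; nlinarith
    have hEG : G ≤ E * G := Nat.le_mul_of_pos_left _ hE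
    have hEG' : E ≤ E * G := Nat.le_mul_of_pos_right _ (by lia)
    have hEm : E * m ≤ E * G := Nat.mul_le_mul_left _ (by lia)
    have hEmm : E * (m * m) ≤ E * G := Nat.mul_le_mul_left _ hG2
    rw [← hT, ← hG]
    generalize E * G = H at *
    have hTH : T ≤ T * H := Nat.le_mul_of_pos_right _ (by lia)
    have hTH' : H ≤ T * H := Nat.le_mul_of_pos_left _ (by lia)
    have hTm : T * m ≤ T * H := Nat.mul_le_mul_left _ (by lia)
    have h1 : T * E ≤ T * H := Nat.mul_le_mul_left _ hEG'
    have h2 : T * (E * m) ≤ T * H := Nat.mul_le_mul_left _ hEm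
    have h3 : T * (E * (m * m)) ≤ T * H := Nat.mul_le_mul_left _ hEmm
    have e1 : t * (m * 60 + 150) ≤ 60 * (T * m) + 150 * T := by
      refine (Nat.mul_le_mul_right _ (show t ≤ T by lia)).trans (le_of_eq ?_); ring
    have e2 : T * E * (m * (m * 60 + 100) + 100) =
        60 * (T * (E * (m * m))) + 100 * (T * (E * m)) + 100 * (T * E) := by ring
    have e3 : t * (E * (m * 250 + 500) + 208) ≤
        250 * (T * (E * m)) + 500 * (T * E) + 208 * T := by
      refine (Nat.mul_le_mul_right _ (show t ≤ T by lia)).trans (le_of_eq ?_); ring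
    have e4 : T * E * (m * 100 + 300) = 100 * (T * (E * m)) + 300 * (T * E) := by ring
    have h4 : 1 ≤ T := by lia
    lia

/-- Every arc lies in a bag. -/
theorem length_arcs_le_bags (X : SteinerInput n t) (hm : ∀ y, (X.𝒯.bag y).card ≤ m) :
    X.arcs.length ≤ t * m ^ 2 := by
  classical
  rw [← List.toFinset_card_of_nodup X.arcs_nodup]
  have hsub : X.arcs.toFinset ⊆ Finset.univ.biUnion fun y => X.𝒯.bag y ×ˢ X.𝒯.bag y := by
    rintro ⟨u, v⟩ h
    rw [List.mem_toFinset, X.mem_arcs] at h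
    obtain ⟨y, h1, h2⟩ := X.𝒯.edge u v (by
      rw [Digraph.toSimpleGraphInclusive, SimpleGraph.fromRel_adj]
      refine ⟨fun e => ?_, .inl h⟩
      rw [e] at h
      exact X.I.acyclic _ (.single h))
    exact Finset.mem_biUnion.2 ⟨y, Finset.mem_univ _, Finset.mem_product.2 ⟨h1, h2⟩⟩
  refine (Finset.card_le_card hsub).trans (Finset.card_biUnion_le.trans ?_)
  refine (Finset.sum_le_card_nsmul _ _ (m ^ 2) fun y _ => ?_).trans (by simp)
  rw [Finset.card_product, sq]
  exact Nat.mul_le_mul (hm y) (hm y)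

/-- The slack between `4 ^ w` and `5 ^ w` absorbs the time that is spent on a single state. -/
theorem four_pow_mul_sq_le (w : ℕ) : 4 ^ (w + 1) * (w + 2) ^ 2 ≤ 100 * 5 ^ w := by
  rcases lt_or_ge w 7 with h | h
  · interval_cases w <;> norm_num
  · induction w, h using Nat.le_induction with
    | base => norm_num
    | succ w hw ih =>
      have h1 : 4 * (w + 3) ^ 2 ≤ 5 * (w + 2) ^ 2 := by nlinarith
      calc 4 ^ (w + 1 + 1) * (w + 1 + 2) ^ 2 = 4 ^ (w + 1) * (4 * (w + 3) ^ 2) := by ring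
        _ ≤ 4 ^ (w + 1) * (5 * (w + 2) ^ 2) := Nat.mul_le_mul_left _ h1
        _ = 5 * (4 ^ (w + 1) * (w + 2) ^ 2) := by ring
        _ ≤ 5 * (100 * 5 ^ w) := Nat.mul_le_mul_left _ ih
        _ = 100 * 5 ^ (w + 1) := by ring

/-- A word length of `O(w + log n)` suffices. -/
theorem room_of_le {κ K n t w : ℕ} (hn : 1 ≤ n) (ht : t ≤ κ * n) (hK : 2 * κ + 10 ≤ K) :
    Room (K * (w + Nat.log 2 n + 1)) n t (w + 1) := by
  obtain ⟨a, ha⟩ : ∃ a, a = 2 ^ (κ + 1) := ⟨_, rfl⟩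
  obtain ⟨b, hb⟩ : ∃ b, b = 2 ^ (Nat.log 2 n + 1) := ⟨_, rfl⟩
  obtain ⟨c, hc⟩ : ∃ c, c = 4 ^ (w + 1) := ⟨_, rfl⟩
  have ha' : κ + 2 ≤ a := by rw [ha]; exact Nat.lt_two_pow_self
  have hb' : n < b := hb ▸ Nat.lt_pow_succ_log_self (by norm_num) n
  have hc' : 4 ≤ c := by
    rw [hc, pow_succ]
    exact Nat.le_mul_of_pos_left _ (by positivity)
  have hW : 16 * (a ^ 2 * b ^ 2 * c) ≤ 2 ^ (K * (w + Nat.log 2 n + 1)) := by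
    have e : 16 * (a ^ 2 * b ^ 2 * c) =
        2 ^ (4 + 2 * (κ + 1) + 2 * (Nat.log 2 n + 1) + 2 * (w + 1)) := by
      have hc2 : c = 2 ^ (2 * (w + 1)) := by
        rw [hc, pow_mul]
        norm_num
      rw [ha, hb, hc2]
      ring
    rw [e]
    refine Nat.pow_le_pow_right (by norm_num) ?_
    have h1 : (2 * κ + 10) * (w + Nat.log 2 n + 1) ≤ K * (w + Nat.log 2 n + 1) :=
      Nat.mul_le_mul_right _ hK
    nlinarith
  have hab : a * b ≤ a ^ 2 * b ^ 2 := by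
    rw [← mul_pow]; exact Nat.le_self_pow (by norm_num) _
  have hb2 : b ^ 2 ≤ a ^ 2 * b ^ 2 := Nat.le_mul_of_pos_left _ (pow_pos (by lia) 2)
  have hab2 : a * b ^ 2 ≤ a ^ 2 * b ^ 2 :=
    Nat.mul_le_mul_right _ (Nat.le_self_pow (by norm_num) _)
  have hnn : n * n ≤ b ^ 2 := by nlinarith
  have htn : t + 2 ≤ a * n := by nlinarith
  obtain ⟨P, hP⟩ : ∃ P, P = a ^ 2 * b ^ 2 := ⟨_, rfl⟩
  rw [← hP] at hab hb2 hab2 hW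
  have hPc : P * 4 ≤ P * c := Nat.mul_le_mul_left _ hc'
  have hP4 : 4 ≤ P := by nlinarith
  constructor
  · lia
  · have : (t + 2) * (n + 2) ≤ (a * n) * (3 * n) := Nat.mul_le_mul htn (by lia)
    have h2 : (a * n) * (3 * n) = 3 * (a * (n * n)) := by ring
    have h3 : a * (n * n) ≤ a * b ^ 2 := Nat.mul_le_mul_left _ hnn
    lia
  · have : (n + 2) * (n + 2) ≤ (3 * n) * (3 * n) := Nat.mul_le_mul (by lia) (by lia)
    have h2 : (3 * n) * (3 * n) = 9 * (n * n) := by ring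
    lia
  · have : (t + 2) * (t + 2) ≤ (a * n) * (a * n) := Nat.mul_le_mul htn htn
    have h2 : (a * n) * (a * n) = a ^ 2 * (n * n) := by ring
    have h3 : a ^ 2 * (n * n) ≤ P := hP ▸ Nat.mul_le_mul_left _ hnn
    lia
  · have h1 : 3 * t + 8 ≤ 8 * P := by
      have h2 : a * n ≤ a * b := Nat.mul_le_mul_left _ hb'.le
      lia
    rw [← hc]
    have h2 : (3 * t + 8) * c ≤ 8 * P * c := Nat.mul_le_mul_right _ h1
    have h3 : 8 * P * c = 8 * (P * c) := by ring
    lia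

end SteinerProg

/-- One program solves Node Weighted Directed Steiner Tree on acyclic digraphs with `n` vertices in
time `O(5 ^ w * w * n)`, on a machine whose words have `O(w + log n)` bits, if a tree decomposition
of width `w` (with `O(n)` nodes) of the underlying undirected graph is given. -/
theorem mainTheorem10 :
    ∃ P : RAM.Prog, ∀ κ : ℕ, ∃ K : ℕ, ∀ (n t w : ℕ) (X : SteinerInput n t),
      X.𝒯.width = w → t ≤ κ * n →
        X.store.FitsIn (K * (w + Nat.log 2 n + 1)) ∧
        ∃ (k : ℕ) (s : RAM.Store),
          RAM.Exec (K * (w + Nat.log 2 n + 1)) P X.store k s ∧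
          k ≤ K * (5 ^ w * max w 1 * n) ∧
          X.I.SolvedBy s := by
  refine ⟨SteinerProg.mainProg, fun κ => ⟨700000 * (κ + 1), fun n t w X hw ht => ?_⟩⟩
  have hn : 1 ≤ n := X.I.r.pos
  have hR : SteinerProg.Room (700000 * (κ + 1) * (w + Nat.log 2 n + 1)) n t (w + 1) :=
    SteinerProg.room_of_le hn ht (by lia)
  have hcard : ∀ y, (X.𝒯.bag y).card ≤ w + 1 := fun y => by
    have := Finset.le_sup (f := fun x => (X.𝒯.bag x).card) (Finset.mem_univ y)
    rw [TreeDecomposition.width] at hw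
    lia
  have hm : ∀ y, (X.bagList y).length ≤ w + 1 := fun y => by
    rcases lt_or_ge y t with h | h
    · rw [SteinerProg.bagList_eq X h, List.length_map, ← List.toFinset_card_of_nodup
        (X.bags_nodup _)]
      refine (Finset.card_le_card fun v hv => ?_).trans (hcard ⟨y, h⟩)
      exact (X.mem_bags _ _).1 (List.mem_toFinset.1 hv)
    · rw [show X.bagList y = [] from X.net.virt y h]
      simp
  obtain ⟨k, s, h1, h2, h3⟩ := SteinerProg.runs_main hR hm
  refine ⟨SteinerProg.store_fitsIn hR X, k, s, h1, h2.trans ?_, h3⟩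
  have harc := SteinerProg.length_arcs_le_bags X hcard
  have hslack := SteinerProg.four_pow_mul_sq_le w
  have ht1 : 1 ≤ t := by have := X.length_links; lia
  have hsq : (w + 1) ^ 2 ≤ 4 ^ (w + 1) * (w + 2) ^ 2 :=
    (Nat.pow_le_pow_left (by lia) 2).trans (Nat.le_mul_of_pos_left _ (by positivity))
  calc 3000 * ((t + 1) * (4 ^ (w + 1) * (w + 1 + 1) ^ 2)) + X.arcs.length * 60
      ≤ 3000 * ((2 * t) * (100 * 5 ^ w)) + t * (100 * 5 ^ w) * 60 := by
        gcongr
        · lia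
        · exact harc.trans (Nat.mul_le_mul_left _ (hsq.trans hslack))
    _ = 606000 * t * 5 ^ w := by ring
    _ ≤ 700000 * ((κ + 1) * n) * (5 ^ w * max w 1) := by
        gcongr
        · lia
        · exact ht.trans (Nat.mul_le_mul_right _ (by lia))
        · exact Nat.le_mul_of_pos_right _ (by lia)
    _ = 700000 * (κ + 1) * (5 ^ w * max w 1 * n) := by ring
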